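/- Let $H$ be a complex Hilbert space, $\omega>0$, and $\mathcal H=L^2([0,\omega],H)$ with the inner product $\frac1\omega\int_0^\omega\langle x(s),y(s)\rangle\,ds$. Let $\mathcal V:[0,\omega]\to B(H)$ be such that $s\mapsto\mathcal V(s)x$ is measurable and square integrable for every $x\in H$, and let $\widehat{\mathcal V}(n)\in B(H)$, $\widehat{\mathcal V}(n)x=\frac1\omega\int_0^\omega\mathcal V(s)x\,e^{-i2\pi ns/\omega}\,ds$, $n\in\mathbb Z$, be its Fourier coefficients. Assume that $$\sum_{n\in\mathbb Z}\|\widehat{\mathcal V}(n)\|^2<\infty\quad\text{and}\quad \sum_{j,\ell\in\mathbb Z}\Big\|\sum_{n\neq\ell}\frac{\widehat{\mathcal V}(j+n)\widehat{\mathcal V}(\ell+n)}{\ell-n}\Big\|^2<\infty .$$ Let $L$ be the operator $(Ly)(s)=y'(s)-\mathcal V(s)y(\omega-s)$ with domain $D(L)=\{y\in W_2^1([0,\omega],H): y(0)=y(\omega)\}$. For $\ell\in\mathbb Z$ and $m\in\mathbb Z_+=\{0,1,2,\dots\}$ put $$\lambda_\ell=\tfrac{i2\pi\ell}{\omega},\quad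 (P_\ell x)(s)=\widehat x(\ell)e^{\lambda_\ell s},\quad \widehat x(\ell)=\tfrac1\omega\int_0^\omega x(\tau)e^{-\lambda_\ell\tau}\,d\tau,\quad P_{(m)}=\sum_{|\ell|\le m}P_\ell,$$ $\mathcal H_\ell=\mathrm{Im}\,P_\ell$, $\mathcal H_{(m)}=\mathrm{Im}\,P_{(m)}$. Let $(S(t)x)(s)=x(t+s)$, $t\in\mathbb R$, be the translation group on $\mathcal H$, where elements of $\mathcal H$ are extended $\omega$-periodically. By a representation of the similar group we mean $(T,U,k,B_{(k)},(B_\ell)_{|\ell|>k})$ such that $T$ is a $C_0$-group on $\mathcal H$ with generator $L$; $U\in B(\mathcal H)$ is continuously invertible and $W=U-I$ satisfies $\sum_{j,\ell\in\mathbb Z}\|P_jWP_\ell\|^2<\infty$; $k\in\mathbb Z_+$; $B_{(k)}\in B(\mathcal H_{(k)})$; $B_\ell\in B(\mathcal H_\ell)$ for $|\ell|>k$, with $\sum_{|\ell|>k}\|B_\ell\|^2<\infty$; and the group $\widetilde T(t)=U^{-1}T(t)U$ satisfies, for all $t\in\mathbb R$, $$\widetilde T(t)=e^{tB_{(k)}}\oplus\bigoplus_{|\ell|>k}e^{t(\lambda_\ell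 I_\ell+B_\ell)}\qquad(\ast)$$ with respect to the orthogonal decomposition $\mathcal H=\mathcal H_{(k)}\oplus\bigoplus_{|\ell|>k}\mathcal H_\ell$, where $I_\ell$ is the identity on $\mathcal H_\ell$. Such a representation exists. Moreover, for every such representation there are entire functions $\Phi^l,\Phi^r:\mathbb C\to B(\mathcal H)$ of exponential type such that $$\widetilde T(t)=S(t)\Phi^r(t)=\Phi^l(t)S(t),\qquad t\in\mathbb R,$$ $\Phi^l(z)|\mathcal H_j=\Phi^r(z)|\mathcal H_j$ for all $|j|>k$ and $z\in\mathbb C$, and $$\max\{\|\Phi^l(z)\|,\|\Phi^r(z)\|\}\le e^{\beta|z|},\quad z\in\mathbb C,\qquad \beta=\sup\Big(\Big\{\frac{2\pi k}{\omega}+\|B_{(k)}\|\Big\}\cup\{\|B_j\|:|j|>k\}\Big).$$ -/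

import Mathlib

open MeasureTheory Filter Topology
open scoped ENNReal

namespace InvolutionGroup

noncomputable section

/-! ### The space `L²([0, ω], H)` -/

/-- Normalized Lebesgue measure on `[0, ω]`. The factor `1/ω` makes the inner product of
`Lp H 2 (μ ω)` equal to `(1/ω) ∫₀^ω ⟨x s, y s⟩ ds`. -/
def μ (ω : ℝ) : Measure ℝ := (ENNReal.ofReal ω)⁻¹ • volume.restrict (Set.Icc 0 ω)

instance isProbabilityMeasure_μ (ω : ℝ) [hω : Fact (0 < ω)] : IsProbabilityMeasure (μ ω) := by
  constructor
  have h : ENNReal.ofReal ω ≠ 0 := by simpa using hω.out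
  simp [μ, ENNReal.inv_mul_cancel h ENNReal.ofReal_ne_top]

/-- The Hilbert space `L²([0, ω], H)`. -/
abbrev L2 (ω : ℝ) (H : Type*) [NormedAddCommGroup H] : Type _ := Lp H 2 (μ ω)

variable {H : Type*} [NormedAddCommGroup H] [InnerProductSpace ℂ H] [CompleteSpace H]

/-! ### Fourier coefficients and the spectral projections of `d/ds` -/

/-- The eigenvalue `λ_ℓ = i 2πℓ/ω` of `d/ds`. -/
def eig (ω : ℝ) (ℓ : ℤ) : ℂ := Complex.I * (2 * Real.pi * ℓ / ω)

lemma norm_exp_eig (ω : ℝ) (ℓ : ℤ) (s : ℝ) : ‖Complex.exp (eig ω ℓ * s)‖ = 1 := by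
  have : eig ω ℓ * s = ((2 * Real.pi * ℓ / ω * s : ℝ) : ℂ) * Complex.I := by
    simp only [eig]; push_cast; ring
  rw [this, Complex.norm_exp_ofReal_mul_I]

lemma continuous_exp_eig (ω : ℝ) (ℓ : ℤ) :
    Continuous (fun s : ℝ => Complex.exp (eig ω ℓ * s)) := by fun_prop

lemma memLp_exp_eig_smul (ω : ℝ) (ℓ : ℤ) {f : ℝ → H} {p : ℝ≥0∞} (hf : MemLp f p (μ ω)) :
    MemLp (fun s : ℝ => Complex.exp (eig ω ℓ * s) • f s) p (μ ω) := by
  refine hf.of_le ((continuous_exp_eig ω ℓ).aestronglyMeasurable.smul hf.1) ?_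
  exact Eventually.of_forall fun s => by rw [norm_smul, norm_exp_eig, one_mul]

/-- The `ℓ`-th Fourier coefficient `x ↦ (1/ω) ∫₀^ω x(τ) e^{-i2πℓτ/ω} dτ`, as a bounded operator. -/
def coeff (ω : ℝ) [Fact (0 < ω)] (ℓ : ℤ) : L2 ω H →L[ℂ] H :=
  LinearMap.mkContinuous
    { toFun := fun x => ∫ s, Complex.exp (eig ω (-ℓ) * s) • x s ∂(μ ω)
      map_add' := fun x y => by
        rw [← integral_add]
        · refine integral_congr_ae ?_
          filter_upwards [Lp.coeFn_add x y] with s hs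
          rw [hs, Pi.add_apply, smul_add]
        · exact (memLp_exp_eig_smul ω (-ℓ) (Lp.memLp x)).integrable (by norm_num)
        · exact (memLp_exp_eig_smul ω (-ℓ) (Lp.memLp y)).integrable (by norm_num)
      map_smul' := fun c x => by
        rw [RingHom.id_apply, ← integral_smul]
        refine integral_congr_ae ?_
        filter_upwards [Lp.coeFn_smul c x] with s hs
        rw [hs, Pi.smul_apply, smul_comm] }
    1 (fun x => by
      rw [one_mul]
      refine (norm_integral_le_lintegral_norm _).trans ?_
      refine ENNReal.toReal_mono (Lp.eLpNorm_ne_top x) ?_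
      calc ∫⁻ s, ENNReal.ofReal ‖Complex.exp (eig ω (-ℓ) * s) • x s‖ ∂(μ ω)
          = eLpNorm x 1 (μ ω) := by
            rw [eLpNorm_one_eq_lintegral_enorm]
            refine lintegral_congr fun s => ?_
            rw [norm_smul, norm_exp_eig, one_mul, ofReal_norm]
        _ ≤ eLpNorm x 2 (μ ω) :=
            eLpNorm_le_eLpNorm_of_exponent_le (by norm_num) (Lp.aestronglyMeasurable x))

/-- The map taking `h ∈ H` to the function `s ↦ e^{i2πℓs/ω} h`, as a bounded operator. -/
def character (ω : ℝ) [Fact (0 < ω)] (ℓ : ℤ) : H →L[ℂ] L2 ω H :=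
  LinearMap.mkContinuous
    { toFun := fun h => (memLp_exp_eig_smul ω ℓ (memLp_const (p := 2) (μ := μ ω) h)).toLp _
      map_add' := fun h h' => by
        rw [← MemLp.toLp_add]
        congr 1
        funext s
        simp [smul_add]
      map_smul' := fun c h => by
        rw [RingHom.id_apply, ← MemLp.toLp_const_smul]
        congr 1
        funext s
        simp [smul_comm c] }
    1 (fun h => by
      rw [one_mul]
      change ‖MemLp.toLp _ (memLp_exp_eig_smul ω ℓ (memLp_const (p := 2) (μ := μ ω) h))‖ ≤ _
      rw [Lp.norm_toLp]
      have h1 : eLpNorm (fun s : ℝ => Complex.exp (eig ω ℓ * s) • h) 2 (μ ω)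
          = eLpNorm (fun _ : ℝ => h) 2 (μ ω) :=
        eLpNorm_congr_norm_ae (Eventually.of_forall fun s => by
          rw [norm_smul, norm_exp_eig, one_mul])
      rw [h1, eLpNorm_const _ (by norm_num) (IsProbabilityMeasure.ne_zero _)]
      simp)

/-- The spectral projection `P_ℓ` of `d/ds`: `(P_ℓ x)(s) = x̂(ℓ) e^{i2πℓs/ω}`. -/
def P (ω : ℝ) [Fact (0 < ω)] (ℓ : ℤ) : L2 ω H →L[ℂ] L2 ω H :=
  (character ω ℓ).comp (coeff ω ℓ)

/-- The projection `P_(m) = ∑_{|ℓ| ≤ m} P_ℓ`. -/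
def PSum (ω : ℝ) [Fact (0 < ω)] (m : ℕ) : L2 ω H →L[ℂ] L2 ω H :=
  ∑ ℓ ∈ Finset.Icc (-(m : ℤ)) m, P ω ℓ

/-- The spectral subspace `H_ℓ = Im P_ℓ`. -/
def HSub (ω : ℝ) [Fact (0 < ω)] (H : Type*) [NormedAddCommGroup H] [InnerProductSpace ℂ H]
    [CompleteSpace H] (ℓ : ℤ) : Submodule ℂ (L2 ω H) :=
  LinearMap.range (P (H := H) ω ℓ).toLinearMap

/-- The subspace `H_(m) = Im P_(m)`. -/
def HSubSum (ω : ℝ) [Fact (0 < ω)] (H : Type*) [NormedAddCommGroup H] [InnerProductSpace ℂ H]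
    [CompleteSpace H] (m : ℕ) : Submodule ℂ (L2 ω H) :=
  LinearMap.range (PSum (H := H) ω m).toLinearMap

/-- The Hilbert–Schmidt class with respect to the resolution of the identity `{P_ℓ}`. -/
def IsHilbertSchmidt {ω : ℝ} [Fact (0 < ω)] (X : L2 ω H →L[ℂ] L2 ω H) : Prop :=
  Summable fun q : ℤ × ℤ => ‖(P ω q.1).comp (X.comp (P ω q.2))‖ ^ 2

/-! ### The potential -/

/-- The linear map `x ↦ 𝒱(·)x` from `H` to `L²`. -/
def potentialLin (ω : ℝ) [Fact (0 < ω)] (V : ℝ → H →L[ℂ] H)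
    (hV : ∀ x : H, MemLp (fun s => V s x) 2 (μ ω)) : H →ₗ[ℂ] L2 ω H where
  toFun := fun x => (hV x).toLp _
  map_add' := fun x y => by
    rw [← MemLp.toLp_add]
    congr 1
    funext s
    simp
  map_smul' := fun c x => by
    rw [RingHom.id_apply, ← MemLp.toLp_const_smul]
    congr 1
    funext s
    simp

/-- The bounded operator `x ↦ 𝒱(·)x` from `H` to `L²` (bounded by the closed graph theorem). -/
def potentialMap (ω : ℝ) [Fact (0 < ω)] (V : ℝ → H →L[ℂ] H)
    (hV : ∀ x : H, MemLp (fun s => V s x) 2 (μ ω)) : H →L[ℂ] L2 ω H where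
  toLinearMap := potentialLin ω V hV
  cont := by
    refine LinearMap.continuous_of_seq_closed_graph (potentialLin ω V hV) fun u x y hu hy => ?_
    have hm := tendstoInMeasure_of_tendsto_Lp hy
    obtain ⟨ns, hns, hae⟩ := hm.exists_seq_tendsto_ae
    refine Lp.ext ?_
    have hall : ∀ᵐ s ∂(μ ω), ∀ n, ((hV (u n)).toLp _ : ℝ → H) s = V s (u n) :=
      ae_all_iff.2 fun n => MemLp.coeFn_toLp (hV (u n))
    filter_upwards [hae, hall, MemLp.coeFn_toLp (hV x)] with s h1 h2 h3
    refine tendsto_nhds_unique h1 ?_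
    have h4 : Tendsto (fun i => V s (u (ns i))) atTop (𝓝 (V s x)) :=
      ((V s).continuous.tendsto x).comp (hu.comp hns.tendsto_atTop)
    simp only [Function.comp_apply, potentialLin, LinearMap.coe_mk, AddHom.coe_mk, h2]
    rw [h3]
    exact h4

/-- The Fourier coefficient `𝒱^(n) ∈ B(H)`, `𝒱^(n)x = (1/ω) ∫₀^ω 𝒱(s)x e^{-i2πns/ω} ds`. -/
def potentialCoeff (ω : ℝ) [Fact (0 < ω)] (V : ℝ → H →L[ℂ] H)
    (hV : ∀ x : H, MemLp (fun s => V s x) 2 (μ ω)) (n : ℤ) : H →L[ℂ] H :=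
  (coeff ω n).comp (potentialMap ω V hV)

/-! ### The differential operator `(Ly)(s) = y'(s) - 𝒱(s)y(ω - s)` with periodic conditions -/

/-- `y` belongs to `W₂¹([0, ω], H)` with derivative `g ∈ L²` and `y(0) = y(ω)`: it has a
(continuous) representative `Y` that is the indefinite integral of `g`, and `Y 0 = Y ω`. -/
def IsPeriodicSobolev {ω : ℝ} (y g : L2 ω H) : Prop :=
  ∃ Y : ℝ → H, (y =ᵐ[μ ω] Y) ∧
    (∀ s ∈ Set.Icc 0 ω, Y s = Y 0 + ∫ τ in (0 : ℝ)..s, g τ) ∧ Y 0 = Y ω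

/-- The domain `D(L) = {y ∈ W₂¹ : y(0) = y(ω)}`. -/
def domL (ω : ℝ) (H : Type*) [NormedAddCommGroup H] [InnerProductSpace ℂ H]
    [CompleteSpace H] : Set (L2 ω H) :=
  {y | ∃ g : L2 ω H, IsPeriodicSobolev y g}

/-- `f = Ly` for `y ∈ D(L)`, where `(Ly)(s) = y'(s) - 𝒱(s)y(ω - s)`. -/
def IsImageL {ω : ℝ} (V : ℝ → H →L[ℂ] H) (y f : L2 ω H) : Prop :=
  ∃ g : L2 ω H, IsPeriodicSobolev y g ∧
    ∀ᵐ s ∂(μ ω), f s = g s - V s (y (ω - s))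

/-! ### Operator groups -/

/-- Strongly continuous one-parameter groups of bounded operators. -/
structure IsC0Group {E : Type*} [NormedAddCommGroup E] [NormedSpace ℂ E]
    (T : ℝ → E →L[ℂ] E) : Prop where
  zero : T 0 = 1
  add : ∀ s t, T (s + t) = T s * T t
  cont : ∀ x, Continuous fun t => T t x

/-- `L` is the infinitesimal generator of the `C₀`-group `T`: the derivative at `0` of `t ↦ T(t)y`
exists exactly for `y ∈ D(L)`, and then it is `Ly`. -/
structure IsGroupGeneratedByL {ω : ℝ} (V : ℝ → H →L[ℂ] H)
    (T : ℝ → L2 ω H →L[ℂ] L2 ω H) : Prop where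
  group : IsC0Group T
  dom : ∀ y : L2 ω H, y ∈ domL ω H ↔ ∃ f, HasDerivAt (fun t => T t y) f 0
  gen : ∀ y f : L2 ω H, HasDerivAt (fun t => T t y) f 0 → IsImageL V y f

/-- Translation by `t` on `[0, ω]` with wrap-around: the point of `(0, ω]` congruent to `t + s`
modulo `ω`. -/
def shift (ω : ℝ) [hω : Fact (0 < ω)] (t s : ℝ) : ℝ := toIocMod hω.out 0 (t + s)

lemma measurePreserving_shift (ω : ℝ) [hω : Fact (0 < ω)] (t : ℝ) :
    MeasurePreserving (shift ω t) (μ ω) (μ ω) := by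
  have h0 : volume.restrict (Set.Icc (0 : ℝ) ω) = volume.restrict (Set.Ioc (0 : ℝ) (0 + ω)) := by
    rw [zero_add]; exact (Measure.restrict_congr_set Ioc_ae_eq_Icc).symm
  have h1 : MeasurePreserving (shift ω t) (volume.restrict (Set.Ioc (0 : ℝ) (0 + ω)))
      (volume.restrict (Set.Ioc (0 : ℝ) (0 + ω))) :=
    (measurePreserving_subtype_coe measurableSet_Ioc).comp
      ((AddCircle.measurePreserving_equivIoc ω (a := 0)).comp
        ((measurePreserving_add_left volume (t : AddCircle ω)).comp
          (AddCircle.measurePreserving_mk ω 0)))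
  unfold μ
  rw [h0]
  exact h1.smul_measure _

/-- The translation group `(S(t)x)(s) = x(t + s)`, where `x` is extended `ω`-periodically. -/
def S (ω : ℝ) [Fact (0 < ω)] (t : ℝ) : L2 ω H →L[ℂ] L2 ω H :=
  (Lp.compMeasurePreservingₗᵢ ℂ (shift ω t) (measurePreserving_shift ω t)).toContinuousLinearMap

/-- The exponential `e^A` of a bounded operator. -/
def opExp {E : Type*} [NormedAddCommGroup E] [NormedSpace ℂ E] (A : E →L[ℂ] E) : E →L[ℂ] E :=
  NormedSpace.exp A

/-! ### Orthogonal direct sums and the similar group -/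

/-- The bounded operator `A` is the orthogonal direct sum of `A_(k) ∈ B(H_(k))` and
`A_ℓ ∈ B(H_ℓ)`, `|ℓ| > k`. (`HasSum` is unconditional convergence.) -/
structure IsDirectSum {ω : ℝ} [Fact (0 < ω)] (k : ℕ) (A : L2 ω H →L[ℂ] L2 ω H)
    (A₀ : HSubSum ω H k →L[ℂ] HSubSum ω H k)
    (A' : ∀ ℓ : {ℓ : ℤ // (k : ℤ) < |ℓ|}, HSub ω H ℓ →L[ℂ] HSub ω H ℓ) : Prop where
  restrict_center : ∀ x : HSubSum ω H k, A x = A₀ x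
  restrict_tail : ∀ (ℓ : {ℓ : ℤ // (k : ℤ) < |ℓ|}) (x : HSub ω H ℓ), A x = A' ℓ x
  hasSum : ∀ x : L2 ω H,
    HasSum (fun ℓ : {ℓ : ℤ // (k : ℤ) < |ℓ|} =>
        (A' ℓ ⟨P ω ℓ x, LinearMap.mem_range_self _ x⟩ : L2 ω H))
      (A x - A₀ ⟨PSum ω k x, LinearMap.mem_range_self _ x⟩)

/-- The group `T̃(t) = U⁻¹ T(t) U`. -/
def similarGroup {ω : ℝ} (T : ℝ → L2 ω H →L[ℂ] L2 ω H) (U : (L2 ω H →L[ℂ] L2 ω H)ˣ)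
    (t : ℝ) : L2 ω H →L[ℂ] L2 ω H :=
  (↑U⁻¹ : L2 ω H →L[ℂ] L2 ω H) * T t * (U : L2 ω H →L[ℂ] L2 ω H)

/-- `T` is the group generated by `L`, `U = I + W` with `W` Hilbert–Schmidt with respect to
`{P_ℓ}`, and `T̃(t) = U⁻¹T(t)U` is for every `t` the orthogonal direct sum of `e^{t B_(k)}` and
`e^{t(λ_ℓ I + B_ℓ)}`, `|ℓ| > k`, where `∑ ‖B_ℓ‖² < ∞`. -/
structure IsSimilarGroupData {ω : ℝ} [Fact (0 < ω)] (V : ℝ → H →L[ℂ] H)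
    (T : ℝ → L2 ω H →L[ℂ] L2 ω H) (U : (L2 ω H →L[ℂ] L2 ω H)ˣ) (k : ℕ)
    (B₀ : HSubSum ω H k →L[ℂ] HSubSum ω H k)
    (B : ∀ ℓ : {ℓ : ℤ // (k : ℤ) < |ℓ|}, HSub ω H ℓ →L[ℂ] HSub ω H ℓ) : Prop where
  generated : IsGroupGeneratedByL V T
  hilbertSchmidt : IsHilbertSchmidt ((U : L2 ω H →L[ℂ] L2 ω H) - 1)
  summable : Summable fun ℓ => ‖B ℓ‖ ^ 2
  directSum : ∀ t : ℝ, IsDirectSum k (similarGroup T U t)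
    (opExp ((t : ℂ) • B₀))
    (fun ℓ => opExp ((t : ℂ) • (eig ω ℓ • (1 : HSub ω H ℓ →L[ℂ] HSub ω H ℓ) + B ℓ)))

/-- The exponent `β = sup {2πk/ω + ‖B_(k)‖, ‖B_j‖, |j| > k}`. -/
def growthBound {ω : ℝ} [Fact (0 < ω)] (k : ℕ)
    (B₀ : HSubSum ω H k →L[ℂ] HSubSum ω H k)
    (B : ∀ ℓ : {ℓ : ℤ // (k : ℤ) < |ℓ|}, HSub ω H ℓ →L[ℂ] HSub ω H ℓ) : ℝ :=
  sSup (insert (2 * Real.pi * k / ω + ‖B₀‖) (Set.range fun ℓ => ‖B ℓ‖))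

/-- Entire functions of exponential type with values in a complex normed space. -/
def IsEntireOfExponentialType {E : Type*} [NormedAddCommGroup E] [NormedSpace ℂ E]
    (Φ : ℂ → E) : Prop :=
  Differentiable ℂ Φ ∧ ∃ C σ : ℝ, ∀ z, ‖Φ z‖ ≤ C * Real.exp (σ * ‖z‖)

end

end InvolutionGroup

namespace InvolutionGroup

noncomputable section

set_option linter.unusedSectionVars false

variable {H : Type*} [NormedAddCommGroup H] [InnerProductSpace ℂ H] [CompleteSpace H]
variable {ω : ℝ} [hω : Fact (0 < ω)]

/-! ### Fourier analysis of `H`-valued functions -/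

/-! In the basis of characters, `A = d/ds` with periodic boundary conditions is the diagonal matrix
with entries `λ_n`. Since `y(ω - s)` reverses frequencies, the perturbation `B` is the Hankel matrix
with entries `𝒱^(j + n)`. As its coefficients lie in `ℓ²`, the product of `B` with `R = (A - κ)⁻¹`
is Hilbert–Schmidt, with norm tending to zero as `κ → ∞`.

Existence comes from two similarities of the form `1 + K`. Divide `𝒱^(j + n)` by `λ_j - λ_n` and
drop the columns `|n| ≤ m` to make the result `K₁` small. Then `AK₁ - K₁A = B - N`, where `N` is the
diagonal of `B` together with the dropped columns, so `(A - B)(1 + K₁) = (1 + K₁)A - N - BK₁`. The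
matrices `K₁` and `N` are Hilbert–Schmidt by the first summability hypothesis, `BK₁` by the second.
Hence `A - B` is similar to `A - C` with `C` Hilbert–Schmidt. By `exists_block_diagonalization`, a
fixed point argument, `A - C` is in turn similar to `A - Z` with `Z` block diagonal, and
`exists_similarity` composes the two. Every identity is multiplied on the right by `R`, so that only
bounded operators occur; `UR = RU'` with `U'` invertible expresses that `U` preserves the domain of
`A`.

Let `low` be the part of `A` in `H_(k)` and `M = low - Z`. The group generated by `A - Z` is `S(t)
e^{-t low} e^{tM}`: here `S(t) e^{-t low}` is a scalar on every block and so commutes with `M`.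
`hasDerivAt_blockGroup_iff` computes the generator, and `potential_reflect_ae_eq` identifies the
Hankel matrix with `𝒱(s)y(ω - s)`.

For an arbitrary representation take `M` to be the orthogonal sum of `B_(k)` and the `B_ℓ`. Formula
(∗) determines the group, so it equals `S(t) e^{-t low} e^{tM}`, and `Φ^r(z) = e^{-z low} e^{zM}`,
`Φ^l(z) = e^{zM} e^{-z low}`. These agree where `low` vanishes, and the growth bound is read off
block by block. -/

lemma integral_μ {F : Type*} [NormedAddCommGroup F] [NormedSpace ℝ F] (f : ℝ → F) :
    ∫ s, f s ∂(μ ω) = ω⁻¹ • ∫ s in (0 : ℝ)..ω, f s := by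
  rw [μ, integral_smul_measure, intervalIntegral.integral_of_le hω.out.le,
    integral_Icc_eq_integral_Ioc]
  simp [ENNReal.toReal_inv, ENNReal.toReal_ofReal hω.out.le]

lemma ae_μ_iff {p : ℝ → Prop} :
    (∀ᵐ s ∂(μ ω), p s) ↔ ∀ᵐ s ∂(volume.restrict (Set.Icc 0 ω)), p s := by
  rw [μ, Measure.ae_ennreal_smul_measure_iff (by simp)]

lemma eig_sub (j l : ℤ) : eig ω j - eig ω l = eig ω (j - l) := by
  simp only [eig]; push_cast; ring

lemma eig_add (j l : ℤ) : eig ω j + eig ω l = eig ω (j + l) := by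
  simp only [eig]; push_cast; ring

lemma eig_neg (l : ℤ) : eig ω (-l) = -eig ω l := by
  simp only [eig]; push_cast; ring

lemma eig_zero : eig ω 0 = 0 := by simp [eig]

lemma eig_ne_zero {l : ℤ} (hl : l ≠ 0) : eig ω l ≠ 0 := by
  have : (ω : ℂ) ≠ 0 := by exact_mod_cast hω.out.ne'
  have h2 : (l : ℂ) ≠ 0 := by exact_mod_cast hl
  simp [eig, this, h2, Real.pi_ne_zero]

lemma exp_eig_period (l : ℤ) : Complex.exp (eig ω l * ω) = 1 := by
  have : (ω : ℂ) ≠ 0 := by exact_mod_cast hω.out.ne'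
  rw [Complex.exp_eq_one_iff]
  refine ⟨l, ?_⟩
  simp only [eig]
  field_simp

lemma integral_exp_eig (l : ℤ) :
    ∫ s, Complex.exp (eig ω l * s) ∂(μ ω) = if l = 0 then 1 else 0 := by
  have hω' := hω.out.ne'
  rw [integral_μ]
  split_ifs with h
  · subst h
    simp [eig_zero, hω']
  · rw [integral_exp_mul_complex (eig_ne_zero h), exp_eig_period]
    simp

lemma coeff_apply (l : ℤ) (x : L2 ω H) :
    coeff ω l x = ∫ s, Complex.exp (eig ω (-l) * s) • x s ∂(μ ω) := rfl

lemma coeFn_character (l : ℤ) (h : H) :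
    (character ω l h : ℝ → H) =ᵐ[μ ω] fun s => Complex.exp (eig ω l * s) • h :=
  MemLp.coeFn_toLp (memLp_exp_eig_smul ω l (memLp_const (p := 2) (μ := μ ω) h))

lemma coeff_character (j l : ℤ) (h : H) :
    coeff ω j (character ω l h) = if j = l then h else 0 := by
  rw [coeff_apply]
  have h1 : ∫ s, Complex.exp (eig ω (-j) * s) • (character ω l h : ℝ → H) s ∂(μ ω)
      = ∫ s, Complex.exp (eig ω (l - j) * s) • h ∂(μ ω) := by
    refine integral_congr_ae ?_
    filter_upwards [coeFn_character l h] with s hs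
    rw [hs, smul_smul, ← Complex.exp_add, ← add_mul, eig_add]
    congr 4
    ring
  rw [h1, integral_smul_const, integral_exp_eig]
  by_cases hjl : j = l
  · simp [hjl]
  · rw [if_neg hjl, if_neg (by omega), zero_smul]

lemma inner_character (l : ℤ) (h : H) (x : L2 ω H) :
    inner ℂ (character ω l h) x = inner ℂ h (coeff ω l x) := by
  rw [coeff_apply, MeasureTheory.L2.inner_def, ← integral_inner]
  · refine integral_congr_ae ?_
    filter_upwards [coeFn_character l h] with s hs
    rw [hs, inner_smul_left, inner_smul_right, ← Complex.exp_conj, eig_neg]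
    congr 2
    simp only [eig, map_mul, map_div₀, Complex.conj_I, Complex.conj_ofReal, map_ofNat, map_intCast]
    ring
  · exact (memLp_exp_eig_smul ω (-l) (Lp.memLp x)).integrable (by norm_num)

/-- Completeness of the characters is reduced to scalar functions: the range is almost everywhere
separable, so vanishing may be tested on one functional at a time, and for each functional
Parseval's identity on `[0, ω]` applies. -/
lemma eq_zero_of_coeff_eq_zero {x : L2 ω H} (hx : ∀ n, coeff ω n x = 0) : x = 0 := by
  obtain ⟨t, ht, hxt⟩ := (Lp.aestronglyMeasurable x).isSeparable_ae_range
  refine (Lp.eq_zero_iff_ae_eq_zero).2 ?_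
  refine ae_eq_zero_of_forall_dual_of_isSeparable ℂ ht (fun c => ?_) hxt
  have hmem : MemLp (fun s => c (x s)) 2 (μ ω) := c.comp_memLp' (Lp.memLp x)
  have hmem' : MemLp (fun s => c (x s)) 2 (volume.restrict (Set.Ioc 0 ω)) := by
    have : μ ω = (ENNReal.ofReal ω)⁻¹ • volume.restrict (Set.Ioc 0 ω) := by
      rw [μ, Measure.restrict_congr_set Ioc_ae_eq_Icc]
    have h2 : volume.restrict (Set.Ioc 0 ω) = ENNReal.ofReal ω • μ ω := by
      rw [this, smul_smul, ENNReal.mul_inv_cancel (by simpa using hω.out) (by simp), one_smul]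
    rw [h2]
    exact hmem.smul_measure (by simp)
  have hco : ∀ n, fourierCoeffOn hω.out (fun s => c (x s)) n = 0 := fun n => by
    rw [fourierCoeffOn_eq_integral]
    have h1 := congrArg c (hx n)
    rw [coeff_apply, ← c.integral_comp_comm, integral_μ, map_zero] at h1
    · convert h1 using 2
      · simp
      · refine intervalIntegral.integral_congr fun s _ => ?_
        simp only [map_smul]
        congr 1
        rw [fourier_coe_apply]
        congr 1
        simp [eig]
        ring
    · exact (memLp_exp_eig_smul ω (-n) (Lp.memLp x)).integrable (by norm_num)
  have hs := hasSum_sq_fourierCoeffOn hω.out hmem'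
  simp only [hco, norm_zero, ne_eq, OfNat.ofNat_ne_zero, not_false_eq_true, zero_pow] at hs
  have h0 := hs.unique hasSum_zero
  have h0' : ∫ s in (0 : ℝ)..ω, ‖c (x s)‖ ^ 2 = 0 := by
    simpa [hω.out.ne'] using h0
  rw [intervalIntegral.integral_of_le hω.out.le, integral_eq_zero_iff_of_nonneg
    (fun s => by positivity) hmem'.norm.integrable_sq] at h0'
  rw [Filter.EventuallyEq, ae_μ_iff, ← Measure.restrict_congr_set Ioc_ae_eq_Icc]
  filter_upwards [h0'] with s hs
  simpa using hs

lemma ext_coeff {x y : L2 ω H} (h : ∀ n, coeff ω n x = coeff ω n y) : x = y := by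
  rw [← sub_eq_zero]
  exact eq_zero_of_coeff_eq_zero fun n => by rw [map_sub, h, sub_self]

lemma norm_character (l : ℤ) (h : H) : ‖character ω l h‖ = ‖h‖ := by
  have h1 := inner_character l h (character ω l h)
  rw [coeff_character, if_pos rfl, inner_self_eq_norm_sq_to_K, inner_self_eq_norm_sq_to_K] at h1
  have h2 : ‖character ω l h‖ ^ 2 = ‖h‖ ^ 2 := by exact_mod_cast h1
  exact (pow_left_inj₀ (norm_nonneg _) (norm_nonneg _) two_ne_zero).1 h2

/-- The map `h ↦ e^{λ_ℓ s} h` as an isometric embedding. -/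
def characterₗᵢ (ω : ℝ) [Fact (0 < ω)] (H : Type*) [NormedAddCommGroup H] [InnerProductSpace ℂ H]
    [CompleteSpace H] (l : ℤ) : H →ₗᵢ[ℂ] L2 ω H :=
  ⟨(character ω l).toLinearMap, norm_character l⟩

lemma isHilbertSum_character :
    IsHilbertSum ℂ (fun _ : ℤ => H) (characterₗᵢ ω H) := by
  refine IsHilbertSum.mk (fun i j hij v w => ?_) ?_
  · change inner ℂ (character ω i v) (character ω j w) = 0
    rw [inner_character, coeff_character, if_neg hij, inner_zero_right]
  · rw [top_le_iff, Submodule.topologicalClosure_eq_top_iff, Submodule.eq_bot_iff]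
    intro x hx
    refine eq_zero_of_coeff_eq_zero fun n => ?_
    rw [Submodule.mem_orthogonal] at hx
    have := hx (character ω n (coeff ω n x))
      (Submodule.mem_iSup_of_mem n ⟨coeff ω n x, rfl⟩)
    rwa [inner_character, inner_self_eq_zero] at this

/-- The Fourier transform as a unitary map onto `ℓ²(ℤ, H)`. -/
def fourierEquiv (ω : ℝ) [Fact (0 < ω)] (H : Type*) [NormedAddCommGroup H] [InnerProductSpace ℂ H]
    [CompleteSpace H] : L2 ω H ≃ₗᵢ[ℂ] lp (fun _ : ℤ => H) 2 :=
  (isHilbertSum_character (ω := ω) (H := H)).linearIsometryEquiv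

lemma coeff_fourierEquiv_symm (a : lp (fun _ : ℤ => H) 2) (n : ℤ) :
    coeff ω n ((fourierEquiv ω H).symm a) = a n := by
  have h := (isHilbertSum_character (ω := ω) (H := H)).hasSum_linearIsometryEquiv_symm a
  have h1 := (coeff ω n).hasSum h
  refine h1.unique ?_
  have h2 := hasSum_ite_eq n (a n)
  convert h2 using 2 with i
  change coeff ω n (character ω i (a i)) = _
  rw [coeff_character]
  by_cases hin : i = n
  · subst hin; simp
  · rw [if_neg (Ne.symm hin), if_neg hin]

lemma fourierEquiv_apply (x : L2 ω H) (n : ℤ) : fourierEquiv ω H x n = coeff ω n x := by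
  rw [← coeff_fourierEquiv_symm (ω := ω), LinearIsometryEquiv.symm_apply_apply]

lemma hasSum_norm_coeff (x : L2 ω H) : HasSum (fun n => ‖coeff ω n x‖ ^ 2) (‖x‖ ^ 2) := by
  have h := lp.hasSum_norm (p := 2) (by norm_num) (fourierEquiv ω H x)
  rw [LinearIsometryEquiv.norm_map] at h
  simpa [fourierEquiv_apply] using h

lemma hasSum_character_coeff (x : L2 ω H) :
    HasSum (fun n => character ω n (coeff ω n x)) x := by
  have h := (isHilbertSum_character (ω := ω) (H := H)).hasSum_linearIsometryEquiv_symm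
    (fourierEquiv ω H x)
  have h2 : (isHilbertSum_character (ω := ω) (H := H)).linearIsometryEquiv.symm
      (fourierEquiv ω H x) = x := (fourierEquiv ω H).symm_apply_apply x
  rw [h2] at h
  convert h using 2 with n
  rw [fourierEquiv_apply]
  rfl

lemma norm_coeff_le (n : ℤ) (x : L2 ω H) : ‖coeff ω n x‖ ≤ ‖x‖ := by
  have := (coeff (H := H) ω n).le_of_opNorm_le
    (LinearMap.mkContinuous_norm_le _ zero_le_one _) x
  simpa using this

lemma exists_coeff_eq {a : ℤ → H} (ha : Summable fun n => ‖a n‖ ^ 2) :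
    ∃ x : L2 ω H, ∀ n, coeff ω n x = a n := by
  have hm : Memℓp a 2 := memℓp_gen (by simpa using ha)
  exact ⟨(fourierEquiv ω H).symm ⟨a, hm⟩, fun n => coeff_fourierEquiv_symm _ _⟩

lemma coeff_S (t : ℝ) (x : L2 ω H) (n : ℤ) :
    coeff ω n (S ω t x) = Complex.exp (eig ω n * t) • coeff ω n x := by
  rw [coeff_apply, coeff_apply, ← integral_smul]
  have h1 : (S ω t x : ℝ → H) =ᵐ[μ ω] fun s => x (shift ω t s) :=
    Lp.coeFn_compMeasurePreserving x (measurePreserving_shift ω t)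
  -- `shift ω t s` differs from `t + s` by an integer multiple of `ω`, which the character does not
  -- see.
  have h2 : ∀ s : ℝ, Complex.exp (eig ω (-n) * s) =
      Complex.exp (eig ω n * t) * Complex.exp (eig ω (-n) * (shift ω t s : ℝ)) := by
    intro s
    obtain ⟨m, hm⟩ : ∃ m : ℤ, t + s = shift ω t s + m * ω :=
      ⟨toIocDiv hω.out 0 (t + s), by
        have := toIocMod_add_toIocDiv_zsmul hω.out 0 (t + s)
        rw [shift, ← zsmul_eq_mul, this]⟩
    have hs : (s : ℂ) = (shift ω t s : ℝ) + m * ω - t := by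
      have : s = shift ω t s + m * ω - t := by linarith
      exact_mod_cast this
    rw [← Complex.exp_add]
    conv_lhs => rw [hs]
    have h3 : eig ω (-n) * (((shift ω t s : ℝ) : ℂ) + m * ω - t)
        = eig ω n * t + eig ω (-n) * (shift ω t s : ℝ) + m * (eig ω (-n) * ω) := by
      rw [eig_neg]; ring
    rw [h3, Complex.exp_add _ ((m : ℂ) * _), Complex.exp_int_mul, exp_eig_period, one_zpow, mul_one]
  have h3 : ∫ s, Complex.exp (eig ω (-n) * s) • (S ω t x : ℝ → H) s ∂(μ ω)
      = ∫ s, (fun u : ℝ => Complex.exp (eig ω n * t) • Complex.exp (eig ω (-n) * u) • x u)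
          (shift ω t s) ∂(μ ω) := by
    refine integral_congr_ae ?_
    filter_upwards [h1] with s hs
    rw [hs, h2 s, smul_smul]
  rw [h3]
  have hmp := measurePreserving_shift ω t
  have hf : AEStronglyMeasurable (fun u : ℝ => Complex.exp (eig ω n * t) •
      Complex.exp (eig ω (-n) * u) • (x : ℝ → H) u) ((μ ω).map (shift ω t)) := by
    rw [hmp.map_eq]
    exact ((memLp_exp_eig_smul ω (-n) (Lp.memLp x)).const_smul _).1
  rw [← integral_map hmp.measurable.aemeasurable hf, hmp.map_eq]

/-! ### Primitives and the periodic Sobolev space -/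

lemma restrict_eq_smul_μ : volume.restrict (Set.Icc 0 ω) = ENNReal.ofReal ω • μ ω := by
  rw [μ, smul_smul, ENNReal.mul_inv_cancel (by simpa using hω.out) (by simp), one_smul]

lemma integrableOn_Lp (g : L2 ω H) : IntegrableOn g (Set.Icc 0 ω) volume := by
  rw [IntegrableOn, restrict_eq_smul_μ]
  exact ((Lp.memLp g).integrable (by norm_num)).smul_measure (by simp)

lemma intervalIntegrable_Lp (g : L2 ω H) {s : ℝ} (hs : s ∈ Set.Icc 0 ω) :
    IntervalIntegrable g volume 0 s := by
  rw [intervalIntegrable_iff_integrableOn_Ioc_of_le hs.1]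
  exact (integrableOn_Lp g).mono_set fun u hu => ⟨hu.1.le, hu.2.trans hs.2⟩

lemma norm_integral_Lp_le (g : L2 ω H) {s : ℝ} (hs : s ∈ Set.Icc 0 ω) :
    ‖∫ τ in (0 : ℝ)..s, g τ‖ ≤ ω * ‖g‖ := by
  have h1 : ‖∫ τ in (0 : ℝ)..s, g τ‖ ≤ ∫ τ in (0 : ℝ)..ω, ‖g τ‖ := by
    refine (intervalIntegral.norm_integral_le_integral_norm hs.1).trans ?_
    exact intervalIntegral.integral_mono_interval le_rfl hs.1 hs.2
      (Eventually.of_forall fun _ => norm_nonneg _)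
      (intervalIntegrable_Lp g ⟨hω.out.le, le_rfl⟩).norm
  have h2 : ∫ τ in (0 : ℝ)..ω, ‖g τ‖ = ω * ∫ τ, ‖g τ‖ ∂(μ ω) := by
    rw [integral_μ, smul_eq_mul, mul_inv_cancel_left₀ hω.out.ne']
  have h3 : ∫ τ, ‖g τ‖ ∂(μ ω) ≤ ‖g‖ := by
    rw [integral_norm_eq_lintegral_enorm (Lp.aestronglyMeasurable g), Lp.norm_def,
      ← eLpNorm_one_eq_lintegral_enorm]
    exact ENNReal.toReal_mono (Lp.eLpNorm_ne_top g)
      (eLpNorm_le_eLpNorm_of_exponent_le (by norm_num) (Lp.aestronglyMeasurable g))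
  rw [h2] at h1
  exact h1.trans (mul_le_mul_of_nonneg_left h3 hω.out.le)

lemma ae_μ_mem : ∀ᵐ s ∂(μ ω), s ∈ Set.Icc 0 ω := by
  rw [ae_μ_iff]; exact ae_restrict_mem measurableSet_Icc

lemma memLp_primitive (g : L2 ω H) : MemLp (fun s => ∫ τ in (0 : ℝ)..s, g τ) 2 (μ ω) := by
  refine MemLp.of_bound ?_ (ω * ‖g‖) ?_
  · have : ContinuousOn (fun s => ∫ τ in (0 : ℝ)..s, g τ) (Set.Icc 0 ω) := by
      have := intervalIntegral.continuousOn_primitive_interval (f := g) (μ := volume)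
        (a := 0) (b := ω) (by rw [Set.uIcc_of_le hω.out.le]; exact integrableOn_Lp g)
      rwa [Set.uIcc_of_le hω.out.le] at this
    have h2 : AEStronglyMeasurable (fun s => ∫ τ in (0 : ℝ)..s, g τ)
      (volume.restrict (Set.Icc 0 ω)) := this.aestronglyMeasurable measurableSet_Icc
    exact h2.smul_measure _
  · filter_upwards [ae_μ_mem] with s hs using norm_integral_Lp_le g hs

/-- The Volterra operator `g ↦ (s ↦ ∫₀ˢ g)` on `L²([0, ω], H)`. -/
def primitive (ω : ℝ) [Fact (0 < ω)] : L2 ω H →L[ℂ] L2 ω H :=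
  LinearMap.mkContinuous
    { toFun := fun g => (memLp_primitive g).toLp _
      map_add' := fun g h => by
        rw [← MemLp.toLp_add]
        refine MemLp.toLp_congr _ _ ?_
        filter_upwards [ae_μ_mem] with s hs
        rw [Pi.add_apply, ← intervalIntegral.integral_add (intervalIntegrable_Lp g hs)
          (intervalIntegrable_Lp h hs)]
        refine intervalIntegral.integral_congr_ae ?_
        have := (ae_μ_iff.1 (Lp.coeFn_add g h))
        rw [ae_restrict_iff' measurableSet_Icc] at this
        filter_upwards [this] with u hu hu'
        rw [Set.uIoc_of_le hs.1] at hu'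
        exact hu ⟨hu'.1.le, hu'.2.trans hs.2⟩
      map_smul' := fun c g => by
        rw [RingHom.id_apply, ← MemLp.toLp_const_smul]
        refine MemLp.toLp_congr _ _ ?_
        filter_upwards [ae_μ_mem] with s hs
        rw [Pi.smul_apply, ← intervalIntegral.integral_smul]
        refine intervalIntegral.integral_congr_ae ?_
        have := (ae_μ_iff.1 (Lp.coeFn_smul c g))
        rw [ae_restrict_iff' measurableSet_Icc] at this
        filter_upwards [this] with u hu hu'
        rw [Set.uIoc_of_le hs.1] at hu'
        exact hu ⟨hu'.1.le, hu'.2.trans hs.2⟩ }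
    ω (fun g => by
      change ‖MemLp.toLp _ (memLp_primitive g)‖ ≤ _
      have := Lp.norm_le_of_ae_bound (f := (memLp_primitive g).toLp _) (C := ω * ‖g‖)
        (mul_nonneg (Fact.out (p := 0 < ω)).le (norm_nonneg _)) (by
          filter_upwards [ae_μ_mem, (memLp_primitive g).coeFn_toLp] with s hs hs'
          rw [hs']
          exact norm_integral_Lp_le g hs)
      simpa [measureUnivNNReal] using this)

lemma coeFn_primitive (g : L2 ω H) :
    (primitive ω g : ℝ → H) =ᵐ[μ ω] fun s => ∫ τ in (0 : ℝ)..s, g τ :=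
  (memLp_primitive g).coeFn_toLp

lemma coeff_zero_apply (g : L2 ω H) : coeff ω 0 g = ω⁻¹ • ∫ τ in (0 : ℝ)..ω, g τ := by
  rw [coeff_apply, ← integral_μ]
  simp [eig_zero]

lemma integral_character {m : ℤ} (h : H) {s : ℝ} (hs : s ∈ Set.Icc 0 ω) :
    ∫ τ in (0 : ℝ)..s, (character ω m h : ℝ → H) τ
      = (∫ τ in (0 : ℝ)..s, Complex.exp (eig ω m * τ)) • h := by
  rw [← intervalIntegral.integral_smul_const]
  refine intervalIntegral.integral_congr_ae ?_
  have := (ae_μ_iff.1 (coeFn_character (ω := ω) m h))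
  rw [ae_restrict_iff' measurableSet_Icc] at this
  filter_upwards [this] with u hu hu'
  rw [Set.uIoc_of_le hs.1] at hu'
  exact hu ⟨hu'.1.le, hu'.2.trans hs.2⟩

lemma integral_id_mul_exp_eig {n : ℤ} (hn : n ≠ 0) :
    ∫ s : ℝ, Complex.exp (eig ω (-n) * s) * s ∂(μ ω) = (eig ω (-n))⁻¹ := by
  have he : eig ω (-n) ≠ 0 := eig_ne_zero (by omega)
  have hω' : (ω : ℂ) ≠ 0 := by exact_mod_cast hω.out.ne'
  rw [integral_μ]
  set c := eig ω (-n) with hc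
  have hd : ∀ s : ℝ, HasDerivAt (fun s : ℝ => Complex.exp (c * s) * (s / c - 1 / c ^ 2))
      (Complex.exp (c * s) * s) s := by
    intro s
    have h1 : HasDerivAt (fun s : ℝ => Complex.exp (c * s)) (Complex.exp (c * s) * (c * 1)) s :=
      ((Complex.ofRealCLM.hasDerivAt (x := s)).const_mul c).cexp
    have h2 : HasDerivAt (fun s : ℝ => (s : ℂ) / c - 1 / c ^ 2) (1 / c) s :=
      ((Complex.ofRealCLM.hasDerivAt (x := s)).div_const c).sub_const _
    refine (h1.mul h2).congr_deriv ?_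
    field_simp
    ring
  rw [intervalIntegral.integral_eq_sub_of_hasDerivAt (fun s _ => hd s)
    (Continuous.intervalIntegrable (by fun_prop) _ _), hc, exp_eig_period, ← hc]
  simp only [Complex.real_smul, Complex.ofReal_zero, mul_zero, Complex.exp_zero]
  push_cast
  field_simp
  ring

lemma coeff_primitive_character (n m : ℤ) (h : H) :
    eig ω n • coeff ω n (primitive ω (character ω m h))
      = coeff ω n (character ω m h) - coeff ω 0 (character ω m h) := by
  have key : coeff ω n (primitive ω (character ω m h)) =
      (∫ s : ℝ, Complex.exp (eig ω (-n) * s) * (∫ τ in (0 : ℝ)..s, Complex.exp (eig ω m * τ)) ∂(μ ω))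
        • h := by
    rw [coeff_apply, ← integral_smul_const]
    refine integral_congr_ae ?_
    filter_upwards [coeFn_primitive (character ω m h), ae_μ_mem] with s h1 h2
    rw [h1, integral_character h h2, smul_smul]
  rw [key]
  by_cases hn : n = 0
  · subst hn; simp [eig_zero]
  simp only [coeff_character]
  by_cases hm : m = 0
  · subst hm
    rw [if_neg hn, if_pos rfl]
    simp only [eig_zero, zero_mul, Complex.exp_zero, intervalIntegral.integral_const, sub_zero,
      Complex.real_smul, mul_one]
    rw [integral_id_mul_exp_eig hn, smul_smul, eig_neg, inv_neg, mul_neg,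
      mul_inv_cancel₀ (eig_ne_zero hn)]
    simp
  · rw [if_neg (Ne.symm hm), sub_zero]
    have h1 : ∫ s : ℝ, Complex.exp (eig ω (-n) * s) *
        (∫ τ in (0 : ℝ)..s, Complex.exp (eig ω m * τ)) ∂(μ ω)
        = (eig ω m)⁻¹ * ∫ s : ℝ, Complex.exp (eig ω (m - n) * s)
            - Complex.exp (eig ω (-n) * s) ∂(μ ω) := by
      rw [← integral_const_mul]
      refine integral_congr_ae (Eventually.of_forall fun s => ?_)
      simp only
      rw [integral_exp_mul_complex (eig_ne_zero hm), sub_eq_add_neg m n, ← eig_add, add_mul,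
        Complex.exp_add]
      simp
      ring
    have hint : ∀ l : ℤ, Integrable (fun s : ℝ => Complex.exp (eig ω l * s)) (μ ω) := fun l => by
      have := (memLp_exp_eig_smul ω l (memLp_const (p := 1) (μ := μ ω) (1 : ℂ))).integrable le_rfl
      simpa using this
    rw [h1, integral_sub (hint _) (hint _), integral_exp_eig, integral_exp_eig,
      if_neg (show -n ≠ 0 by omega)]
    by_cases hnm : n = m
    · subst hnm
      rw [if_pos (sub_self n), if_pos rfl, smul_smul]
      simp [mul_inv_cancel₀ (eig_ne_zero (ω := ω) hn)]
    · rw [if_neg (show m - n ≠ 0 by omega), if_neg hnm]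
      simp

/-- Integration by parts, in which the boundary term at `ω` is the mean of `g`. It is checked on
characters and extended by continuity in `g`. -/
lemma coeff_primitive (n : ℤ) (g : L2 ω H) :
    eig ω n • coeff ω n (primitive ω g) = coeff ω n g - coeff ω 0 g := by
  have h := hasSum_character_coeff g
  have h1 := (eig ω n • (coeff ω n).comp (primitive ω)).hasSum h
  have h2 := (coeff (H := H) ω n - coeff ω 0).hasSum h
  refine HasSum.unique h1 ?_
  convert h2 using 2 with m
  · exact coeff_primitive_character n m _
  · rfl

/-- Domain and derivative become a Fourier multiplier. The periodic boundary condition is the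
equation at `n = 0`: the mean of `g` vanishes, so its primitive takes the same value at `0` and `ω`.
-/
theorem isPeriodicSobolev_iff {y g : L2 ω H} :
    IsPeriodicSobolev y g ↔ ∀ n, coeff ω n g = eig ω n • coeff ω n y := by
  constructor
  · rintro ⟨Y, hyY, hY, hper⟩ n
    have h0 : coeff ω 0 g = 0 := by
      have := hY ω ⟨hω.out.le, le_rfl⟩
      rw [← hper, left_eq_add] at this
      rw [coeff_zero_apply, this, smul_zero]
    have hy : y = character ω 0 (Y 0) + primitive ω g := by
      refine Lp.ext ?_
      filter_upwards [hyY, ae_μ_mem, coeFn_primitive g, coeFn_character (ω := ω) 0 (Y 0),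
        Lp.coeFn_add (character ω 0 (Y 0)) (primitive ω g)] with s h1 h2 h3 h4 h5
      rw [h1, h5, Pi.add_apply, h3, h4, hY s h2]
      simp [eig_zero]
    rw [hy, map_add, smul_add, coeff_primitive, h0, coeff_character]
    by_cases hn : n = 0
    · subst hn; simp [eig_zero, h0]
    · simp [hn]
  · intro h
    have h0 : coeff ω 0 g = 0 := by rw [h 0, eig_zero, zero_smul]
    have hint : ∫ τ in (0 : ℝ)..ω, g τ = 0 := by
      rw [coeff_zero_apply] at h0
      exact (smul_eq_zero.1 h0).resolve_left (inv_ne_zero hω.out.ne')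
    -- The constant that matches the zeroth coefficients; the others match by `coeff_primitive`,
    -- since `g` has mean zero.
    set c : H := coeff ω 0 y - coeff ω 0 (primitive ω g) with hc
    have hy : y = character ω 0 c + primitive ω g := by
      refine ext_coeff fun n => ?_
      rw [map_add, coeff_character]
      by_cases hn : n = 0
      · subst hn; rw [if_pos rfl, hc]; abel
      · rw [if_neg hn, zero_add]
        have h1 := coeff_primitive n g
        rw [h0, sub_zero, h n] at h1
        exact (smul_right_injective H (eig_ne_zero (ω := ω) hn) h1).symm
    refine ⟨fun s => c + ∫ τ in (0 : ℝ)..s, g τ, ?_, fun s _ => by simp, by simp [hint]⟩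
    have h1 := Lp.coeFn_add (character ω 0 c) (primitive ω g)
    rw [← hy] at h1
    filter_upwards [h1, coeFn_primitive g, coeFn_character (ω := ω) 0 c] with s h2 h3 h4
    rw [h2, Pi.add_apply, h3, h4]
    simp [eig_zero]

/-! ### Operators given by their action on Fourier coefficients -/

lemma summable_mul_of_sq {ι : Type*} {a b : ι → ℝ} (ha : ∀ i, 0 ≤ a i) (hb : ∀ i, 0 ≤ b i)
    (hA : Summable fun i => a i ^ 2) (hB : Summable fun i => b i ^ 2) :
    Summable fun i => a i * b i := by
  refine Summable.of_nonneg_of_le (fun i => mul_nonneg (ha i) (hb i)) (fun i => ?_) (hA.add hB)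
  nlinarith [sq_nonneg (a i - b i), sq_nonneg (a i), sq_nonneg (b i)]

lemma tsum_mul_sq_le {ι : Type*} {a b : ι → ℝ} (ha : ∀ i, 0 ≤ a i) (hb : ∀ i, 0 ≤ b i)
    (hA : Summable fun i => a i ^ 2) (hB : Summable fun i => b i ^ 2) :
    (∑' i, a i * b i) ^ 2 ≤ (∑' i, a i ^ 2) * ∑' i, b i ^ 2 := by
  have h := (summable_mul_of_sq ha hb hA hB).hasSum
  refine le_of_tendsto (h.pow 2) (Eventually.of_forall fun s => ?_)
  refine (Finset.sum_mul_sq_le_sq_mul_sq s a b).trans ?_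
  gcongr
  · exact hA.sum_le_tsum s fun i _ => sq_nonneg _
  · exact hB.sum_le_tsum s fun i _ => sq_nonneg _

/-- Operators are built here from the coefficients of their values: Parseval's identity gives the
bound, and uniqueness of the coefficients gives linearity. -/
lemma exists_op_of_coeff (f : ℤ → L2 ω H →ₗ[ℂ] H) {C : ℝ} (hC : 0 ≤ C)
    (hf : ∀ x, ∃ A, HasSum (fun n => ‖f n x‖ ^ 2) A ∧ A ≤ (C * ‖x‖) ^ 2) :
    ∃ X : L2 ω H →L[ℂ] L2 ω H, (∀ n x, coeff ω n (X x) = f n x) ∧ ‖X‖ ≤ C := by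
  have hs : ∀ x, Summable fun n => ‖f n x‖ ^ 2 := fun x => (hf x).choose_spec.1.summable
  choose F hF using fun x => exists_coeff_eq (ω := ω) (hs x)
  let X : L2 ω H →ₗ[ℂ] L2 ω H :=
    { toFun := F
      map_add' := fun x y => ext_coeff fun n => by simp [hF]
      map_smul' := fun c x => ext_coeff fun n => by simp [hF] }
  have hX : ∀ x, ‖X x‖ ≤ C * ‖x‖ := fun x => by
    obtain ⟨A, hA, hle⟩ := hf x
    have h1 := hasSum_norm_coeff (F x)
    simp only [hF] at h1
    have h2 : ‖F x‖ ^ 2 ≤ (C * ‖x‖) ^ 2 := by rw [h1.unique hA]; exact hle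
    exact (pow_le_pow_iff_left₀ (by positivity) (by positivity) two_ne_zero).1 h2
  exact ⟨X.mkContinuous C hX, fun n x => hF x n, X.mkContinuous_norm_le hC hX⟩

lemma op_ext {F : Type*} [NormedAddCommGroup F] [NormedSpace ℂ F] {X Y : L2 ω H →L[ℂ] F}
    (h : ∀ n v, X (character ω n v) = Y (character ω n v)) : X = Y := by
  ext x
  have h1 := X.hasSum (hasSum_character_coeff x)
  have h2 := Y.hasSum (hasSum_character_coeff x)
  simp only [h] at h1
  exact h1.unique h2

lemma op_ext_coeff {X Y : L2 ω H →L[ℂ] L2 ω H}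
    (h : ∀ j n v, coeff ω j (X (character ω n v)) = coeff ω j (Y (character ω n v))) : X = Y :=
  op_ext fun n v => ext_coeff (ω := ω) (H := H) fun j => h j n v

lemma exists_diag {d : ℤ → ℂ} {C : ℝ} (hC : 0 ≤ C) (hd : ∀ n, ‖d n‖ ≤ C) :
    ∃ X : L2 ω H →L[ℂ] L2 ω H, (∀ n x, coeff ω n (X x) = d n • coeff ω n x) ∧ ‖X‖ ≤ C := by
  refine exists_op_of_coeff (fun n => d n • (coeff (H := H) ω n).toLinearMap) hC fun x => ?_
  have h := hasSum_norm_coeff x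
  have hle : ∀ n, ‖d n • coeff ω n x‖ ^ 2 ≤ C ^ 2 * ‖coeff ω n x‖ ^ 2 := fun n => by
    rw [norm_smul, mul_pow]
    gcongr
    exact hd n
  have hs := Summable.of_nonneg_of_le (fun n => sq_nonneg _) hle (h.mul_left _).summable
  refine ⟨_, hs.hasSum, ?_⟩
  rw [mul_pow]
  exact hasSum_le hle hs.hasSum (h.mul_left _)

open Classical in
/-- The Fourier multiplier with bounded symbol `d` (zero if `d` is unbounded). -/
def diag (ω : ℝ) [Fact (0 < ω)] (H : Type*) [NormedAddCommGroup H] [InnerProductSpace ℂ H]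
    [CompleteSpace H] (d : ℤ → ℂ) : L2 ω H →L[ℂ] L2 ω H :=
  if h : ∃ X : L2 ω H →L[ℂ] L2 ω H, ∀ n x, coeff ω n (X x) = d n • coeff ω n x
  then h.choose else 0

lemma coeff_diag {d : ℤ → ℂ} {C : ℝ} (hd : ∀ n, ‖d n‖ ≤ C) (n : ℤ) (x : L2 ω H) :
    coeff ω n (diag ω H d x) = d n • coeff ω n x := by
  obtain ⟨X, hX, -⟩ := exists_diag (ω := ω) (H := H) ((norm_nonneg _).trans (hd 0)) hd
  have h : ∃ X : L2 ω H →L[ℂ] L2 ω H, ∀ n x, coeff ω n (X x) = d n • coeff ω n x := ⟨X, hX⟩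
  rw [diag, dif_pos h]
  exact h.choose_spec n x

lemma diag_character {d : ℤ → ℂ} {C : ℝ} (hd : ∀ n, ‖d n‖ ≤ C) (n : ℤ) (v : H) :
    diag ω H d (character ω n v) = d n • character ω n v := by
  refine ext_coeff fun j => ?_
  rw [coeff_diag hd, map_smul, coeff_character]
  by_cases h : j = n
  · rw [h]
  · simp [h]

lemma norm_diag_le {d : ℤ → ℂ} {C : ℝ} (hd : ∀ n, ‖d n‖ ≤ C) : ‖diag ω H d‖ ≤ C := by
  have hC := (norm_nonneg _).trans (hd 0)
  obtain ⟨X, hX, hXC⟩ := exists_diag (ω := ω) (H := H) hC hd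
  have : diag ω H d = X := by
    ext1 x
    exact ext_coeff fun n => by rw [coeff_diag hd, hX]
  rwa [this]

/-! ### Hilbert–Schmidt matrices with operator entries -/

/-- Square summable matrices with entries in `B(H)`. -/
abbrev Mat (H : Type*) [NormedAddCommGroup H] [InnerProductSpace ℂ H] : Type _ :=
  lp (fun _ : ℤ × ℤ => H →L[ℂ] H) 2

lemma Mat.hasSum_norm_sq (M : Mat H) : HasSum (fun q => ‖M q‖ ^ 2) (‖M‖ ^ 2) := by
  simpa using lp.hasSum_norm (p := 2) (by norm_num) M

open Classical in
/-- The matrix with given entries (zero if they are not square summable). -/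
def toMat (f : ℤ × ℤ → H →L[ℂ] H) : Mat H :=
  if h : Summable fun q => ‖f q‖ ^ 2 then ⟨f, memℓp_gen (by simpa using h)⟩ else 0

lemma toMat_apply {f : ℤ × ℤ → H →L[ℂ] H} (hf : Summable fun q => ‖f q‖ ^ 2) (q : ℤ × ℤ) :
    toMat f q = f q := by
  rw [toMat, dif_pos hf]

lemma Mat.norm_le {M : Mat H} {C : ℝ} (hC : 0 ≤ C) {b : ℤ × ℤ → ℝ} {B : ℝ} (hb : HasSum b B)
    (hMb : ∀ q, ‖M q‖ ^ 2 ≤ b q) (hB : B ≤ C ^ 2) : ‖M‖ ≤ C :=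
  (pow_le_pow_iff_left₀ (norm_nonneg _) hC two_ne_zero).1 ((hasSum_le hMb M.hasSum_norm_sq hb).trans hB)

lemma Mat.ext' {M N : Mat H} (h : ∀ j n, M (j, n) = N (j, n)) : M = N :=
  lp.ext (funext fun q => h q.1 q.2)

lemma Mat.summable_row (M : Mat H) (j : ℤ) : Summable fun n => ‖M (j, n)‖ ^ 2 :=
  M.hasSum_norm_sq.summable.prod_factor j

lemma Mat.summable_col (M : Mat H) (n : ℤ) : Summable fun j => ‖M (j, n)‖ ^ 2 :=
  ((Equiv.prodComm ℤ ℤ).summable_iff.2 M.hasSum_norm_sq.summable).prod_factor n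

lemma Mat.hasSum_row (M : Mat H) : HasSum (fun j => ∑' n, ‖M (j, n)‖ ^ 2) (‖M‖ ^ 2) := by
  have h := M.hasSum_norm_sq.summable.hasSum.prod_fiberwise fun j => (M.summable_row j).hasSum
  rwa [M.hasSum_norm_sq.tsum_eq] at h

lemma Mat.hasSum_col (M : Mat H) : HasSum (fun n => ∑' j, ‖M (j, n)‖ ^ 2) (‖M‖ ^ 2) :=
  HasSum.prod_fiberwise ((Equiv.prodComm ℤ ℤ).hasSum_iff.2 M.hasSum_norm_sq)
    fun n => (M.summable_col n).hasSum

lemma Mat.summable_apply_coeff (M : Mat H) (j : ℤ) (x : L2 ω H) :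
    Summable fun n => ‖M (j, n)‖ * ‖coeff ω n x‖ :=
  summable_mul_of_sq (fun _ => norm_nonneg _) (fun _ => norm_nonneg _) (M.summable_row j)
    (hasSum_norm_coeff x).summable

lemma Mat.summable_apply_coeff' (M : Mat H) (j : ℤ) (x : L2 ω H) :
    Summable fun n => ‖M (j, n) (coeff ω n x)‖ :=
  Summable.of_nonneg_of_le (fun _ => norm_nonneg _) (fun _ => ContinuousLinearMap.le_opNorm _ _)
    (M.summable_apply_coeff j x)

/-- Cauchy–Schwarz in each row: the Hilbert–Schmidt norm dominates the operator norm. -/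
lemma Mat.exists_op (M : Mat H) : ∃ X : L2 ω H →L[ℂ] L2 ω H,
    (∀ j x, coeff ω j (X x) = ∑' n, M (j, n) (coeff ω n x)) ∧ ‖X‖ ≤ ‖M‖ := by
  refine exists_op_of_coeff (fun j =>
    { toFun := fun x => ∑' n, M (j, n) (coeff ω n x)
      map_add' := fun x y => by
        simp only [map_add]
        exact (M.summable_apply_coeff' j x).of_norm.tsum_add (M.summable_apply_coeff' j y).of_norm
      map_smul' := fun c x => by
        simp only [map_smul, RingHom.id_apply]
        exact (M.summable_apply_coeff' j x).of_norm.tsum_const_smul c }) (norm_nonneg _) fun x => ?_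
  have hle : ∀ j, ‖∑' n, M (j, n) (coeff ω n x)‖ ^ 2 ≤ (∑' n, ‖M (j, n)‖ ^ 2) * ‖x‖ ^ 2 := by
    intro j
    have h1 : ‖∑' n, M (j, n) (coeff ω n x)‖ ≤ ∑' n, ‖M (j, n)‖ * ‖coeff ω n x‖ :=
      (norm_tsum_le_tsum_norm (M.summable_apply_coeff' j x)).trans
        ((M.summable_apply_coeff' j x).tsum_le_tsum (fun _ => ContinuousLinearMap.le_opNorm _ _)
          (M.summable_apply_coeff j x))
    have h2 := tsum_mul_sq_le (fun _ => norm_nonneg _) (fun _ => norm_nonneg _) (M.summable_row j)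
      (hasSum_norm_coeff x).summable
    rw [(hasSum_norm_coeff x).tsum_eq] at h2
    exact (pow_le_pow_left₀ (norm_nonneg _) h1 2).trans h2
  have hs := M.hasSum_row.mul_right (‖x‖ ^ 2)
  have hs' := Summable.of_nonneg_of_le (fun _ => sq_nonneg _) hle hs.summable
  exact ⟨_, hs'.hasSum, by rw [mul_pow]; exact hasSum_le hle hs'.hasSum hs⟩

/-- The operator on `L²` with given square summable matrix. -/
def ofMat (ω : ℝ) [Fact (0 < ω)] (M : Mat H) : L2 ω H →L[ℂ] L2 ω H :=
  M.exists_op.choose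

lemma coeff_ofMat (M : Mat H) (j : ℤ) (x : L2 ω H) :
    coeff ω j (ofMat ω M x) = ∑' n, M (j, n) (coeff ω n x) :=
  M.exists_op.choose_spec.1 j x

lemma norm_ofMat_le (M : Mat H) : ‖ofMat ω M‖ ≤ ‖M‖ := M.exists_op.choose_spec.2

lemma coeff_ofMat_character (M : Mat H) (j n : ℤ) (v : H) :
    coeff ω j (ofMat ω M (character ω n v)) = M (j, n) v := by
  rw [coeff_ofMat, tsum_eq_single n]
  · rw [coeff_character, if_pos rfl]
  · intro p hp
    rw [coeff_character, if_neg hp, map_zero]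

lemma ofMat_add (M N : Mat H) : ofMat ω (M + N) = ofMat ω M + ofMat ω N :=
  op_ext_coeff fun j n v => by simp [coeff_ofMat_character]

lemma ofMat_sub (M N : Mat H) : ofMat ω (M - N) = ofMat ω M - ofMat ω N :=
  op_ext_coeff fun j n v => by simp [coeff_ofMat_character]

lemma isHilbertSchmidt_ofMat (M : Mat H) : IsHilbertSchmidt (ofMat ω M) := by
  refine Summable.of_nonneg_of_le (fun _ => sq_nonneg _) (fun q => ?_) M.hasSum_norm_sq.summable
  gcongr
  refine ContinuousLinearMap.opNorm_le_bound _ (norm_nonneg _) fun x => ?_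
  change ‖character ω q.1 (coeff ω q.1 (ofMat ω M (character ω q.2 (coeff ω q.2 x))))‖ ≤ _
  rw [norm_character, coeff_ofMat_character]
  exact ((M q).le_opNorm _).trans (by gcongr; exact norm_coeff_le _ _)

/-! ### Products of matrices -/

lemma Mat.summable_mul (M N : Mat H) (j n : ℤ) :
    Summable fun p => ‖M (j, p)‖ * ‖N (p, n)‖ :=
  summable_mul_of_sq (fun _ => norm_nonneg _) (fun _ => norm_nonneg _) (M.summable_row j)
    (N.summable_col n)

lemma Mat.summable_comp (M N : Mat H) (j n : ℤ) :
    Summable fun p => ‖(M (j, p)).comp (N (p, n))‖ :=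
  Summable.of_nonneg_of_le (fun _ => norm_nonneg _)
    (fun _ => ContinuousLinearMap.opNorm_comp_le _ _) (M.summable_mul N j n)

lemma Mat.norm_tsum_comp_sq_le (M N : Mat H) (j n : ℤ) :
    ‖∑' p, (M (j, p)).comp (N (p, n))‖ ^ 2
      ≤ (∑' p, ‖M (j, p)‖ ^ 2) * ∑' p, ‖N (p, n)‖ ^ 2 := by
  have h1 : ‖∑' p, (M (j, p)).comp (N (p, n))‖ ≤ ∑' p, ‖M (j, p)‖ * ‖N (p, n)‖ :=
    (norm_tsum_le_tsum_norm (M.summable_comp N j n)).trans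
      ((M.summable_comp N j n).tsum_le_tsum (fun _ => ContinuousLinearMap.opNorm_comp_le _ _)
        (M.summable_mul N j n))
  exact (pow_le_pow_left₀ (norm_nonneg _) h1 2).trans
    (tsum_mul_sq_le (fun _ => norm_nonneg _) (fun _ => norm_nonneg _) (M.summable_row j)
      (N.summable_col n))

lemma Mat.hasSum_row_mul_col (M N : Mat H) :
    HasSum (fun q : ℤ × ℤ => (∑' p, ‖M (q.1, p)‖ ^ 2) * ∑' p, ‖N (p, q.2)‖ ^ 2)
      (‖M‖ ^ 2 * ‖N‖ ^ 2) :=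
  M.hasSum_row.mul N.hasSum_col (M.hasSum_row.summable.mul_of_nonneg N.hasSum_col.summable
    (fun _ => tsum_nonneg fun _ => sq_nonneg _) (fun _ => tsum_nonneg fun _ => sq_nonneg _))

/-- The matrix product. -/
def Mat.mul (M N : Mat H) : Mat H := toMat fun q => ∑' p, (M (q.1, p)).comp (N (p, q.2))

lemma Mat.mul_apply (M N : Mat H) (j n : ℤ) :
    M.mul N (j, n) = ∑' p, (M (j, p)).comp (N (p, n)) :=
  toMat_apply (f := fun q => ∑' p, (M (q.1, p)).comp (N (p, q.2)))
    (Summable.of_nonneg_of_le (fun _ => sq_nonneg _)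
      (fun q => M.norm_tsum_comp_sq_le N q.1 q.2) (M.hasSum_row_mul_col N).summable) (j, n)

lemma Mat.norm_mul_le (M N : Mat H) : ‖M.mul N‖ ≤ ‖M‖ * ‖N‖ := by
  refine Mat.norm_le (by positivity) (M.hasSum_row_mul_col N) (fun q => ?_) (by rw [mul_pow])
  rw [show q = (q.1, q.2) from rfl, M.mul_apply]
  exact M.norm_tsum_comp_sq_le N q.1 q.2

lemma ofMat_mul (M N : Mat H) : ofMat ω (M.mul N) = ofMat ω M * ofMat ω N := by
  refine op_ext_coeff fun j n v => ?_
  rw [coeff_ofMat_character, mul_apply_eq_comp, coeff_ofMat, Mat.mul_apply]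
  simp only [coeff_ofMat_character]
  exact ((ContinuousLinearMap.apply ℂ H v).map_tsum (M.summable_comp N j n).of_norm)

section

variable (M M' N N' : Mat H)

lemma Mat.sub_mul : (M - M').mul N = M.mul N - M'.mul N :=
  Mat.ext' fun j n => by
    rw [lp.coeFn_sub, Pi.sub_apply]
    simp only [Mat.mul_apply]
    rw [← (M.summable_comp N j n).of_norm.tsum_sub (M'.summable_comp N j n).of_norm]
    exact tsum_congr fun p => by simp [ContinuousLinearMap.sub_comp]

lemma Mat.mul_sub : M.mul (N - N') = M.mul N - M.mul N' :=
  Mat.ext' fun j n => by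
    rw [lp.coeFn_sub, Pi.sub_apply]
    simp only [Mat.mul_apply]
    rw [← (M.summable_comp N j n).of_norm.tsum_sub (M.summable_comp N' j n).of_norm]
    exact tsum_congr fun p => by simp [ContinuousLinearMap.comp_sub]

end

/-! ### Entrywise multipliers -/

/-- Entrywise multiplication of a matrix by scalars. -/
def scale (γ : ℤ × ℤ → ℂ) (M : Mat H) : Mat H := toMat fun q => γ q • M q

lemma scale_apply {γ : ℤ × ℤ → ℂ} {C : ℝ} (hγ : ∀ q, ‖γ q‖ ≤ C) (M : Mat H) (q : ℤ × ℤ) :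
    scale γ M q = γ q • M q := by
  refine toMat_apply (Summable.of_nonneg_of_le (fun _ => sq_nonneg _) (fun q => ?_)
    (M.hasSum_norm_sq.summable.mul_left (C ^ 2))) q
  rw [norm_smul, mul_pow]
  gcongr
  exact hγ q

lemma norm_scale_le {γ : ℤ × ℤ → ℂ} {C : ℝ} (hγ : ∀ q, ‖γ q‖ ≤ C) (M : Mat H) :
    ‖scale γ M‖ ≤ C * ‖M‖ := by
  have hC := (norm_nonneg _).trans (hγ 0)
  refine Mat.norm_le (by positivity) (M.hasSum_norm_sq.mul_left (C ^ 2)) (fun q => ?_)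
    (by rw [mul_pow])
  rw [scale_apply hγ, norm_smul, mul_pow]
  gcongr
  exact hγ q

lemma scale_sub {γ : ℤ × ℤ → ℂ} {C : ℝ} (hγ : ∀ q, ‖γ q‖ ≤ C) (M N : Mat H) :
    scale γ (M - N) = scale γ M - scale γ N :=
  Mat.ext' fun j n => by
    simp only [lp.coeFn_sub, Pi.sub_apply, scale_apply hγ, smul_sub]

/-! ### The resolvent of `d/ds` -/

/-- The symbol `1 / (λ_n - κ)` of the resolvent of `d/ds`. -/
def resSymbol (ω κ : ℝ) (n : ℤ) : ℂ := (eig ω n - κ)⁻¹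

lemma normSq_eig_sub (κ : ℝ) (n : ℤ) :
    ‖eig ω n - κ‖ ^ 2 = κ ^ 2 + (2 * Real.pi / ω) ^ 2 * (n : ℝ) ^ 2 := by
  have : eig ω n - κ = ((-κ : ℝ) : ℂ) + ((2 * Real.pi / ω * n : ℝ) : ℂ) * Complex.I := by
    simp only [eig]; push_cast; ring
  rw [this, Complex.sq_norm, Complex.normSq_add_mul_I]
  ring

lemma eig_sub_ne_zero {κ : ℝ} (hκ : 0 < κ) (n : ℤ) : eig ω n - κ ≠ 0 := by
  intro h
  have := normSq_eig_sub (ω := ω) κ n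
  rw [h, norm_zero] at this
  nlinarith [sq_nonneg (2 * Real.pi / ω * n), pow_pos hκ 2, mul_pow (2 * Real.pi / ω) (n : ℝ) 2]

lemma norm_eig_sub_ge {κ : ℝ} (hκ : 0 < κ) (n : ℤ) : κ ≤ ‖eig ω n - κ‖ := by
  refine (pow_le_pow_iff_left₀ hκ.le (norm_nonneg _) two_ne_zero).1 ?_
  rw [normSq_eig_sub]
  have : 0 ≤ (2 * Real.pi / ω) ^ 2 * (n : ℝ) ^ 2 := by positivity
  linarith

lemma norm_resSymbol_le {κ : ℝ} (hκ : 0 < κ) (n : ℤ) : ‖resSymbol ω κ n‖ ≤ κ⁻¹ := by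
  rw [resSymbol, norm_inv]
  exact inv_anti₀ hκ (norm_eig_sub_ge hκ n)

lemma summable_inv_sq : Summable fun n : ℤ => ((n : ℝ) ^ 2)⁻¹ := by
  simpa using Real.summable_one_div_int_pow.2 one_lt_two

lemma norm_resSymbol_sq_le {κ : ℝ} (hκ : 1 ≤ κ) (n : ℤ) :
    ‖resSymbol ω κ n‖ ^ 2 ≤ (if n = 0 then 1 else 0) + (2 * Real.pi / ω)⁻¹ ^ 2 * ((n : ℝ) ^ 2)⁻¹ := by
  have hω' := hω.out
  rw [resSymbol, norm_inv, inv_pow, normSq_eig_sub]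
  split_ifs with h
  · subst h
    simp only [Int.cast_zero, ne_eq, OfNat.ofNat_ne_zero, not_false_eq_true, zero_pow, mul_zero,
      add_zero, inv_zero]
    exact inv_le_one_of_one_le₀ (by nlinarith)
  · rw [zero_add]
    have : (0 : ℝ) < (n : ℝ) ^ 2 := by
      have : (n : ℝ) ≠ 0 := by exact_mod_cast h
      positivity
    rw [inv_pow, ← mul_inv]
    refine inv_anti₀ (by positivity) ?_
    nlinarith [sq_nonneg κ]

lemma summable_norm_resSymbol_sq {κ : ℝ} (hκ : 1 ≤ κ) :
    Summable fun n => ‖resSymbol ω κ n‖ ^ 2 :=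
  Summable.of_nonneg_of_le (fun _ => sq_nonneg _) (norm_resSymbol_sq_le hκ)
    ((hasSum_ite_eq (0 : ℤ) (1 : ℝ)).summable.add (summable_inv_sq.mul_left _))

/-- Dominated convergence: each term is at most `κ⁻²`, and for `κ ≥ 1` a summable bound does not
depend on `κ`. This makes the perturbation small relative to `d/ds`. -/
lemma tendsto_tsum_norm_resSymbol_sq :
    Tendsto (fun κ : ℝ => ∑' n, ‖resSymbol ω κ n‖ ^ 2) atTop (𝓝 0) := by
  rw [← tsum_zero (α := ℝ) (β := ℤ)]
  refine tendsto_tsum_of_dominated_convergence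
    (bound := fun n : ℤ => (if n = 0 then 1 else 0) + (2 * Real.pi / ω)⁻¹ ^ 2 * ((n : ℝ) ^ 2)⁻¹)
    ((hasSum_ite_eq (0 : ℤ) (1 : ℝ)).summable.add (summable_inv_sq.mul_left _)) (fun n => ?_) ?_
  · have h1 : Tendsto (fun κ : ℝ => κ⁻¹ ^ 2) atTop (𝓝 0) := by
      simpa using (tendsto_inv_atTop_zero (𝕜 := ℝ)).pow 2
    refine squeeze_zero' (Eventually.of_forall fun _ => sq_nonneg _) ?_ h1
    filter_upwards [eventually_gt_atTop 0] with κ hκ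
    exact pow_le_pow_left₀ (norm_nonneg _) (norm_resSymbol_le hκ n) 2
  · filter_upwards [eventually_ge_atTop 1] with κ hκ n
    rw [Real.norm_of_nonneg (sq_nonneg _)]
    exact norm_resSymbol_sq_le hκ n

/-- The resolvent `(d/ds - κ)⁻¹` with periodic boundary conditions. -/
def res (ω : ℝ) [Fact (0 < ω)] (H : Type*) [NormedAddCommGroup H] [InnerProductSpace ℂ H]
    [CompleteSpace H] (κ : ℝ) : L2 ω H →L[ℂ] L2 ω H :=
  diag ω H (resSymbol ω κ)

lemma coeff_res {κ : ℝ} (hκ : 0 < κ) (n : ℤ) (x : L2 ω H) :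
    coeff ω n (res ω H κ x) = resSymbol ω κ n • coeff ω n x :=
  coeff_diag (norm_resSymbol_le hκ) n x

lemma eig_smul_coeff_res {κ : ℝ} (hκ : 0 < κ) (n : ℤ) (x : L2 ω H) :
    eig ω n • coeff ω n (res ω H κ x) = coeff ω n x + (κ : ℂ) • coeff ω n (res ω H κ x) := by
  rw [← sub_eq_iff_eq_add, ← sub_smul, coeff_res hκ, smul_smul, resSymbol,
    mul_inv_cancel₀ (eig_sub_ne_zero hκ n), one_smul]

/-- The graph of `d/ds` is parametrized by `w = (d/ds - κ)y`, which lets bounded operators stand for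
unbounded ones in what follows. -/
lemma eq_res_iff {κ : ℝ} (hκ : 0 < κ) {y g : L2 ω H} :
    (∀ n, coeff ω n g = eig ω n • coeff ω n y) ↔
      ∃ w, y = res ω H κ w ∧ g = w + (κ : ℂ) • res ω H κ w := by
  constructor
  · intro h
    have hy : y = res ω H κ (g - (κ : ℂ) • y) := ext_coeff fun n => by
      rw [coeff_res hκ, map_sub, map_smul, h n, ← sub_smul, smul_smul, resSymbol,
        inv_mul_cancel₀ (eig_sub_ne_zero hκ n), one_smul]
    exact ⟨g - (κ : ℂ) • y, hy, by rw [← hy]; abel⟩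
  · rintro ⟨w, rfl, rfl⟩ n
    rw [eig_smul_coeff_res hκ, map_add, map_smul]

/-! ### The perturbation `y ↦ 𝒱(s) y(ω - s)` -/

/-- The bijection `(j, n) ↦ (j + n, n)`. -/
def shearEquiv : ℤ × ℤ ≃ ℤ × ℤ where
  toFun q := (q.1 + q.2, q.2)
  invFun q := (q.1 - q.2, q.2)
  left_inv q := by simp
  right_inv q := by simp

lemma hasSum_hankel_mul {a : ℤ → H →L[ℂ] H} (ha : Summable fun n => ‖a n‖ ^ 2) {r : ℤ → ℝ}
    (hr0 : ∀ n, 0 ≤ r n) (hr : Summable r) :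
    HasSum (fun q : ℤ × ℤ => ‖a (q.1 + q.2)‖ ^ 2 * r q.2) ((∑' n, ‖a n‖ ^ 2) * ∑' n, r n) :=
  shearEquiv.hasSum_iff.2 (ha.hasSum.mul hr.hasSum
    (ha.mul_of_nonneg hr (fun _ => sq_nonneg _) hr0))

/-- The matrix of the perturbation composed with the resolvent of `d/ds`. -/
def hankelRes (ω κ : ℝ) (a : ℤ → H →L[ℂ] H) : Mat H :=
  toMat fun q => resSymbol ω κ q.2 • a (q.1 + q.2)

section

variable {a : ℤ → H →L[ℂ] H} {κ : ℝ}

lemma hasSum_hankelRes (ha : Summable fun n => ‖a n‖ ^ 2) (hκ : 1 ≤ κ) :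
    HasSum (fun q : ℤ × ℤ => ‖resSymbol ω κ q.2 • a (q.1 + q.2)‖ ^ 2)
      ((∑' n, ‖a n‖ ^ 2) * ∑' n, ‖resSymbol ω κ n‖ ^ 2) := by
  have := hasSum_hankel_mul ha (fun n => sq_nonneg ‖resSymbol ω κ n‖) (summable_norm_resSymbol_sq hκ)
  simpa only [norm_smul, mul_pow, mul_comm] using this

lemma hankelRes_apply (ha : Summable fun n => ‖a n‖ ^ 2) (hκ : 1 ≤ κ) (j n : ℤ) :
    hankelRes ω κ a (j, n) = resSymbol ω κ n • a (j + n) :=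
  toMat_apply (f := fun q : ℤ × ℤ => resSymbol ω κ q.2 • a (q.1 + q.2))
    (hasSum_hankelRes ha hκ).summable (j, n)

lemma tendsto_norm_hankelRes (ha : Summable fun n => ‖a n‖ ^ 2) :
    Tendsto (fun κ : ℝ => ‖hankelRes ω κ a‖) atTop (𝓝 0) := by
  have h1 := (tendsto_tsum_norm_resSymbol_sq (ω := ω)).const_mul (∑' n, ‖a n‖ ^ 2)
  rw [mul_zero] at h1
  have h2 := h1.sqrt
  rw [Real.sqrt_zero] at h2
  refine h2.congr' ?_
  filter_upwards [eventually_ge_atTop 1] with κ hκ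
  have h3 := (hankelRes ω κ a).hasSum_norm_sq
  have h4 : (fun q : ℤ × ℤ => ‖hankelRes ω κ a q‖ ^ 2)
      = fun q : ℤ × ℤ => ‖resSymbol ω κ q.2 • a (q.1 + q.2)‖ ^ 2 := by
    funext q
    rw [← hankelRes_apply ha hκ]
  rw [h4] at h3
  rw [(hasSum_hankelRes ha hκ).unique h3, Real.sqrt_sq (norm_nonneg _)]

end

/-- A subsequence of the symmetric partial sums converges almost everywhere to the `L²` sum, so that
sum must agree with the pointwise one. -/
lemma ae_eq_of_hasSum {f : ℤ → L2 ω H} {F : L2 ω H} (h : HasSum f F) {g : ℝ → H}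
    (hg : ∀ᵐ s ∂(μ ω), HasSum (fun n => f n s) (g s)) : F =ᵐ[μ ω] g := by
  have hseq : Tendsto (fun N : ℕ => Finset.Icc (-(N : ℤ)) N) atTop atTop := by
    refine tendsto_atTop_finset_of_monotone (fun a b hab => ?_) fun n => ⟨n.natAbs, ?_⟩
    · exact Finset.Icc_subset_Icc (by simpa using hab) (by simpa using hab)
    · rw [Finset.mem_Icc]; omega
  have h1 : Tendsto (fun N : ℕ => ∑ n ∈ Finset.Icc (-(N : ℤ)) N, f n) atTop (𝓝 F) := h.comp hseq
  obtain ⟨ns, hns, hae⟩ := (tendstoInMeasure_of_tendsto_Lp h1).exists_seq_tendsto_ae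
  have hall : ∀ᵐ s ∂(μ ω), ∀ N : ℕ, ((∑ n ∈ Finset.Icc (-(N : ℤ)) N, f n : L2 ω H) : ℝ → H) s
      = ∑ n ∈ Finset.Icc (-(N : ℤ)) N, f n s := by
    refine ae_all_iff.2 fun N => ?_
    filter_upwards [Lp.coeFn_finsetSum (Finset.Icc (-(N : ℤ)) N) f] with s hs
    rw [hs, Finset.sum_apply]
  filter_upwards [hae, hall, hg] with s h2 h3 h4
  refine tendsto_nhds_unique h2 ?_
  simp only [h3]
  exact (h4.comp hseq).comp hns.tendsto_atTop

lemma measurePreserving_reflect : MeasurePreserving (fun s => ω - s) (μ ω) (μ ω) := by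
  have h1 := (Measure.measurePreserving_sub_left (volume : Measure ℝ) ω).restrict_preimage
    (measurableSet_Icc (a := (0 : ℝ)) (b := ω))
  have h2 : (fun s => ω - s) ⁻¹' Set.Icc 0 ω = Set.Icc 0 ω := by
    simp
  rw [h2] at h1
  exact h1.smul_measure _

/-- Multiplication by the character `e^{λ_n s}`. -/
def modulate (n : ℤ) (u : L2 ω H) : L2 ω H := (memLp_exp_eig_smul ω n (Lp.memLp u)).toLp _

lemma coeFn_modulate (n : ℤ) (u : L2 ω H) :
    (modulate n u : ℝ → H) =ᵐ[μ ω] fun s => Complex.exp (eig ω n * s) • u s :=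
  MemLp.coeFn_toLp _

lemma norm_modulate (n : ℤ) (u : L2 ω H) : ‖modulate n u‖ = ‖u‖ := by
  rw [modulate, Lp.norm_toLp, Lp.norm_def]
  congr 1
  exact eLpNorm_congr_norm_ae (Eventually.of_forall fun s => by
    rw [norm_smul, norm_exp_eig, one_mul])

lemma coeff_modulate (j n : ℤ) (u : L2 ω H) :
    coeff ω j (modulate (-n) u) = coeff ω (j + n) u := by
  rw [coeff_apply, coeff_apply]
  refine integral_congr_ae ?_
  filter_upwards [coeFn_modulate (-n) u] with s hs
  rw [hs, smul_smul, ← Complex.exp_add, ← add_mul, eig_add]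
  congr 4
  ring

/-- The coefficients of a function in the range of the resolvent are absolutely summable, being
products of two `ℓ²` sequences. So its Fourier series converges absolutely, `V s` may be applied
term by term, and reflection turns `e^{λ_n s}` into `e^{-λ_n s}`. The same series converges in `L²`
to the image under the matrix. -/
theorem potential_reflect_ae_eq {V : ℝ → H →L[ℂ] H}
    {hV : ∀ x : H, MemLp (fun s => V s x) 2 (μ ω)}
    (ha : Summable fun n : ℤ => ‖potentialCoeff ω V hV n‖ ^ 2) {κ : ℝ} (hκ : 1 ≤ κ) (w : L2 ω H) :
    (ofMat ω (hankelRes ω κ (potentialCoeff ω V hV)) w : ℝ → H) =ᵐ[μ ω]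
      fun s => V s ((res ω H κ w : ℝ → H) (ω - s)) := by
  have hκ0 : 0 < κ := by linarith
  set y := res ω H κ w with hy
  set b : ℤ → H := fun n => coeff ω n y with hb
  have hbs : Summable fun n => ‖b n‖ := by
    have : Summable fun n => ‖resSymbol ω κ n‖ * ‖coeff ω n w‖ :=
      summable_mul_of_sq (fun _ => norm_nonneg _) (fun _ => norm_nonneg _)
        (summable_norm_resSymbol_sq hκ) (hasSum_norm_coeff w).summable
    simpa only [hb, hy, coeff_res hκ0, norm_smul] using this
  set f : ℤ → L2 ω H := fun n => modulate (-n) (potentialMap ω V hV (b n)) with hf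
  have hfs : Summable f := by
    refine Summable.of_norm_bounded (hbs.mul_left ‖potentialMap ω V hV‖) fun n => ?_
    rw [hf, norm_modulate]
    exact ContinuousLinearMap.le_opNorm _ _
  have hF : ofMat ω (hankelRes ω κ (potentialCoeff ω V hV)) w = ∑' n, f n := by
    refine ext_coeff fun j => ?_
    rw [coeff_ofMat, (coeff ω j).map_tsum hfs]
    refine tsum_congr fun n => ?_
    rw [hf, coeff_modulate, hankelRes_apply ha hκ, hb]
    simp only [hy, coeff_res hκ0, map_smul]
    rfl
  rw [hF]
  have hY : y =ᵐ[μ ω] fun s => ∑' n, Complex.exp (eig ω n * s) • b n := by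
    refine ae_eq_of_hasSum (hasSum_character_coeff y) ?_
    filter_upwards [ae_all_iff.2 fun n => coeFn_character n (coeff ω n y)] with s hs
    simp only [hs]
    refine (Summable.of_norm ?_).hasSum
    simpa only [norm_smul, norm_exp_eig, one_mul] using hbs
  have hYr := measurePreserving_reflect.quasiMeasurePreserving.ae_eq_comp hY
  refine ae_eq_of_hasSum hfs.hasSum ?_
  have h1 : ∀ᵐ s ∂(μ ω), ∀ n, (f n : ℝ → H) s
      = Complex.exp (eig ω (-n) * s) • (potentialMap ω V hV (b n) : ℝ → H) s :=
    ae_all_iff.2 fun n => coeFn_modulate (-n) _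
  have h2 : ∀ᵐ s ∂(μ ω), ∀ n, (potentialMap ω V hV (b n) : ℝ → H) s = V s (b n) :=
    ae_all_iff.2 fun n => MemLp.coeFn_toLp (hV (b n))
  filter_upwards [hYr, h1, h2] with s h3 h4 h5
  simp only [Function.comp_apply] at h3
  rw [h3]
  have hs : Summable fun n => Complex.exp (eig ω n * ((ω - s : ℝ) : ℂ)) • b n := by
    refine Summable.of_norm ?_
    simpa only [norm_smul, norm_exp_eig, one_mul] using hbs
  have h6 := (V s).hasSum hs.hasSum
  convert h6 using 2 with n
  rw [h4, h5, map_smul]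
  congr 1
  rw [Complex.ofReal_sub, mul_sub, sub_eq_add_neg, Complex.exp_add, exp_eig_period, one_mul,
    eig_neg, neg_mul]

/-! ### The operator exponential -/

section OpExp

variable {E F : Type*} [NormedAddCommGroup E] [NormedSpace ℂ E] [CompleteSpace E]
  [NormedAddCommGroup F] [NormedSpace ℂ F] [CompleteSpace F]

lemma hasSum_opExp (X : E →L[ℂ] E) :
    HasSum (fun n : ℕ => ((n.factorial : ℂ)⁻¹) • X ^ n) (opExp X) :=
  NormedSpace.exp_series_hasSum_exp' X

/-- With `L` the inclusion of an invariant subspace this restricts the exponential; with `L` a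
Fourier coefficient it computes the exponential of a multiplier. -/
lemma opExp_intertwine {X : E →L[ℂ] E} {Y : F →L[ℂ] F} {L : F →L[ℂ] E}
    (h : ∀ v, X (L v) = L (Y v)) (v : F) : opExp X (L v) = L (opExp Y v) := by
  have hp : ∀ n : ℕ, (X ^ n) (L v) = L ((Y ^ n) v) := by
    intro n
    induction n with
    | zero => simp
    | succ n ih => rw [pow_succ', pow_succ', mul_apply_eq_comp, ih, h, mul_apply_eq_comp]
  have h1 := (ContinuousLinearMap.apply ℂ E (L v)).hasSum (hasSum_opExp X)
  have h2 := (L.comp (ContinuousLinearMap.apply ℂ F v)).hasSum (hasSum_opExp Y)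
  refine h1.unique ?_
  convert h2 using 2 with n
  · simp [hp]
  · rfl

lemma norm_opExp_apply_le (X : E →L[ℂ] E) (v : E) : ‖opExp X v‖ ≤ Real.exp ‖X‖ * ‖v‖ := by
  have hp : ∀ n : ℕ, ‖(X ^ n) v‖ ≤ ‖X‖ ^ n * ‖v‖ := by
    intro n
    induction n with
    | zero => simp
    | succ n ih =>
      rw [pow_succ', mul_apply_eq_comp, pow_succ', mul_assoc]
      exact (X.le_opNorm _).trans (by gcongr)
  have h1 := (ContinuousLinearMap.apply ℂ E v).hasSum (hasSum_opExp X)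
  have h2 : HasSum (fun n : ℕ => ‖X‖ ^ n / n.factorial * ‖v‖) (Real.exp ‖X‖ * ‖v‖) := by
    have := NormedSpace.expSeries_div_hasSum_exp (𝔸 := ℝ) ‖X‖
    rw [← Real.exp_eq_exp_ℝ] at this
    exact this.mul_right _
  have h3 := tsum_of_norm_bounded (f := fun n : ℕ =>
    ContinuousLinearMap.apply ℂ E v (((n.factorial : ℂ)⁻¹) • X ^ n)) h2 fun n => by
      simp only [ContinuousLinearMap.apply_apply, smul_apply, norm_smul,
        norm_inv, Complex.norm_natCast]
      rw [div_eq_inv_mul, mul_assoc]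
      gcongr
      exact hp n
  rwa [h1.tsum_eq] at h3

lemma opExp_add_of_commute {X Y : E →L[ℂ] E} (h : Commute X Y) :
    opExp (X + Y) = opExp X * opExp Y := by
  let _ : NormedAlgebra ℚ (E →L[ℂ] E) := NormedAlgebra.restrictScalars ℚ ℂ _
  exact NormedSpace.exp_add_of_commute h

lemma opExp_smul_one (c : ℂ) : opExp (c • (1 : E →L[ℂ] E)) = Complex.exp c • 1 := by
  have := NormedSpace.algebraMap_exp_comm (𝕂 := ℂ) (𝔸 := E →L[ℂ] E) c
  rw [Algebra.algebraMap_eq_smul_one, Algebra.algebraMap_eq_smul_one, ← Complex.exp_eq_exp_ℂ] at this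
  exact this.symm

lemma opExp_zero : opExp (0 : E →L[ℂ] E) = 1 := NormedSpace.exp_zero

lemma opExp_add_smul (s t : ℂ) (X : E →L[ℂ] E) :
    opExp ((s + t) • X) = opExp (s • X) * opExp (t • X) := by
  rw [add_smul]
  exact opExp_add_of_commute (((Commute.refl X).smul_left s).smul_right t)

lemma hasDerivAt_opExp_smul (X : E →L[ℂ] E) (z : ℂ) :
    HasDerivAt (fun u : ℂ => opExp (u • X)) (opExp (z • X) * X) z :=
  hasDerivAt_exp_smul_const X z

lemma hasDerivAt_opExp_ofReal_smul (X : E →L[ℂ] E) :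
    HasDerivAt (fun t : ℝ => opExp ((t : ℂ) • X)) X 0 := by
  have h := (hasDerivAt_opExp_smul X ((0 : ℝ) : ℂ)).scomp (0 : ℝ)
    (Complex.ofRealCLM.hasDerivAt (x := 0))
  refine h.congr_deriv ?_
  simp [opExp_zero]

lemma opExp_smul_one_add (c : ℂ) (X : E →L[ℂ] E) :
    opExp (c • (1 : E →L[ℂ] E) + X) = Complex.exp c • opExp X := by
  rw [opExp_add_of_commute ((Commute.one_left X).smul_left c), opExp_smul_one, smul_one_mul]

end OpExp

/-! ### Spectral subspaces -/

lemma P_apply (l : ℤ) (x : L2 ω H) : P ω l x = character ω l (coeff ω l x) := rfl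

lemma coeff_P (n l : ℤ) (x : L2 ω H) :
    coeff ω n (P ω l x) = if n = l then coeff ω n x else 0 := by
  rw [P_apply, coeff_character]
  split_ifs with h
  · rw [h]
  · rfl

lemma coeff_PSum (n : ℤ) (k : ℕ) (x : L2 ω H) :
    coeff ω n (PSum ω k x) = if |n| ≤ k then coeff ω n x else 0 := by
  simp only [PSum, sum_apply, map_sum, coeff_P, Finset.sum_ite_eq,
    Finset.mem_Icc, abs_le]

lemma mem_HSub {l : ℤ} {x : L2 ω H} : x ∈ HSub ω H l ↔ P ω l x = x := by
  constructor
  · rintro ⟨y, rfl⟩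
    exact ext_coeff fun n => by
      change coeff ω n (P ω l (P ω l y)) = coeff ω n (P ω l y)
      simp only [coeff_P]; split_ifs <;> rfl
  · intro h; exact ⟨x, h⟩

lemma mem_HSubSum {k : ℕ} {x : L2 ω H} : x ∈ HSubSum ω H k ↔ PSum ω k x = x := by
  constructor
  · rintro ⟨y, rfl⟩
    exact ext_coeff fun n => by
      change coeff ω n (PSum ω k (PSum ω k y)) = coeff ω n (PSum ω k y)
      simp only [coeff_PSum]; split_ifs <;> rfl
  · intro h; exact ⟨x, h⟩

instance completeSpace_HSub (l : ℤ) : CompleteSpace (HSub ω H l) := by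
  have : IsClosed (HSub ω H l : Set (L2 ω H)) := by
    have h : (HSub ω H l : Set (L2 ω H)) = {x | P ω l x = x} := Set.ext fun x => mem_HSub
    rw [h]
    exact isClosed_eq (P ω l).continuous continuous_id
  exact this.completeSpace_coe

instance completeSpace_HSubSum (k : ℕ) : CompleteSpace (HSubSum ω H k) := by
  have : IsClosed (HSubSum ω H k : Set (L2 ω H)) := by
    have h : (HSubSum ω H k : Set (L2 ω H)) = {x | PSum ω k x = x} := Set.ext fun x => mem_HSubSum
    rw [h]
    exact isClosed_eq (PSum ω k).continuous continuous_id
  exact this.completeSpace_coe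

lemma coeff_of_mem_HSub {l n : ℤ} {x : L2 ω H} (hx : x ∈ HSub ω H l) (hn : n ≠ l) :
    coeff ω n x = 0 := by
  rw [← mem_HSub.1 hx, coeff_P, if_neg hn]

lemma coeff_of_mem_HSubSum {k : ℕ} {n : ℤ} {x : L2 ω H} (hx : x ∈ HSubSum ω H k)
    (hn : (k : ℤ) < |n|) : coeff ω n x = 0 := by
  rw [← mem_HSubSum.1 hx, coeff_PSum, if_neg (not_le.2 hn)]

lemma character_mem_HSub (l : ℤ) (v : H) : character ω l v ∈ HSub ω H l :=
  mem_HSub.2 (by rw [P_apply, coeff_character, if_pos rfl])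

lemma character_mem_HSubSum {k : ℕ} {l : ℤ} (hl : |l| ≤ k) (v : H) :
    character ω l v ∈ HSubSum ω H k :=
  mem_HSubSum.2 (ext_coeff fun n => by
    rw [coeff_PSum, coeff_character]
    by_cases h : n = l
    · rw [h, if_pos hl]
    · simp [h])

lemma hasSum_P_tail (k : ℕ) (x : L2 ω H) :
    HasSum (fun l : {l : ℤ // (k : ℤ) < |l|} => P ω l x) (x - PSum ω k x) := by
  have h := hasSum_character_coeff (x - PSum ω k x)
  have h2 : (fun n => character ω n (coeff ω n (x - PSum ω k x)))
      = Set.indicator {l : ℤ | (k : ℤ) < |l|} fun n => P ω n x := by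
    funext n
    rw [map_sub, coeff_PSum]
    by_cases hn : |n| ≤ k
    · rw [if_pos hn, sub_self, map_zero, Set.indicator_of_notMem]
      exact not_lt.2 hn
    · rw [if_neg hn, sub_zero, Set.indicator_of_mem (show n ∈ {l : ℤ | (k : ℤ) < |l|} from
        not_le.1 hn)]
      rfl
  rw [h2] at h
  exact hasSum_subtype_iff_indicator.2 h

lemma norm_sq_eq_add (k : ℕ) (x : L2 ω H) :
    ‖x‖ ^ 2 = ‖PSum ω k x‖ ^ 2 + ‖x - PSum ω k x‖ ^ 2 := by
  refine (hasSum_norm_coeff x).unique ?_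
  convert (hasSum_norm_coeff (PSum ω k x)).add (hasSum_norm_coeff (x - PSum ω k x)) using 2 with n
  rw [map_sub, coeff_PSum]
  split_ifs <;> simp

lemma norm_le_of_blocks {k : ℕ} {x y : L2 ω H} {c : ℝ} (hc : 0 ≤ c)
    (h0 : ‖PSum ω k y‖ ≤ c * ‖PSum ω k x‖)
    (h1 : ∀ n : ℤ, (k : ℤ) < |n| → ‖P ω n y‖ ≤ c * ‖P ω n x‖) : ‖y‖ ≤ c * ‖x‖ := by
  refine (pow_le_pow_iff_left₀ (norm_nonneg _) (by positivity) two_ne_zero).1 ?_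
  have h2 : ‖y - PSum ω k y‖ ^ 2 ≤ c ^ 2 * ‖x - PSum ω k x‖ ^ 2 := by
    refine hasSum_le (fun n => ?_) (hasSum_norm_coeff _) ((hasSum_norm_coeff _).mul_left _)
    rw [map_sub, map_sub, coeff_PSum, coeff_PSum]
    by_cases hn : |n| ≤ k
    · simp [hn]
    · have := h1 n (not_le.1 hn)
      rw [P_apply, P_apply, norm_character, norm_character] at this
      rw [if_neg hn, if_neg hn, sub_zero, sub_zero, ← mul_pow]
      exact pow_le_pow_left₀ (norm_nonneg _) this 2
  have h3 := pow_le_pow_left₀ (norm_nonneg _) h0 2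
  rw [mul_pow] at h3 ⊢
  rw [norm_sq_eq_add k x, norm_sq_eq_add k y]
  linarith

/-! ### Block diagonal operators -/

/-- The bounded operator `M` is the orthogonal sum of `B₀` and the `B ℓ`. -/
structure IsBlock (k : ℕ) (M : L2 ω H →L[ℂ] L2 ω H) (B₀ : HSubSum ω H k →L[ℂ] HSubSum ω H k)
    (B : ∀ l : {l : ℤ // (k : ℤ) < |l|}, HSub ω H l →L[ℂ] HSub ω H l) : Prop where
  center : ∀ x : HSubSum ω H k, M x = B₀ x
  tail : ∀ (l : {l : ℤ // (k : ℤ) < |l|}) (x : HSub ω H l), M x = B l x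

section Block

variable {k : ℕ} {M : L2 ω H →L[ℂ] L2 ω H} {B₀ : HSubSum ω H k →L[ℂ] HSubSum ω H k}
  {B : ∀ l : {l : ℤ // (k : ℤ) < |l|}, HSub ω H l →L[ℂ] HSub ω H l}

lemma IsBlock.mem_center (h : IsBlock k M B₀ B) {x : L2 ω H} (hx : x ∈ HSubSum ω H k) :
    M x ∈ HSubSum ω H k := by
  rw [h.center ⟨x, hx⟩]; exact Subtype.coe_prop _

lemma IsBlock.mem_tail (h : IsBlock k M B₀ B) {l : ℤ} (hl : (k : ℤ) < |l|) {x : L2 ω H}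
    (hx : x ∈ HSub ω H l) : M x ∈ HSub ω H l := by
  rw [h.tail ⟨l, hl⟩ ⟨x, hx⟩]; exact Subtype.coe_prop _

/-- Within a block `T` is a scalar and `M` does not leave the block. The projections and the
truncated translations are operators `T` of this kind. -/
lemma IsBlock.commute (h : IsBlock k M B₀ B) {T : L2 ω H →L[ℂ] L2 ω H} {c₀ : ℂ} {c : ℤ → ℂ}
    (h0 : ∀ x ∈ HSubSum ω H k, T x = c₀ • x)
    (h1 : ∀ l : ℤ, (k : ℤ) < |l| → ∀ x ∈ HSub ω H l, T x = c l • x) : Commute M T := by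
  refine op_ext fun n v => ?_
  simp only [mul_apply_eq_comp]
  by_cases hn : |n| ≤ k
  · have := character_mem_HSubSum (ω := ω) hn v
    rw [h0 _ this, h0 _ (h.mem_center this), map_smul]
  · have := character_mem_HSub (ω := ω) n v
    rw [h1 n (not_le.1 hn) _ this, h1 n (not_le.1 hn) _ (h.mem_tail (not_le.1 hn) this), map_smul]

lemma IsBlock.commute_PSum (h : IsBlock k M B₀ B) : Commute M (PSum ω k) := by
  refine h.commute (c₀ := 1) (c := 0) (fun x hx => ?_) fun l hl x hx => ?_
  · rw [mem_HSubSum.1 hx, one_smul]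
  · refine ext_coeff fun n => ?_
    rw [coeff_PSum]
    split_ifs with hn
    · rw [coeff_of_mem_HSub hx (by rintro rfl; omega)]; simp
    · simp

lemma IsBlock.commute_P (h : IsBlock k M B₀ B) {l : ℤ} (hl : (k : ℤ) < |l|) :
    Commute M (P ω l) := by
  refine h.commute (c₀ := 0) (c := fun n => if n = l then 1 else 0) (fun x hx => ?_)
    fun n hn x hx => ?_
  · rw [P_apply, coeff_of_mem_HSubSum hx hl, map_zero, zero_smul]
  · split_ifs with hnl
    · subst hnl; rw [mem_HSub.1 hx, one_smul]
    · rw [P_apply, coeff_of_mem_HSub hx (Ne.symm hnl), map_zero, zero_smul]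

lemma IsBlock.opExp_center (h : IsBlock k M B₀ B) (z : ℂ) (x : HSubSum ω H k) :
    opExp (z • M) x = opExp (z • B₀) x :=
  opExp_intertwine (L := (HSubSum ω H k).subtypeL) (fun v => by simp [h.center]) x

lemma IsBlock.opExp_tail (h : IsBlock k M B₀ B) (z : ℂ) (l : {l : ℤ // (k : ℤ) < |l|})
    (x : HSub ω H l) : opExp (z • M) x = opExp (z • B l) x :=
  opExp_intertwine (L := (HSub ω H l).subtypeL) (fun v => by simp [h.tail]) x

lemma IsBlock.opExp (h : IsBlock k M B₀ B) (z : ℂ) :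
    IsBlock k (opExp (z • M)) (InvolutionGroup.opExp (z • B₀))
      (fun l => InvolutionGroup.opExp (z • B l)) :=
  ⟨h.opExp_center z, h.opExp_tail z⟩

lemma exists_isBlock (B₀ : HSubSum ω H k →L[ℂ] HSubSum ω H k)
    (B : ∀ l : {l : ℤ // (k : ℤ) < |l|}, HSub ω H l →L[ℂ] HSub ω H l) {b : ℝ} (hb0 : 0 ≤ b)
    (hb : ∀ l, ‖B l‖ ≤ b) : ∃ M : L2 ω H →L[ℂ] L2 ω H, IsBlock k M B₀ B := by
  let PP : L2 ω H →L[ℂ] HSubSum ω H k :=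
    (PSum ω k).codRestrict _ fun x => LinearMap.mem_range_self _ x
  let Pl : ∀ l : ℤ, L2 ω H →L[ℂ] HSub ω H l := fun l =>
    (P ω l).codRestrict _ fun x => LinearMap.mem_range_self _ x
  -- The tail blocks act on one frequency each, so their sum can be given coefficient by
  -- coefficient. The central block may mix frequencies and is added separately.
  let f : ℤ → L2 ω H →L[ℂ] H := fun n => if h : (k : ℤ) < |n|
    then (coeff ω n).comp ((HSub ω H n).subtypeL.comp ((B ⟨n, h⟩).comp (Pl n))) else 0
  have hf : ∀ n x, ‖f n x‖ ^ 2 ≤ b ^ 2 * ‖coeff ω n x‖ ^ 2 := by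
    intro n x
    by_cases h : (k : ℤ) < |n|
    · simp only [f, dif_pos h]
      rw [← mul_pow]
      refine pow_le_pow_left₀ (norm_nonneg _) ?_ 2
      refine (norm_coeff_le _ _).trans ?_
      change ‖B ⟨n, h⟩ (Pl n x)‖ ≤ _
      refine ((B ⟨n, h⟩).le_opNorm _).trans ?_
      have : ‖Pl n x‖ = ‖coeff ω n x‖ := by
        change ‖P ω n x‖ = _
        rw [P_apply, norm_character]
      rw [this]
      gcongr
      exact hb _
    · simp only [f, dif_neg h]
      simp
      positivity
  obtain ⟨X, hX, -⟩ := exists_op_of_coeff (fun n => (f n).toLinearMap) hb0 fun x => by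
    have h := (hasSum_norm_coeff x).mul_left (b ^ 2)
    have hs := Summable.of_nonneg_of_le (fun n => sq_nonneg _) (fun n => hf n x) h.summable
    exact ⟨_, hs.hasSum, by rw [mul_pow]; exact hasSum_le (fun n => hf n x) hs.hasSum h⟩
  refine ⟨(HSubSum ω H k).subtypeL.comp (B₀.comp PP) + X, fun x => ?_, fun l x => ?_⟩
  · have h1 : PP x = x := Subtype.ext (mem_HSubSum.1 x.2)
    have h2 : X x = 0 := ext_coeff fun n => by
      rw [hX, map_zero]
      by_cases h : (k : ℤ) < |n|
      · have h3 : Pl n x = 0 := Subtype.ext (by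
          change P ω n (x : L2 ω H) = 0
          rw [P_apply, coeff_of_mem_HSubSum x.2 h, map_zero])
        simp [f, dif_pos h, h3]
      · simp [f, dif_neg h]
    simp [h1, h2]
  · have h1 : PP x = 0 := Subtype.ext (ext_coeff fun n => by
      change coeff ω n (PSum ω k (x : L2 ω H)) = coeff ω n 0
      rw [coeff_PSum, map_zero]
      split_ifs with hn
      · exact coeff_of_mem_HSub x.2 (by rintro rfl; exact absurd l.2 (not_lt.2 hn))
      · rfl)
    have h2 : X x = B l x := ext_coeff fun n => by
      rw [hX]
      by_cases hn : n = l
      · subst hn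
        have h3 : Pl l x = x := Subtype.ext (mem_HSub.1 x.2)
        simp [f, dif_pos l.2, h3]
      · rw [coeff_of_mem_HSub (B l x).2 hn]
        by_cases h : (k : ℤ) < |n|
        · have h3 : Pl n x = 0 := Subtype.ext (by
            change P ω n (x : L2 ω H) = 0
            rw [P_apply, coeff_of_mem_HSub x.2 hn, map_zero])
          simp [f, dif_pos h, h3]
        · simp [f, dif_neg h]
    simp [h1, h2]

lemma exists_restrict (h0 : ∀ x ∈ HSubSum ω H k, M x ∈ HSubSum ω H k)
    (h1 : ∀ l : ℤ, (k : ℤ) < |l| → ∀ x ∈ HSub ω H l, M x ∈ HSub ω H l) :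
    ∃ (B₀ : HSubSum ω H k →L[ℂ] HSubSum ω H k)
      (B : ∀ l : {l : ℤ // (k : ℤ) < |l|}, HSub ω H l →L[ℂ] HSub ω H l), IsBlock k M B₀ B :=
  ⟨(M.comp (HSubSum ω H k).subtypeL).codRestrict _ fun x => h0 x x.2,
    fun l => (M.comp (HSub ω H l).subtypeL).codRestrict _ fun x => h1 l l.2 x x.2,
    fun _ => rfl, fun _ _ => rfl⟩

end Block

/-! ### Strong convergence in terms of Fourier coefficients -/

/-- Parseval's identity and dominated convergence for the series of squared coefficients. -/
lemma tendsto_of_coeff {ι : Type*} {l : Filter ι} {F : ι → L2 ω H} {f : L2 ω H} {b : ℤ → ℝ}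
    (hb : Summable b) (hle : ∀ᶠ i in l, ∀ n, ‖coeff ω n (F i) - coeff ω n f‖ ^ 2 ≤ b n)
    (h : ∀ n, Tendsto (fun i => coeff ω n (F i)) l (𝓝 (coeff ω n f))) : Tendsto F l (𝓝 f) := by
  have h1 : Tendsto (fun i => ∑' n, ‖coeff ω n (F i) - coeff ω n f‖ ^ 2) l (𝓝 0) := by
    rw [← tsum_zero (α := ℝ) (β := ℤ)]
    refine tendsto_tsum_of_dominated_convergence hb (fun n => ?_) ?_
    · have := ((h n).sub_const (coeff ω n f)).norm.pow 2
      simpa using this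
    · filter_upwards [hle] with i hi n
      rw [Real.norm_of_nonneg (sq_nonneg _)]
      exact hi n
  rw [tendsto_iff_norm_sub_tendsto_zero]
  have h2 := h1.sqrt
  rw [Real.sqrt_zero] at h2
  convert h2 using 2 with i
  have h3 := hasSum_norm_coeff (F i - f)
  simp only [map_sub] at h3
  rw [h3.tsum_eq, Real.sqrt_sq (norm_nonneg _)]

lemma S_zero : S (H := H) ω 0 = 1 := by
  ext1 x
  exact ext_coeff fun n => by simp [coeff_S]

lemma norm_S (t : ℝ) (x : L2 ω H) : ‖S ω t x‖ = ‖x‖ :=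
  (Lp.compMeasurePreservingₗᵢ ℂ (shift ω t) (measurePreserving_shift ω t)).norm_map x

lemma continuous_S (x : L2 ω H) : Continuous fun t => S ω t x := by
  refine continuous_iff_continuousAt.2 fun t₀ => ?_
  refine tendsto_of_coeff (((hasSum_norm_coeff x).summable).mul_left 4)
    (Eventually.of_forall fun t n => ?_) fun n => ?_
  · rw [coeff_S, coeff_S, ← sub_smul, norm_smul, mul_pow]
    gcongr
    have : ‖Complex.exp (eig ω n * t) - Complex.exp (eig ω n * t₀)‖ ≤ 2 := by
      refine (norm_sub_le _ _).trans ?_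
      rw [norm_exp_eig, norm_exp_eig]
      norm_num
    nlinarith [norm_nonneg (Complex.exp (eig ω n * t) - Complex.exp (eig ω n * t₀))]
  · simp only [coeff_S]
    exact ((continuous_exp_eig ω n).smul continuous_const).tendsto t₀

lemma tendsto_S {ι : Type*} {l : Filter ι} {t : ι → ℝ} {t₀ : ℝ} {u : ι → L2 ω H} {u₀ : L2 ω H}
    (ht : Tendsto t l (𝓝 t₀)) (hu : Tendsto u l (𝓝 u₀)) :
    Tendsto (fun i => S ω (t i) (u i)) l (𝓝 (S ω t₀ u₀)) := by
  have h1 : Tendsto (fun i => S ω (t i) u₀) l (𝓝 (S ω t₀ u₀)) :=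
    ((continuous_S u₀).tendsto t₀).comp ht
  have h2 : Tendsto (fun i => S ω (t i) (u i - u₀)) l (𝓝 0) := by
    rw [tendsto_zero_iff_norm_tendsto_zero]
    simp only [norm_S]
    exact tendsto_iff_norm_sub_tendsto_zero.1 hu
  simpa using h1.add h2

/-! ### The translation group and its generator -/

/-- The inequality `|e^{iθ} - 1| ≤ |θ|` bounds the `n`-th coefficient of the difference quotient by
that of `h`, uniformly in `t`. Its squared distance to the limit is then at most `4‖coeff ω n h‖²`,
a summable bound for passing to the limit coefficientwise. -/
theorem hasDerivAt_S_iff {x h : L2 ω H} :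
    HasDerivAt (fun t => S ω t x) h 0 ↔ ∀ n, coeff ω n h = eig ω n • coeff ω n x := by
  have hexp : ∀ n, HasDerivAt (fun t : ℝ => Complex.exp (eig ω n * t) • coeff ω n x)
      (eig ω n • coeff ω n x) 0 := fun n => by
    have h1 : HasDerivAt (fun s : ℝ => Complex.exp (eig ω n * s))
        (Complex.exp (eig ω n * (0 : ℝ)) * (eig ω n * 1)) 0 :=
      ((Complex.ofRealCLM.hasDerivAt (x := 0)).const_mul _).cexp
    simpa using h1.smul_const (coeff ω n x)
  constructor
  · intro hd n
    have h1 := (((coeff (H := H) ω n).restrictScalars ℝ).hasFDerivAt.comp_hasDerivAt (0 : ℝ) hd)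
    refine h1.unique ?_
    convert hexp n using 1
    funext t
    exact coeff_S t x n
  · intro hh
    rw [hasDerivAt_iff_tendsto_slope_zero]
    have hco : ∀ (t : ℝ) n, coeff ω n (t⁻¹ • (S ω (0 + t) x - S ω 0 x))
        = t⁻¹ • (Complex.exp (eig ω n * t) • coeff ω n x - coeff ω n x) := fun t n => by
      rw [zero_add, (coeff ω n).map_smul_of_tower, map_sub, coeff_S, coeff_S]
      simp
    refine tendsto_of_coeff ((hasSum_norm_coeff h).summable.mul_left 4) ?_ fun n => ?_
    · refine Eventually.of_forall fun t n => ?_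
      have h1 : ‖coeff ω n (t⁻¹ • (S ω (0 + t) x - S ω 0 x))‖ ≤ ‖coeff ω n h‖ := by
        have h0 : Complex.exp (eig ω n * t) • coeff ω n x - coeff ω n x
            = (Complex.exp (eig ω n * t) - 1) • coeff ω n x := by rw [sub_smul, one_smul]
        rw [hco, hh, h0, norm_smul, norm_smul, norm_smul, ← mul_assoc]
        gcongr
        have h2 : eig ω n * t = Complex.I * ((2 * Real.pi * n / ω * t : ℝ) : ℂ) := by
          simp only [eig]; push_cast; ring
        have h3 : ‖eig ω n‖ = |2 * Real.pi * n / ω| := by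
          have : eig ω n = Complex.I * ((2 * Real.pi * n / ω : ℝ) : ℂ) := by
            simp only [eig]; push_cast; ring
          rw [this, norm_mul, Complex.norm_I, one_mul, Complex.norm_real, Real.norm_eq_abs]
        have h4 := Real.norm_exp_I_mul_ofReal_sub_one_le (x := 2 * Real.pi * n / ω * t)
        rw [← h2, Real.norm_eq_abs, abs_mul, ← h3] at h4
        rw [norm_inv, Real.norm_eq_abs]
        by_cases ht : t = 0
        · simp [ht]
        · rw [inv_mul_le_iff₀ (abs_pos.2 ht)]
          linarith
      have h2 := norm_sub_le (coeff ω n (t⁻¹ • (S ω (0 + t) x - S ω 0 x))) (coeff ω n h)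
      nlinarith [norm_nonneg (coeff ω n (t⁻¹ • (S ω (0 + t) x - S ω 0 x)) - coeff ω n h),
        norm_nonneg (coeff ω n h)]
    · simp only [hco]
      have h1 := hasDerivAt_iff_tendsto_slope_zero.1 (hexp n)
      rw [hh]
      simpa using h1

/-- As `u 0 = 0`, the difference quotient is `S(t)` applied to `u(t)/t`, and strong continuity
suffices: `u'` need not lie in the domain of the generator of `S`. -/
lemma hasDerivAt_S_apply {u : ℝ → L2 ω H} {u' : L2 ω H} (hu : HasDerivAt u u' 0) (h0 : u 0 = 0) :
    HasDerivAt (fun t => S ω t (u t)) u' 0 := by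
  rw [hasDerivAt_iff_tendsto_slope_zero] at hu ⊢
  have h1 : Tendsto (fun t : ℝ => t) (𝓝[≠] 0) (𝓝 0) := tendsto_id.mono_left nhdsWithin_le_nhds
  have h2 := tendsto_S h1 hu
  rw [S_zero, one_apply_eq_self] at h2
  refine h2.congr fun t => ?_
  rw [(S ω t).map_smul_of_tower, zero_add, h0, map_zero, sub_zero, sub_zero]

/-! ### The group with a block diagonal generator -/

/-- The symbol of the part of `d/ds` in `H_(k)`. -/
def lowSymbol (ω : ℝ) (k : ℕ) (n : ℤ) : ℂ := if |n| ≤ k then eig ω n else 0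

lemma norm_eig (n : ℤ) : ‖eig ω n‖ = 2 * Real.pi * |(n : ℝ)| / ω := by
  have h : eig ω n = Complex.I * ((2 * Real.pi * n / ω : ℝ) : ℂ) := by
    simp only [eig]; push_cast; ring
  rw [h, norm_mul, Complex.norm_I, one_mul, Complex.norm_real, Real.norm_eq_abs, abs_div, abs_mul,
    abs_of_pos hω.out, abs_of_pos Real.two_pi_pos]

lemma norm_lowSymbol_le (k : ℕ) (n : ℤ) : ‖lowSymbol ω k n‖ ≤ 2 * Real.pi * k / ω := by
  have := hω.out
  have := Real.pi_pos
  rw [lowSymbol]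
  split_ifs with h
  · rw [norm_eig]
    have h' : |(n : ℝ)| ≤ k := by exact_mod_cast h
    gcongr
  · rw [norm_zero]; positivity

/-- The part of `d/ds` in `H_(k)`, extended by zero. -/
def low (ω : ℝ) [Fact (0 < ω)] (H : Type*) [NormedAddCommGroup H] [InnerProductSpace ℂ H]
    [CompleteSpace H] (k : ℕ) : L2 ω H →L[ℂ] L2 ω H := diag ω H (lowSymbol ω k)

lemma coeff_low (k : ℕ) (n : ℤ) (x : L2 ω H) :
    coeff ω n (low ω H k x) = lowSymbol ω k n • coeff ω n x :=
  coeff_diag (norm_lowSymbol_le k) n x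

lemma norm_low_le (k : ℕ) : ‖low ω H k‖ ≤ 2 * Real.pi * k / ω := norm_diag_le (norm_lowSymbol_le k)

lemma coeff_opExp_low (k : ℕ) (z : ℂ) (n : ℤ) (x : L2 ω H) :
    coeff ω n (opExp (z • low ω H k) x) = Complex.exp (z * lowSymbol ω k n) • coeff ω n x := by
  have h := opExp_intertwine (X := (z * lowSymbol ω k n) • (1 : H →L[ℂ] H))
    (Y := z • low ω H k) (L := coeff ω n) (fun v => by simp [coeff_low, mul_smul]) x
  rw [← h, opExp_smul_one]
  simp

/-- The translation group with its part in `H_(k)` replaced by the identity. -/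
def tailShift (ω : ℝ) [Fact (0 < ω)] (H : Type*) [NormedAddCommGroup H] [InnerProductSpace ℂ H]
    [CompleteSpace H] (k : ℕ) (t : ℝ) : L2 ω H →L[ℂ] L2 ω H :=
  S ω t * opExp ((-t : ℂ) • low ω H k)

lemma coeff_tailShift (k : ℕ) (t : ℝ) (n : ℤ) (x : L2 ω H) :
    coeff ω n (tailShift ω H k t x)
      = (if |n| ≤ k then 1 else Complex.exp (eig ω n * t)) • coeff ω n x := by
  rw [tailShift, mul_apply_eq_comp, coeff_S, coeff_opExp_low, smul_smul, ← Complex.exp_add,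
    lowSymbol]
  split_ifs
  · rw [show eig ω n * t + -t * eig ω n = 0 by ring, Complex.exp_zero]
  · rw [mul_zero, add_zero]

lemma tailShift_eq_opExp_mul (k : ℕ) (t : ℝ) :
    tailShift ω H k t = opExp ((-t : ℂ) • low ω H k) * S ω t := by
  ext1 x
  refine ext_coeff fun n => ?_
  rw [tailShift, mul_apply_eq_comp, mul_apply_eq_comp, coeff_S, coeff_opExp_low, coeff_opExp_low,
    coeff_S, smul_comm]

lemma tailShift_add (k : ℕ) (s t : ℝ) :
    tailShift ω H k (s + t) = tailShift ω H k s * tailShift ω H k t := by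
  ext1 x
  refine ext_coeff fun n => ?_
  rw [mul_apply_eq_comp, coeff_tailShift, coeff_tailShift, coeff_tailShift, smul_smul]
  split_ifs
  · simp
  · rw [← Complex.exp_add]; push_cast; ring_nf

lemma tailShift_zero (k : ℕ) : tailShift ω H k 0 = 1 := by
  ext1 x
  refine ext_coeff fun n => ?_
  rw [coeff_tailShift]
  simp

lemma tailShift_center {k : ℕ} (t : ℝ) {x : L2 ω H} (hx : x ∈ HSubSum ω H k) :
    tailShift ω H k t x = x := by
  refine ext_coeff fun n => ?_
  rw [coeff_tailShift]
  split_ifs with h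
  · rw [one_smul]
  · rw [coeff_of_mem_HSubSum hx (not_le.1 h), smul_zero]

lemma tailShift_tail {k : ℕ} (t : ℝ) {l : ℤ} (hl : (k : ℤ) < |l|) {x : L2 ω H}
    (hx : x ∈ HSub ω H l) : tailShift ω H k t x = Complex.exp (eig ω l * t) • x := by
  refine ext_coeff fun n => ?_
  rw [coeff_tailShift, map_smul]
  by_cases h : n = l
  · subst h; rw [if_neg (not_le.2 hl)]
  · rw [coeff_of_mem_HSub hx h, smul_zero, smul_zero]

lemma opExp_low_tail {k : ℕ} (z : ℂ) {l : ℤ} (hl : (k : ℤ) < |l|) {x : L2 ω H}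
    (hx : x ∈ HSub ω H l) : opExp (z • low ω H k) x = x := by
  refine ext_coeff fun n => ?_
  rw [coeff_opExp_low, lowSymbol]
  by_cases h : n = l
  · subst h; rw [if_neg (not_le.2 hl)]; simp
  · rw [coeff_of_mem_HSub hx h, smul_zero]

/-- The group generated by the sum of the part of `d/ds` outside `H_(k)` and `M`. -/
def blockGroup (k : ℕ) (M : L2 ω H →L[ℂ] L2 ω H) (t : ℝ) : L2 ω H →L[ℂ] L2 ω H :=
  tailShift ω H k t * opExp ((t : ℂ) • M)

section

variable {k : ℕ} {M : L2 ω H →L[ℂ] L2 ω H} {B₀ : HSubSum ω H k →L[ℂ] HSubSum ω H k}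
  {B : ∀ l : {l : ℤ // (k : ℤ) < |l|}, HSub ω H l →L[ℂ] HSub ω H l}

/-- This is the reason for splitting off the part in `H_(k)`: there `S(t)` acts by several different
scalars and need not commute with the central block of `M`. -/
lemma IsBlock.commute_tailShift (h : IsBlock k M B₀ B) (t : ℝ) :
    Commute M (tailShift ω H k t) :=
  h.commute (c₀ := 1) (fun x hx => by rw [tailShift_center t hx, one_smul])
    fun l hl x hx => tailShift_tail t hl hx

lemma IsBlock.isDirectSum_blockGroup (h : IsBlock k M B₀ B) (t : ℝ) :
    IsDirectSum k (blockGroup k M t) (InvolutionGroup.opExp ((t : ℂ) • B₀))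
      (fun l => InvolutionGroup.opExp
        ((t : ℂ) • (eig ω l • (1 : HSub ω H l →L[ℂ] HSub ω H l) + B l))) := by
  have hc : ∀ x : HSubSum ω H k, blockGroup k M t x = InvolutionGroup.opExp ((t : ℂ) • B₀) x := by
    intro x
    rw [blockGroup, mul_apply_eq_comp, h.opExp_center, tailShift_center t (Subtype.coe_prop _)]
  have ht : ∀ (l : {l : ℤ // (k : ℤ) < |l|}) (x : HSub ω H l), blockGroup k M t x =
      InvolutionGroup.opExp
        ((t : ℂ) • (eig ω l • (1 : HSub ω H l →L[ℂ] HSub ω H l) + B l)) x := by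
    intro l x
    rw [blockGroup, mul_apply_eq_comp, h.opExp_tail, tailShift_tail t l.2 (Subtype.coe_prop _),
      smul_add, smul_smul, opExp_smul_one_add, mul_comm (t : ℂ)]
    rfl
  refine ⟨hc, ht, fun x => ?_⟩
  rw [← hc, ← map_sub]
  have h1 := (blockGroup k M t).hasSum (hasSum_P_tail k x)
  convert h1 using 2 with l
  rw [← ht]

lemma IsBlock.isC0Group_blockGroup (h : IsBlock k M B₀ B) : IsC0Group (blockGroup k M) := by
  have hcomm : ∀ s t : ℝ, Commute (InvolutionGroup.opExp ((s : ℂ) • M)) (tailShift ω H k t) :=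
    fun s t => (h.opExp s).commute_tailShift t
  refine ⟨?_, fun s t => ?_, fun x => ?_⟩
  · rw [blockGroup, tailShift_zero, Complex.ofReal_zero, zero_smul, opExp_zero, one_mul]
  · rw [blockGroup, blockGroup, blockGroup, tailShift_add, Complex.ofReal_add, opExp_add_smul,
      mul_assoc, ← mul_assoc (tailShift ω H k t), ← (hcomm s t).eq]
    simp only [mul_assoc]
  · refine continuous_iff_continuousAt.2 fun t₀ => ?_
    have h1 : ∀ (X : L2 ω H →L[ℂ] L2 ω H), Continuous fun t : ℝ => InvolutionGroup.opExp ((t : ℂ) • X) :=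
      fun X => (continuous_iff_continuousAt.2 fun z =>
        (hasDerivAt_opExp_smul X z).continuousAt).comp Complex.continuous_ofReal
    have h2 : Continuous fun t : ℝ => InvolutionGroup.opExp ((-t : ℂ) • low ω H k)
        (InvolutionGroup.opExp ((t : ℂ) • M) x) := by
      have := (h1 (low ω H k)).comp continuous_neg
      simp only [Function.comp_def, Complex.ofReal_neg] at this
      exact this.clm_apply ((h1 M).clm_apply continuous_const)
    exact tendsto_S tendsto_id (h2.tendsto t₀)

/-- The orbit of `x` is `S(t)x` plus `S(t)` applied to a differentiable curve vanishing at `0`, so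
it is differentiable at `0` exactly when `S(t)x` is. The generator is thus `d/ds + M - low`, on the
domain of `d/ds`. -/
lemma hasDerivAt_blockGroup_iff {x f : L2 ω H} :
    HasDerivAt (fun t => blockGroup k M t x) f 0 ↔
      ∀ n, coeff ω n (f - (M - low ω H k) x) = eig ω n • coeff ω n x := by
  rw [← hasDerivAt_S_iff]
  have hE : HasDerivAt (fun t : ℝ => (opExp ((-t : ℂ) • low ω H k) * opExp ((t : ℂ) • M)) x)
      ((M - low ω H k) x) 0 := by
    have h1 := hasDerivAt_opExp_ofReal_smul M
    have h2 := hasDerivAt_opExp_ofReal_smul (-low ω H k)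
    have h3 := h2.mul h1
    have h4 : HasDerivAt (fun t : ℝ => (opExp ((t : ℂ) • -low ω H k) * opExp ((t : ℂ) • M)))
      (M - low ω H k) 0 := by
      refine h3.congr_deriv ?_
      simp [opExp_zero]
      abel
    have h5 := ((ContinuousLinearMap.apply ℂ (L2 ω H) x).restrictScalars ℝ).hasFDerivAt.comp_hasDerivAt
      (0 : ℝ) h4
    exact h5.congr_of_eventuallyEq (Eventually.of_forall fun t => by simp)
  have hu : HasDerivAt (fun t : ℝ => (opExp ((-t : ℂ) • low ω H k) * opExp ((t : ℂ) • M)) x - x)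
      ((M - low ω H k) x) 0 := hE.sub_const x
  have hS := hasDerivAt_S_apply hu (by simp [opExp_zero])
  have heq : ∀ t : ℝ, blockGroup k M t x
      = S ω t x + S ω t ((opExp ((-t : ℂ) • low ω H k) * opExp ((t : ℂ) • M)) x - x) := fun t => by
    rw [← map_add, add_sub_cancel, blockGroup, tailShift, mul_assoc]
    rfl
  simp only [heq]
  constructor
  · intro hf
    have := hf.sub hS
    refine this.congr_of_eventuallyEq (Eventually.of_forall fun t => ?_)
    simp
  · intro hf
    exact (hf.add hS).congr_deriv (sub_add_cancel _ _)

/-! ### Uniqueness and the entire factors -/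

/-- Through this lemma the group of an arbitrary representation is identified with the explicit
`blockGroup`. -/
lemma IsDirectSum.unique {A A' : L2 ω H →L[ℂ] L2 ω H} {A₀ : HSubSum ω H k →L[ℂ] HSubSum ω H k}
    {D : ∀ l : {l : ℤ // (k : ℤ) < |l|}, HSub ω H l →L[ℂ] HSub ω H l}
    (h : IsDirectSum k A A₀ D) (h' : IsDirectSum k A' A₀ D) : A = A' := by
  ext1 x
  have := (h.hasSum x).unique (h'.hasSum x)
  exact sub_left_inj.1 this

lemma differentiable_opExp_smul (X : L2 ω H →L[ℂ] L2 ω H) :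
    Differentiable ℂ fun z : ℂ => opExp (z • X) :=
  fun z => (hasDerivAt_opExp_smul X z).differentiableAt

lemma differentiable_opExp_neg_smul (X : L2 ω H →L[ℂ] L2 ω H) :
    Differentiable ℂ fun z : ℂ => opExp (-z • X) :=
  (differentiable_opExp_smul X).comp differentiable_neg

lemma isBlock_low (k : ℕ) : ∃ (A₀ : HSubSum ω H k →L[ℂ] HSubSum ω H k)
    (A : ∀ l : {l : ℤ // (k : ℤ) < |l|}, HSub ω H l →L[ℂ] HSub ω H l), IsBlock k (low ω H k) A₀ A := by
  refine exists_restrict (fun x hx => mem_HSubSum.2 (ext_coeff fun n => ?_)) fun l _ x hx =>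
    mem_HSub.2 (ext_coeff fun n => ?_)
  · rw [coeff_PSum, coeff_low, lowSymbol]; split_ifs <;> simp
  · rw [coeff_P, coeff_low]
    split_ifs with h
    · rfl
    · rw [coeff_of_mem_HSub hx h, smul_zero]

lemma norm_le_of_commute {N : L2 ω H →L[ℂ] L2 ω H} {c : ℝ} (hc : 0 ≤ c)
    (hN : Commute N (PSum ω k)) (hN' : ∀ l : ℤ, (k : ℤ) < |l| → Commute N (P ω l))
    (h0 : ∀ x ∈ HSubSum ω H k, ‖N x‖ ≤ c * ‖x‖)
    (h1 : ∀ l : ℤ, (k : ℤ) < |l| → ∀ x ∈ HSub ω H l, ‖N x‖ ≤ c * ‖x‖) : ‖N‖ ≤ c := by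
  refine ContinuousLinearMap.opNorm_le_bound _ hc fun x => norm_le_of_blocks (k := k) hc ?_ ?_
  · have : PSum ω k (N x) = N (PSum ω k x) := (DFunLike.congr_fun hN.eq x).symm
    rw [this]
    exact h0 _ ⟨x, rfl⟩
  · intro n hn
    have : P ω n (N x) = N (P ω n x) := (DFunLike.congr_fun (hN' n hn).eq x).symm
    rw [this]
    exact h1 n hn _ ⟨x, rfl⟩

end

/-! ### Growth of the entire factors -/

lemma norm_opExp_smul_apply_le {E : Type*} [NormedAddCommGroup E] [NormedSpace ℂ E]
    [CompleteSpace E] (z : ℂ) (X : E →L[ℂ] E) (v : E) :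
    ‖opExp (z • X) v‖ ≤ Real.exp (‖z‖ * ‖X‖) * ‖v‖ := by
  rw [← norm_smul]
  exact norm_opExp_apply_le _ v

section

variable {k : ℕ} {B₀ : HSubSum ω H k →L[ℂ] HSubSum ω H k}
  {B : ∀ l : {l : ℤ // (k : ℤ) < |l|}, HSub ω H l →L[ℂ] HSub ω H l}

lemma bddAbove_growthBound (hB : Summable fun l => ‖B l‖ ^ 2) :
    BddAbove (insert (2 * Real.pi * k / ω + ‖B₀‖) (Set.range fun l => ‖B l‖)) := by
  refine BddAbove.insert _ ⟨√(∑' l, ‖B l‖ ^ 2), ?_⟩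
  rintro _ ⟨l, rfl⟩
  exact Real.le_sqrt_of_sq_le (hB.le_tsum l fun _ _ => sq_nonneg _)

lemma le_growthBound_center (hB : Summable fun l => ‖B l‖ ^ 2) :
    2 * Real.pi * k / ω + ‖B₀‖ ≤ growthBound k B₀ B :=
  le_csSup (bddAbove_growthBound hB) (Set.mem_insert _ _)

lemma le_growthBound_tail (hB : Summable fun l => ‖B l‖ ^ 2) (l : {l : ℤ // (k : ℤ) < |l|}) :
    ‖B l‖ ≤ growthBound k B₀ B :=
  le_csSup (bddAbove_growthBound hB) (Set.mem_insert_of_mem _ ⟨l, rfl⟩)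

variable {M : L2 ω H →L[ℂ] L2 ω H}

lemma IsBlock.norm_opExp_center_le (h : IsBlock k M B₀ B) (z : ℂ) {x : L2 ω H}
    (hx : x ∈ HSubSum ω H k) :
    ‖InvolutionGroup.opExp (z • M) x‖ ≤ Real.exp (‖z‖ * ‖B₀‖) * ‖x‖ := by
  have h1 := norm_opExp_smul_apply_le z B₀ ⟨x, hx⟩
  rw [h.opExp_center z ⟨x, hx⟩]
  exact h1

lemma IsBlock.norm_opExp_tail_le (h : IsBlock k M B₀ B) (z : ℂ) (l : {l : ℤ // (k : ℤ) < |l|})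
    {x : L2 ω H} (hx : x ∈ HSub ω H l) :
    ‖InvolutionGroup.opExp (z • M) x‖ ≤ Real.exp (‖z‖ * ‖B l‖) * ‖x‖ := by
  have h1 := norm_opExp_smul_apply_le z (B l) ⟨x, hx⟩
  rw [h.opExp_tail z l ⟨x, hx⟩]
  exact h1

lemma norm_opExp_low_le (k : ℕ) (z : ℂ) (x : L2 ω H) :
    ‖opExp (-z • low ω H k) x‖ ≤ Real.exp (‖z‖ * (2 * Real.pi * k / ω)) * ‖x‖ := by
  refine (norm_opExp_apply_le _ _).trans ?_
  rw [norm_smul, norm_neg]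
  gcongr
  exact norm_low_le k

lemma growthBound_nonneg (hB : Summable fun l => ‖B l‖ ^ 2) : 0 ≤ growthBound k B₀ B := by
  have := hω.out
  have := Real.pi_pos
  exact le_trans (by positivity) (le_growthBound_center hB)

/-- Both exponentials preserve the orthogonal blocks, so block estimates suffice. On `H_(k)` the
exponents `‖B₀‖` and `2πk/ω` add up; on the other blocks the exponential of `low` is the identity
and only `‖B l‖` remains. -/
lemma IsBlock.norm_factor_le (h : IsBlock k M B₀ B) (hB : Summable fun l => ‖B l‖ ^ 2) (z : ℂ) :
    max ‖InvolutionGroup.opExp (z • M) * InvolutionGroup.opExp (-z • low ω H k)‖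
      ‖InvolutionGroup.opExp (-z • low ω H k) * InvolutionGroup.opExp (z • M)‖
      ≤ Real.exp (growthBound k B₀ B * ‖z‖) := by
  obtain ⟨A₀, A, hA⟩ := isBlock_low (ω := ω) (H := H) k
  have hM' := h.opExp z
  have hA' := hA.opExp (-z)
  have hcenter : Real.exp (‖z‖ * ‖B₀‖) * Real.exp (‖z‖ * (2 * Real.pi * k / ω))
      ≤ Real.exp (growthBound k B₀ B * ‖z‖) := by
    rw [← Real.exp_add, Real.exp_le_exp]
    nlinarith [mul_le_mul_of_nonneg_right (le_growthBound_center (B₀ := B₀) hB) (norm_nonneg z)]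
  have htail : ∀ l : {l : ℤ // (k : ℤ) < |l|},
      Real.exp (‖z‖ * ‖B l‖) ≤ Real.exp (growthBound k B₀ B * ‖z‖) := fun l => by
    rw [Real.exp_le_exp, mul_comm]
    exact mul_le_mul_of_nonneg_right (le_growthBound_tail hB l) (norm_nonneg z)
  refine max_le ?_ ?_
  · refine norm_le_of_commute (k := k) (Real.exp_pos _).le
      (hM'.commute_PSum.mul_left hA'.commute_PSum)
      (fun l hl => (hM'.commute_P hl).mul_left (hA'.commute_P hl)) (fun x hx => ?_)
      fun l hl x hx => ?_
    · rw [mul_apply_eq_comp]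
      refine (h.norm_opExp_center_le z (hA'.mem_center hx)).trans ?_
      refine (mul_le_mul_of_nonneg_left (norm_opExp_low_le k z x) (Real.exp_pos _).le).trans ?_
      rw [← mul_assoc]
      gcongr
    · rw [mul_apply_eq_comp, opExp_low_tail _ hl hx]
      exact (h.norm_opExp_tail_le z ⟨l, hl⟩ hx).trans
        (mul_le_mul_of_nonneg_right (htail _) (norm_nonneg _))
  · refine norm_le_of_commute (k := k) (Real.exp_pos _).le
      (hA'.commute_PSum.mul_left hM'.commute_PSum)
      (fun l hl => (hA'.commute_P hl).mul_left (hM'.commute_P hl)) (fun x hx => ?_)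
      fun l hl x hx => ?_
    · rw [mul_apply_eq_comp]
      refine (norm_opExp_low_le k z _).trans ?_
      refine (mul_le_mul_of_nonneg_left (h.norm_opExp_center_le z hx) (Real.exp_pos _).le).trans ?_
      rw [← mul_assoc, mul_comm (Real.exp _) (Real.exp _)]
      gcongr
    · rw [mul_apply_eq_comp, opExp_low_tail _ hl (hM'.mem_tail hl hx)]
      exact (h.norm_opExp_tail_le z ⟨l, hl⟩ hx).trans
        (mul_le_mul_of_nonneg_right (htail _) (norm_nonneg _))

/-- In `S(t) e^{-t low} e^{tM}` the first two factors commute with each other and their product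
commutes with `e^{tM}`, so `S(t)` can be moved to either end. The two resulting factors may differ
on `H_(k)`, where `low` need not commute with `B₀`. -/
theorem exists_entire_factors {V : ℝ → H →L[ℂ] H} {T : ℝ → L2 ω H →L[ℂ] L2 ω H}
    {U : (L2 ω H →L[ℂ] L2 ω H)ˣ} (h : IsSimilarGroupData V T U k B₀ B) :
    ∃ Φl Φr : ℂ → L2 ω H →L[ℂ] L2 ω H,
      IsEntireOfExponentialType Φl ∧ IsEntireOfExponentialType Φr ∧
      (∀ t : ℝ, similarGroup T U t = S ω t * Φr t ∧ similarGroup T U t = Φl t * S ω t) ∧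
      (∀ j : ℤ, (k : ℤ) < |j| → ∀ x ∈ HSub ω H j, ∀ z : ℂ, Φl z x = Φr z x) ∧
      ∀ z : ℂ, max ‖Φl z‖ ‖Φr z‖ ≤ Real.exp (growthBound k B₀ B * ‖z‖) := by
  obtain ⟨M, hM⟩ := exists_isBlock B₀ B (growthBound_nonneg (B₀ := B₀) h.summable)
    (le_growthBound_tail h.summable)
  have hT : ∀ t, similarGroup T U t = blockGroup k M t := fun t =>
    (h.directSum t).unique (hM.isDirectSum_blockGroup t)
  have hle := hM.norm_factor_le h.summable
  refine ⟨fun z => opExp (z • M) * opExp (-z • low ω H k),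
    fun z => opExp (-z • low ω H k) * opExp (z • M), ⟨?_, 1, growthBound k B₀ B, fun z => ?_⟩,
    ⟨?_, 1, growthBound k B₀ B, fun z => ?_⟩, fun t => ⟨?_, ?_⟩, fun j hj x hx z => ?_, hle⟩
  · exact (differentiable_opExp_smul M).mul (differentiable_opExp_neg_smul _)
  · rw [one_mul]; exact (le_max_left _ _).trans (hle z)
  · exact (differentiable_opExp_neg_smul _).mul (differentiable_opExp_smul M)
  · rw [one_mul]; exact (le_max_right _ _).trans (hle z)
  · rw [hT, blockGroup, tailShift, mul_assoc]
  · rw [hT, blockGroup, mul_assoc, ← tailShift_eq_opExp_mul]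
    exact ((hM.opExp t).commute_tailShift t).eq.symm
  · rw [mul_apply_eq_comp, mul_apply_eq_comp, opExp_low_tail _ hj hx,
      opExp_low_tail _ hj ((hM.opExp z).mem_tail hj hx)]

end

/-- Banach's theorem on the closed ball of radius `r`, which is invariant because the Lipschitz
constant `1/2` contributes at most `r/2` on top of `‖F 0‖`. -/
lemma exists_fixedPoint_of_half_lipschitz {E : Type*} [NormedAddCommGroup E] [CompleteSpace E]
    {F : E → E} {r : ℝ} (hr : 0 ≤ r) (h0 : ‖F 0‖ ≤ r / 2)
    (hF : ∀ x y, ‖x‖ ≤ r → ‖y‖ ≤ r → ‖F x - F y‖ ≤ 1 / 2 * ‖x - y‖) :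
    ∃ x, ‖x‖ ≤ r ∧ F x = x := by
  have hmaps : Set.MapsTo F (Metric.closedBall 0 r) (Metric.closedBall 0 r) := fun x hx => by
    rw [mem_closedBall_zero_iff] at hx ⊢
    have h1 := hF x 0 hx (by simpa using hr)
    rw [sub_zero] at h1
    have h2 := norm_le_norm_sub_add (F x) (F 0)
    linarith
  have hc : ContractingWith (1 / 2) (hmaps.restrict F _ _) := by
    refine ⟨by rw [div_lt_one two_pos]; exact one_lt_two, LipschitzWith.of_dist_le_mul fun x y => ?_⟩
    have := hF x y (mem_closedBall_zero_iff.1 x.2) (mem_closedBall_zero_iff.1 y.2)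
    rw [Subtype.dist_eq, Subtype.dist_eq, dist_eq_norm, dist_eq_norm]
    simpa using this
  obtain ⟨x, hx, hfx, -⟩ := hc.exists_fixedPoint' Metric.isClosed_closedBall.isComplete hmaps
    (x := 0) (by simpa using hr) (edist_ne_top _ _)
  exact ⟨x, mem_closedBall_zero_iff.1 hx, hfx⟩

lemma regroup_fixedPoint {G : Type*} [AddCommGroup G] {c d a₁ a₂ a₃ a₄ b x : G}
    (h : c + a₁ + a₂ - a₃ - a₄ = x) : x - b = c + d + (a₁ + a₂) - (d + b) - (a₃ + a₄) := by
  rw [← h]; abel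

/-! ### Truncations and the commutator equation -/

open Classical in
/-- The indicator symbol of a set of matrix positions. -/
def ind (p : ℤ × ℤ → Prop) (q : ℤ × ℤ) : ℂ := if p q then 1 else 0

lemma norm_ind_le (p : ℤ × ℤ → Prop) (q : ℤ × ℤ) : ‖ind p q‖ ≤ 1 := by
  rw [ind]; split_ifs <;> simp

/-- Dominated convergence over the entries, each of which is eventually discarded. The small
matrices in both similarities arise in this way. -/
lemma tendsto_norm_scale_ind {p : ℕ → ℤ × ℤ → Prop} (hp : ∀ q, ∀ᶠ m in atTop, ¬ p m q)
    (M : Mat H) : Tendsto (fun m => ‖scale (ind (p m)) M‖) atTop (𝓝 0) := by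
  have h1 : Tendsto (fun m => ∑' q, ‖scale (ind (p m)) M q‖ ^ 2) atTop (𝓝 0) := by
    rw [← tsum_zero (α := ℝ) (β := ℤ × ℤ)]
    refine tendsto_tsum_of_dominated_convergence M.hasSum_norm_sq.summable (fun q => ?_)
      (Eventually.of_forall fun m q => ?_)
    · refine tendsto_const_nhds.congr' ?_
      filter_upwards [hp q] with m hm
      rw [scale_apply (norm_ind_le _), ind, if_neg hm]
      simp
    · rw [Real.norm_of_nonneg (sq_nonneg _), scale_apply (norm_ind_le _), norm_smul]
      refine pow_le_pow_left₀ (by positivity) ?_ 2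
      exact mul_le_of_le_one_left (norm_nonneg _) (norm_ind_le _ _)
  have h2 := h1.sqrt
  rw [Real.sqrt_zero] at h2
  convert h2 using 2 with m
  rw [(scale (ind (p m)) M).hasSum_norm_sq.tsum_eq, Real.sqrt_sq (norm_nonneg _)]

/-- The positions of the blocks of an operator on `H_(k) ⊕ ⨁_{|ℓ| > k} H_ℓ`. -/
def InBlock (k : ℕ) (q : ℤ × ℤ) : Prop := (|q.1| ≤ k ∧ |q.2| ≤ k) ∨ q.1 = q.2

open Classical in
/-- The symbol of the solution operator of the commutator equation `AY - YA = X` off the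
diagonal blocks, where `A = d/ds`. -/
def commSymbol (ω : ℝ) (k : ℕ) (q : ℤ × ℤ) : ℂ :=
  if InBlock k q then 0 else (eig ω (q.1 - q.2))⁻¹

lemma norm_eig_inv_le {d : ℤ} {N : ℝ} (hN : 0 < N) (hd : N ≤ |(d : ℝ)|) :
    ‖(eig ω d)⁻¹‖ ≤ ω / (2 * Real.pi) / N := by
  have := hω.out
  have := Real.pi_pos
  rw [norm_inv, norm_eig, inv_div, div_div]
  gcongr

lemma norm_commSymbol_le (k : ℕ) (q : ℤ × ℤ) : ‖commSymbol ω k q‖ ≤ ω / (2 * Real.pi) := by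
  have h1 := hω.out
  have h2 := Real.pi_pos
  rw [commSymbol]
  split_ifs with h
  · rw [norm_zero]; positivity
  · have h3 : q.1 ≠ q.2 := fun he => h (Or.inr he)
    have h4 : (1 : ℝ) ≤ |((q.1 - q.2 : ℤ) : ℝ)| := by
      exact_mod_cast Int.one_le_abs (sub_ne_zero.2 h3)
    simpa using norm_eig_inv_le (ω := ω) one_pos h4

/-- Off the blocks, an index of modulus at most `m` forces the other one beyond `k`, so the divisor
is large. Raising `k` at fixed `m` compensates for the low block `D` of `C`, which is not small. -/
lemma norm_commSymbol_le_of_low {m k : ℕ} (hmk : m < k) {q : ℤ × ℤ}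
    (hq : |q.1| ≤ m ∨ |q.2| ≤ m) :
    ‖commSymbol ω k q‖ ≤ ω / (2 * Real.pi) / (k - m) := by
  have h1 := hω.out
  have h2 := Real.pi_pos
  have h3 : (0 : ℝ) < k - m := sub_pos.2 (by exact_mod_cast hmk)
  rw [commSymbol]
  split_ifs with h
  · rw [norm_zero]; positivity
  · refine norm_eig_inv_le h3 ?_
    have h4 : (k : ℤ) - m ≤ |q.1 - q.2| := by
      have h5 : ¬ (|q.1| ≤ k ∧ |q.2| ≤ k) := fun he => h (Or.inl he)
      have h6 := abs_sub_abs_le_abs_sub q.1 q.2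
      have h7 := abs_sub_abs_le_abs_sub q.2 q.1
      rw [abs_sub_comm q.2 q.1] at h7
      omega
    exact_mod_cast h4

lemma scale_scale {γ δ : ℤ × ℤ → ℂ} {C D : ℝ} (hγ : ∀ q, ‖γ q‖ ≤ C) (hδ : ∀ q, ‖δ q‖ ≤ D)
    (M : Mat H) : scale γ (scale δ M) = scale (fun q => γ q * δ q) M := by
  refine Mat.ext' fun j n => ?_
  rw [scale_apply hγ, scale_apply hδ, scale_apply (C := C * D) (fun q => ?_), smul_smul]
  rw [norm_mul]
  exact mul_le_mul (hγ q) (hδ q) (norm_nonneg _) ((norm_nonneg _).trans (hγ q))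

section

variable {m k : ℕ} (hmk : m < k) {D : Mat H}
  (hD : ∀ j n, ¬ (|j| ≤ (m : ℤ) ∧ |n| ≤ (m : ℤ)) → D (j, n) = 0)

include hmk hD

/-- Only the rows with index at most `m` in modulus are seen by `D`, and there the symbol is small.
For the product in the other order the same holds with columns. -/
lemma norm_low_mul_comm_le (X : Mat H) :
    ‖D.mul (scale (commSymbol ω k) X)‖ ≤ ‖D‖ * (ω / (2 * Real.pi) / (k - m) * ‖X‖) := by
  have h1 : D.mul (scale (commSymbol ω k) X)
      = D.mul (scale (ind fun q => |q.1| ≤ m) (scale (commSymbol ω k) X)) := by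
    refine Mat.ext' fun j n => ?_
    rw [Mat.mul_apply, Mat.mul_apply]
    refine tsum_congr fun p => ?_
    rw [scale_apply (norm_ind_le _), ind]
    split_ifs with hp
    · rw [one_smul]
    · rw [hD j p fun h => hp h.2]; simp
  rw [h1, scale_scale (norm_ind_le _) (norm_commSymbol_le k)]
  refine (Mat.norm_mul_le _ _).trans (mul_le_mul_of_nonneg_left ?_ (norm_nonneg _))
  refine norm_scale_le (fun q => ?_) X
  rw [norm_mul, ind]
  split_ifs with hp
  · simpa using norm_commSymbol_le_of_low hmk (Or.inl hp)
  · have h1 := hω.out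
    have h2 := Real.pi_pos
    have h3 : (0 : ℝ) < k - m := sub_pos.2 (by exact_mod_cast hmk)
    rw [norm_zero, zero_mul]
    positivity

lemma norm_comm_mul_low_le (X : Mat H) :
    ‖(scale (commSymbol ω k) X).mul D‖ ≤ (ω / (2 * Real.pi) / (k - m) * ‖X‖) * ‖D‖ := by
  have h1 : (scale (commSymbol ω k) X).mul D
      = (scale (ind fun q => |q.2| ≤ m) (scale (commSymbol ω k) X)).mul D := by
    refine Mat.ext' fun j n => ?_
    rw [Mat.mul_apply, Mat.mul_apply]
    refine tsum_congr fun p => ?_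
    rw [scale_apply (norm_ind_le _), ind]
    split_ifs with hp
    · rw [one_smul]
    · rw [hD p n fun h => hp h.1]; simp
  rw [h1, scale_scale (norm_ind_le _) (norm_commSymbol_le k)]
  refine (Mat.norm_mul_le _ _).trans (mul_le_mul_of_nonneg_right ?_ (norm_nonneg _))
  refine norm_scale_le (fun q => ?_) X
  rw [norm_mul, ind]
  split_ifs with hp
  · simpa using norm_commSymbol_le_of_low hmk (Or.inr hp)
  · have h1 := hω.out
    have h2 := Real.pi_pos
    have h3 : (0 : ℝ) < k - m := sub_pos.2 (by exact_mod_cast hmk)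
    rw [norm_zero, zero_mul]
    positivity

end

/-- For every Hilbert–Schmidt matrix `C`, the operator `d/ds - C` is, at the level of matrices,
similar to `d/ds - Z` with `Z` block diagonal. -/
theorem exists_block_diagonalization (ω : ℝ) [hω : Fact (0 < ω)] (C : Mat H) :
    ∃ (k : ℕ) (X Z : Mat H), ‖scale (commSymbol ω k) X‖ < 1 ∧
      (∀ j n, ¬ InBlock k (j, n) → Z (j, n) = 0) ∧
      X - scale (ind (InBlock k)) X = C + C.mul (scale (commSymbol ω k) X) - Z
        - (scale (commSymbol ω k) X).mul Z := by
  have hω0 := hω.out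
  have hpi := Real.pi_pos
  set c₀ := ω / (2 * Real.pi) with hc₀
  have hc₀pos : 0 < c₀ := by positivity
  -- The bound `1/(20 c₀)` here and `N > 8 c₀ ‖D‖` below make the five Lipschitz constants in `hlip`
  -- equal to `1/20`, `1/8`, `1/8`, `1/10` and `1/10`, with sum `1/2`.
  obtain ⟨m, hm⟩ : ∃ m : ℕ, ‖scale (ind fun q => ¬ (|q.1| ≤ (m : ℤ) ∧ |q.2| ≤ (m : ℤ))) C‖
      < 1 / (20 * c₀) := by
    refine ((tendsto_norm_scale_ind (fun q => ?_) C).eventually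
      (gt_mem_nhds (show (0 : ℝ) < 1 / (20 * c₀) by positivity))).exists
    filter_upwards [eventually_ge_atTop (max q.1.natAbs q.2.natAbs)] with m hm
    rw [not_not, Int.abs_eq_natAbs, Int.abs_eq_natAbs]
    omega
  set C' := scale (ind fun q => ¬ (|q.1| ≤ (m : ℤ) ∧ |q.2| ≤ (m : ℤ))) C with hC'
  set D := C - C' with hDdef
  have hD : ∀ j n, ¬ (|j| ≤ (m : ℤ) ∧ |n| ≤ (m : ℤ)) → D (j, n) = 0 := fun j n h => by
    rw [hDdef, lp.coeFn_sub, Pi.sub_apply, hC', scale_apply (norm_ind_le _), ind, if_pos h, one_smul,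
      sub_self]
  obtain ⟨N, hN⟩ := exists_nat_gt (8 * c₀ * ‖D‖)
  set k := m + N + 1 with hk
  have hmk : m < k := by omega
  set η := c₀ / ((k : ℝ) - m) with hη
  have hkm : (k : ℝ) - m = N + 1 := by rw [hk]; push_cast; ring
  have hηD : η * ‖D‖ ≤ 1 / 8 := by
    rw [hη, hkm, div_mul_eq_mul_div, div_le_iff₀ (by positivity)]
    linarith
  set ε := ‖C'‖ with hε
  have hcε : c₀ * ε ≤ 1 / 20 := by
    rw [lt_div_iff₀ (by positivity)] at hm
    linarith
  have hε0 : 0 ≤ ε := norm_nonneg _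
  let Γ : Mat H → Mat H := scale (commSymbol ω k)
  let J : Mat H → Mat H := scale (ind (InBlock k))
  have hΓ : ∀ X, ‖Γ X‖ ≤ c₀ * ‖X‖ := fun X => norm_scale_le (norm_commSymbol_le k) X
  have hJ : ∀ X, ‖J X‖ ≤ ‖X‖ := fun X => by
    simpa using norm_scale_le (norm_ind_le (InBlock k)) X
  have hΓs : ∀ X Y, Γ X - Γ Y = Γ (X - Y) := fun X Y => (scale_sub (norm_commSymbol_le k) X Y).symm
  have hJs : ∀ X Y, J X - J Y = J (X - Y) := fun X Y => (scale_sub (norm_ind_le _) X Y).symm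
  -- The goal is `(A - C)(1 + ΓX) = (1 + ΓX)(A - Z)`, where `AΓX - ΓXA = X - JX`. Putting `Z = D +
  -- JX` and cancelling `JX` leaves `X = F X`.
  let F : Mat H → Mat H := fun X =>
    C' + C'.mul (Γ X) + D.mul (Γ X) - (Γ X).mul D - (Γ X).mul (J X)
  have hdiff : ∀ X Y, F X - F Y = C'.mul (Γ (X - Y)) + D.mul (Γ (X - Y)) - (Γ (X - Y)).mul D
      - ((Γ (X - Y)).mul (J X) + (Γ Y).mul (J (X - Y))) := fun X Y => by
    simp only [F, ← hΓs, ← hJs, Mat.sub_mul, Mat.mul_sub]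
    abel
  have hlip : ∀ X Y, ‖X‖ ≤ 2 * ε → ‖Y‖ ≤ 2 * ε → ‖F X - F Y‖ ≤ 1 / 2 * ‖X - Y‖ := by
    intro X Y hX hY
    set W := X - Y with hW
    have hW0 := norm_nonneg W
    have e1 : ‖C'.mul (Γ W)‖ ≤ 1 / 20 * ‖W‖ := by
      refine (Mat.norm_mul_le _ _).trans ?_
      nlinarith [mul_le_mul_of_nonneg_left (hΓ W) hε0]
    have e2 : ‖D.mul (Γ W)‖ ≤ 1 / 8 * ‖W‖ := by
      refine (norm_low_mul_comm_le hmk hD W).trans ?_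
      change ‖D‖ * (η * ‖W‖) ≤ _
      nlinarith
    have e3 : ‖(Γ W).mul D‖ ≤ 1 / 8 * ‖W‖ := by
      refine (norm_comm_mul_low_le hmk hD W).trans ?_
      change (η * ‖W‖) * ‖D‖ ≤ _
      nlinarith
    have e4 : ‖(Γ W).mul (J X)‖ ≤ 1 / 10 * ‖W‖ := by
      refine (Mat.norm_mul_le _ _).trans ?_
      refine (mul_le_mul (hΓ W) ((hJ X).trans hX) (norm_nonneg _) (by positivity)).trans ?_
      nlinarith
    have e5 : ‖(Γ Y).mul (J W)‖ ≤ 1 / 10 * ‖W‖ := by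
      refine (Mat.norm_mul_le _ _).trans ?_
      refine (mul_le_mul ((hΓ Y).trans (mul_le_mul_of_nonneg_left hY hc₀pos.le)) (hJ W)
        (norm_nonneg _) (by positivity)).trans ?_
      nlinarith
    rw [hdiff]
    have f1 := norm_sub_le (C'.mul (Γ W) + D.mul (Γ W) - (Γ W).mul D)
      ((Γ W).mul (J X) + (Γ Y).mul (J W))
    have f2 := norm_sub_le (C'.mul (Γ W) + D.mul (Γ W)) ((Γ W).mul D)
    have f3 := norm_add_le (C'.mul (Γ W)) (D.mul (Γ W))
    have f4 := norm_add_le ((Γ W).mul (J X)) ((Γ Y).mul (J W))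
    linarith
  have hF0 : F 0 = C' := by
    have h1 : Γ 0 = 0 := by
      have := hΓs 0 0
      rw [sub_self, sub_zero] at this
      exact this.symm
    have h2 : ∀ M : Mat H, M.mul 0 = 0 := fun M => by
      have := M.mul_sub 0 0
      rwa [sub_self, sub_self] at this
    have h3 : ∀ M : Mat H, Mat.mul 0 M = 0 := fun M => by
      have := Mat.sub_mul 0 0 M
      rwa [sub_self, sub_self] at this
    simp only [F, h1, h2, h3, add_zero, sub_zero]
  -- The radius is twice `‖F 0‖ = ε`.
  obtain ⟨X, hX, hfix⟩ := exists_fixedPoint_of_half_lipschitz (F := F) (r := 2 * ε) (by positivity)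
    (by rw [hF0]; linarith) hlip
  refine ⟨k, X, D + J X, ?_, fun j n h => ?_, ?_⟩
  · have := (hΓ X).trans (mul_le_mul_of_nonneg_left hX hc₀pos.le)
    refine lt_of_le_of_lt this ?_
    linarith
  · rw [lp.coeFn_add, Pi.add_apply, hD j n fun h' => h (Or.inl
      ⟨h'.1.trans (by exact_mod_cast hmk.le), h'.2.trans (by exact_mod_cast hmk.le)⟩), zero_add]
    change scale (ind (InBlock k)) X (j, n) = 0
    rw [scale_apply (norm_ind_le _), ind, if_neg h, zero_smul]
  · change X - J X = C + C.mul (Γ X) - (D + J X) - (Γ X).mul (D + J X)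
    have h1 : C = C' + D := by rw [hDdef]; abel
    have h2 : (Γ X).mul (D + J X) = (Γ X).mul D + (Γ X).mul (J X) := by
      have := (Γ X).mul_sub (D + J X) (J X)
      rw [add_sub_cancel_right] at this
      rw [this]; abel
    have h3 : (C' + D).mul (Γ X) = C'.mul (Γ X) + D.mul (Γ X) := by
      have := Mat.sub_mul (C' + D) D (Γ X)
      rw [add_sub_cancel_right] at this
      rw [this]; abel
    have h4 : C' + C'.mul (Γ X) + D.mul (Γ X) - (Γ X).mul D - (Γ X).mul (J X) = X := hfix
    rw [h2, h1, h3]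
    exact regroup_fixedPoint h4

/-! ### Matrices and the resolvent of `d/ds` -/

/-- The matrix of the product of an operator with the resolvent of `d/ds`. -/
def mulRes (ω κ : ℝ) (M : Mat H) : Mat H := scale (fun q => resSymbol ω κ q.2) M

section

variable {κ : ℝ} (hκ : 0 < κ)

include hκ

lemma mulRes_apply (M : Mat H) (j n : ℤ) : mulRes ω κ M (j, n) = resSymbol ω κ n • M (j, n) :=
  scale_apply (γ := fun q => resSymbol ω κ q.2) (fun q => norm_resSymbol_le hκ q.2) M (j, n)

lemma norm_mulRes_le (M : Mat H) : ‖mulRes ω κ M‖ ≤ κ⁻¹ * ‖M‖ :=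
  norm_scale_le (fun q => norm_resSymbol_le hκ q.2) M

lemma res_character (n : ℤ) (v : H) :
    res ω H κ (character ω n v) = resSymbol ω κ n • character ω n v :=
  diag_character (norm_resSymbol_le hκ) n v

lemma ofMat_mulRes (M : Mat H) : ofMat ω (mulRes ω κ M) = ofMat ω M * res ω H κ :=
  op_ext_coeff fun j n v => by
    rw [mul_apply_eq_comp, res_character hκ, map_smul, map_smul, coeff_ofMat_character,
      coeff_ofMat_character, mulRes_apply hκ]
    rfl

lemma one_add_resSymbol_mul (j n : ℤ) :
    1 + resSymbol ω κ n * (eig ω j - eig ω n) = resSymbol ω κ n * (eig ω j - κ) := by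
  have h := inv_mul_cancel₀ (eig_sub_ne_zero (ω := ω) hκ n)
  rw [resSymbol]
  linear_combination -h

/-- This is `(A - κ)K = K(A - κ) + [A, K]` multiplied by the resolvent on both sides; `G` is the
matrix of `[A, K](A - κ)⁻¹`. -/
lemma ofMat_mul_res {K G : Mat H}
    (hG : ∀ j n, G (j, n) = (resSymbol ω κ n * (eig ω j - eig ω n)) • K (j, n)) :
    ofMat ω K * res ω H κ = res ω H κ * (ofMat ω K + ofMat ω G) :=
  op_ext_coeff fun j n v => by
    rw [mul_apply_eq_comp, mul_apply_eq_comp, res_character hκ, map_smul, map_smul, coeff_res hκ,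
      add_apply, map_add, coeff_ofMat_character, coeff_ofMat_character, hG, smul_apply, ← one_smul ℂ (K (j, n) v),
      smul_smul, smul_smul, ← add_smul, smul_smul, mul_one, mul_one, one_add_resSymbol_mul hκ,
      resSymbol, resSymbol]
    congr 1
    have := eig_sub_ne_zero (ω := ω) hκ j
    field_simp

end

/-! ### The operator `d/ds - B` is similar to a Hilbert–Schmidt perturbation of `d/ds` -/

section Hankel

variable {a : ℤ → H →L[ℂ] H} (ha : Summable fun n => ‖a n‖ ^ 2)

/-- The matrix solving the commutator equation for a Hankel perturbation. -/
def hankelComm (ω : ℝ) (a : ℤ → H →L[ℂ] H) : Mat H :=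
  toMat fun q => (eig ω (q.1 - q.2))⁻¹ • a (q.1 + q.2)

open Classical in
/-- The diagonal of a Hankel matrix together with its columns with indices `|n| ≤ m`. -/
def hankelDiag (m : ℕ) (a : ℤ → H →L[ℂ] H) : Mat H :=
  toMat fun q => if q.1 = q.2 ∨ |q.2| ≤ m then a (q.1 + q.2) else 0

include ha

/-- The pair `(j + n, j - n)` determines `(j, n)`, so the sum of squares is at most a product of two
convergent sums. The diagonal contributes nothing, as the inverse of `λ_0 = 0` is `0`. -/
lemma hankelComm_apply (j n : ℤ) :
    hankelComm ω a (j, n) = (eig ω (j - n))⁻¹ • a (j + n) := by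
  refine toMat_apply (f := fun q : ℤ × ℤ => (eig ω (q.1 - q.2))⁻¹ • a (q.1 + q.2)) ?_ (j, n)
  have h1 : Summable fun d : ℤ => ‖(eig ω d)⁻¹‖ ^ 2 := by
    refine (summable_inv_sq.mul_left ((ω / (2 * Real.pi)) ^ 2)).congr fun d => ?_
    rw [norm_inv, norm_eig, inv_div, ← div_div ω (2 * Real.pi), div_pow _ |(d : ℝ)|, sq_abs,
      div_eq_mul_inv _ ((d : ℝ) ^ 2)]
  have h2 := ha.mul_of_nonneg h1 (fun _ => sq_nonneg _) fun _ => sq_nonneg _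
  have hinj : Function.Injective fun q : ℤ × ℤ => (q.1 + q.2, q.1 - q.2) := by
    rintro ⟨a, b⟩ ⟨c, d⟩ h
    simp only [Prod.mk.injEq] at h ⊢
    omega
  refine (h2.comp_injective hinj).congr fun q => ?_
  rw [norm_smul, mul_pow, mul_comm]
  rfl

/-- The diagonal entries `a (n + n)` are terms of a square summable sequence at distinct places, and
there are finitely many further columns, each a translate of that sequence. -/
lemma hankelDiag_apply (m : ℕ) (j n : ℤ) [Decidable (j = n ∨ |n| ≤ m)] :
    hankelDiag m a (j, n) = if j = n ∨ |n| ≤ m then a (j + n) else 0 := by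
  classical
  have hs : Summable fun q : ℤ × ℤ =>
      ‖if q.1 = q.2 ∨ |q.2| ≤ m then a (q.1 + q.2) else 0‖ ^ 2 := by
    have h1 : Summable fun q : ℤ × ℤ => if q.1 = q.2 then ‖a (q.1 + q.2)‖ ^ 2 else 0 := by
      have hinj : Function.Injective fun n : ℤ => (n, n) := fun a b h => (Prod.mk.inj h).1
      refine (hinj.summable_iff fun q hq => ?_).1 ?_
      · rw [if_neg]
        intro h
        exact hq ⟨q.1, Prod.ext rfl h⟩
      · have hinj' : Function.Injective fun n : ℤ => n + n := fun a b h => by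
          simp only at h; omega
        refine (ha.comp_injective hinj').congr fun n => ?_
        simp
    have h2 := (hasSum_hankel_mul ha (r := fun n => if |n| ≤ m then 1 else 0)
      (fun n => by split_ifs <;> norm_num) (summable_of_ne_finset_zero (s := Finset.Icc (-(m : ℤ)) m)
        fun n hn => if_neg fun h => hn (Finset.mem_Icc.2 (abs_le.1 h)))).summable
    refine Summable.of_nonneg_of_le (fun _ => sq_nonneg _) (fun q => ?_) (h1.add h2)
    have := sq_nonneg ‖a (q.1 + q.2)‖
    by_cases h3 : q.1 = q.2 <;> by_cases h4 : |q.2| ≤ (m : ℤ) <;> simp [h3, h4]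
  rw [hankelDiag, toMat_apply hs]
  congr

end Hankel

/-- The product of a Hankel matrix and the solution of its commutator equation. -/
def HankelCommProduct (ω : ℝ) (a : ℤ → H →L[ℂ] H) (E : Mat H) : Prop :=
  ∀ j n, E (j, n) = ∑' p, (a (j + p)).comp ((eig ω (p - n))⁻¹ • a (p + n))

/-- As `λ_p - λ_n = (2πi/ω)(p - n)`, the sums in the hypothesis are the required entries up to the
constant `c`, whose sign comes from writing `n - p` for `p - n`. -/
lemma exists_hankelCommProduct {a : ℤ → H →L[ℂ] H}
    (h : Summable fun q : ℤ × ℤ => ‖∑' n : {n : ℤ // n ≠ q.2}, ((q.2 - n : ℤ) : ℂ)⁻¹ •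
      (a (q.1 + n)).comp (a (q.2 + n))‖ ^ 2) : ∃ E : Mat H, HankelCommProduct ω a E := by
  set c : ℂ := -(Complex.I * (2 * Real.pi / ω))⁻¹ with hc
  set T : ℤ × ℤ → H →L[ℂ] H := fun q => ∑' n : {n : ℤ // n ≠ q.2}, ((q.2 - n : ℤ) : ℂ)⁻¹ •
      (a (q.1 + n)).comp (a (q.2 + n)) with hT
  have hs : Summable fun q => ‖c • T q‖ ^ 2 := by
    simpa only [norm_smul, mul_pow] using h.mul_left (‖c‖ ^ 2)
  refine ⟨toMat fun q => c • T q, fun j n => ?_⟩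
  rw [toMat_apply hs, hT]
  simp only
  have h1 := tsum_subtype {p : ℤ | p ≠ n} fun p : ℤ => ((n - p : ℤ) : ℂ)⁻¹ •
      (a (j + p)).comp (a (n + p))
  refine (congrArg (c • ·) h1).trans ?_
  rw [← tsum_const_smul'']
  refine tsum_congr fun p => ?_
  -- The index excluded from the hypothesis contributes zero to the full sum, since `(eig ω 0)⁻¹ =
  -- 0`.
  by_cases hp : p = n
  · subst hp
    rw [Set.indicator_of_notMem (by simp)]
    simp [eig_zero]
  · rw [Set.indicator_of_mem (show p ∈ {p : ℤ | p ≠ n} from hp), ContinuousLinearMap.comp_smul,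
      smul_smul, add_comm n p]
    congr 1
    rw [hc, neg_mul, ← mul_inv, ← inv_neg, eig]
    congr 1
    push_cast
    ring

section Similarity

variable {a : ℤ → H →L[ℂ] H} (ha : Summable fun n => ‖a n‖ ^ 2) {E : Mat H}
  (hE : HankelCommProduct ω a E) (m : ℕ)

/-- Removal of the columns with indices `|n| ≤ m`. -/
def cutCols (m : ℕ) (M : Mat H) : Mat H := scale (ind fun q => ¬ |q.2| ≤ (m : ℤ)) M

open Classical in
lemma cutCols_apply (M : Mat H) (j n : ℤ) :
    cutCols m M (j, n) = if |n| ≤ (m : ℤ) then 0 else M (j, n) := by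
  rw [cutCols, scale_apply (norm_ind_le _), ind]
  by_cases h : |n| ≤ (m : ℤ) <;> simp [h]

include ha

/-- In operator terms `(B - N)R = [A, K₁]R`: the matrix `N` collects exactly the positions where
`K₁` was cut or its divisor vanishes. -/
lemma hankelRes_sub_apply {κ : ℝ} (hκ : 1 ≤ κ) (j n : ℤ) :
    (hankelRes ω κ a - mulRes ω κ (hankelDiag m a)) (j, n)
      = (resSymbol ω κ n * (eig ω j - eig ω n)) • cutCols m (hankelComm ω a) (j, n) := by
  classical
  rw [lp.coeFn_sub, Pi.sub_apply, hankelRes_apply ha hκ, mulRes_apply (by linarith),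
    hankelDiag_apply ha, cutCols_apply, hankelComm_apply ha, eig_sub]
  by_cases h1 : |n| ≤ (m : ℤ)
  · rw [if_pos (Or.inr h1), if_pos h1, sub_self, smul_zero]
  · rw [if_neg h1]
    by_cases h2 : j = n
    · subst h2; simp [eig_zero]
    · rw [if_neg (by tauto), smul_zero, sub_zero, smul_smul, mul_assoc,
        mul_inv_cancel₀ (eig_ne_zero (sub_ne_zero.2 h2)), mul_one]

include hE

/-- In operator terms `BR(K₁ + G₁) = BK₁R`. In the entries, the resolvent symbol at the summation
index `p` cancels against `λ_p - κ`, which leaves the sum defining `E`. -/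
lemma hankelRes_mul {κ : ℝ} (hκ : 1 ≤ κ) :
    (hankelRes ω κ a).mul (cutCols m (hankelComm ω a)
        + (hankelRes ω κ a - mulRes ω κ (hankelDiag m a)))
      = mulRes ω κ (cutCols m E) := by
  classical
  have hκ0 : 0 < κ := by linarith
  refine Mat.ext' fun j n => ?_
  rw [Mat.mul_apply, mulRes_apply hκ0, cutCols_apply]
  have h1 : ∀ p, (hankelRes ω κ a (j, p)).comp ((cutCols m (hankelComm ω a)
        + (hankelRes ω κ a - mulRes ω κ (hankelDiag m a)) : Mat H) (p, n))
      = resSymbol ω κ n • (if |n| ≤ (m : ℤ) then 0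
          else (a (j + p)).comp ((eig ω (p - n))⁻¹ • a (p + n))) := by
    intro p
    rw [lp.coeFn_add, Pi.add_apply, hankelRes_sub_apply ha m hκ,
      ← one_smul ℂ (cutCols m (hankelComm ω a) (p, n)), smul_smul, ← add_smul, mul_one,
      one_add_resSymbol_mul hκ0, hankelRes_apply ha hκ, cutCols_apply, hankelComm_apply ha]
    split_ifs
    · simp
    · rw [ContinuousLinearMap.comp_smul, ContinuousLinearMap.smul_comp, smul_smul, mul_assoc,
        resSymbol, resSymbol, mul_inv_cancel₀ (eig_sub_ne_zero hκ0 p), mul_one]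
  simp only [h1]
  rw [tsum_const_smul'']
  split_ifs
  · simp
  · rw [hE j n]

end Similarity

/-! ### Composition of the two similarities -/

lemma isUnit_one_add {A : Type*} [NormedRing A] [CompleteSpace A] {x : A} (hx : ‖x‖ < 1) :
    IsUnit (1 + x) := by
  have := isUnit_one_sub_of_norm_lt_one (x := -x) (by rwa [norm_neg])
  rwa [sub_neg_eq_add] at this

/-- Formally `C = (1 + K)⁻¹N`; iterating inside the space of square summable matrices keeps `C`
Hilbert–Schmidt. -/
lemma exists_add_mul_eq (K N : Mat H) (hK : ‖K‖ ≤ 1 / 2) : ∃ C : Mat H, C + K.mul C = N := by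
  have h0 : K.mul 0 = 0 := by
    have := K.mul_sub 0 0
    rwa [sub_self, sub_self] at this
  obtain ⟨C, -, hC⟩ := exists_fixedPoint_of_half_lipschitz (F := fun C : Mat H => N - K.mul C)
    (r := 2 * ‖N‖) (by positivity) (by simp [h0]) fun x y _ _ => by
      rw [sub_sub_sub_cancel_left, ← Mat.mul_sub, norm_sub_rev x y]
      exact (Mat.norm_mul_le _ _).trans (mul_le_mul_of_nonneg_right hK (norm_nonneg _))
  exact ⟨C, by nth_rewrite 1 [← hC]; exact sub_add_cancel _ _⟩

/-- The last two identities are `(A - B)U = U(A - Z)` in bounded form: `(A - B)R` is `1 + κR - ofMat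
ω (hankelRes ω κ a)`, and `UR = RU'` with `U'` invertible says that `U` maps the domain of `A` onto
itself. -/
theorem exists_similarity {a : ℤ → H →L[ℂ] H} (ha : Summable fun n => ‖a n‖ ^ 2) {E : Mat H}
    (hE : HankelCommProduct ω a E) :
    ∃ (k : ℕ) (Z : Mat H) (κ : ℝ) (U U' : (L2 ω H →L[ℂ] L2 ω H)ˣ), 1 ≤ κ ∧
      (∀ j n, ¬ InBlock k (j, n) → Z (j, n) = 0) ∧
      IsHilbertSchmidt ((U : L2 ω H →L[ℂ] L2 ω H) - 1) ∧
      (U : L2 ω H →L[ℂ] L2 ω H) * res ω H κ = res ω H κ * U' ∧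
      (1 + (κ : ℂ) • res ω H κ - ofMat ω (hankelRes ω κ a)) * U'
        = U * (1 + (κ : ℂ) • res ω H κ - ofMat ω Z * res ω H κ) := by
  obtain ⟨m, hm⟩ : ∃ m : ℕ, ‖cutCols m (hankelComm ω a)‖ < 1 / 2 := by
    refine ((tendsto_norm_scale_ind (fun q => ?_) (hankelComm ω a)).eventually
      (gt_mem_nhds (show (0 : ℝ) < 1 / 2 by norm_num))).exists
    filter_upwards [eventually_ge_atTop q.2.natAbs] with m hm
    rw [not_not, Int.abs_eq_natAbs]
    omega
  set K₁ := cutCols m (hankelComm ω a) with hK₁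
  set N := hankelDiag m a with hN
  obtain ⟨C, hC⟩ := exists_add_mul_eq K₁ (N + cutCols m E) hm.le
  obtain ⟨k, X, Z, hX, hZ, hXZ⟩ := exists_block_diagonalization ω C
  set K₂ := scale (commSymbol ω k) X with hK₂
  set G₂ := X - scale (ind (InBlock k)) X with hG₂
  -- The factors of `U'` are `1 + K + [A, K]R` for `K = K₁, K₂`. The norms of `K₁` and `K₂` are
  -- below `1` and independent of `κ`, while `[A, K]R` tends to zero, so both factors are invertible
  -- for large `κ`.
  have hlim1 : Tendsto (fun κ : ℝ => ‖hankelRes ω κ a‖ + κ⁻¹ * ‖N‖) atTop (𝓝 0) := by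
    simpa using (tendsto_norm_hankelRes (ω := ω) ha).add (tendsto_inv_atTop_zero.mul_const ‖N‖)
  have hlim2 : Tendsto (fun κ : ℝ => κ⁻¹ * ‖G₂‖) atTop (𝓝 0) := by
    simpa using tendsto_inv_atTop_zero.mul_const ‖G₂‖
  obtain ⟨κ, hκ, hκ1, hκ2⟩ := ((eventually_ge_atTop (1 : ℝ)).and
    ((hlim1.eventually (gt_mem_nhds (show (0 : ℝ) < 1 - ‖K₁‖ by linarith))).and
      (hlim2.eventually (gt_mem_nhds (show (0 : ℝ) < 1 - ‖K₂‖ by linarith))))).exists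
  have hκ0 : 0 < κ := by linarith
  set G₁ := hankelRes ω κ a - mulRes ω κ N with hG₁
  set R := res ω H κ with hR
  have hnormG₁ : ‖G₁‖ ≤ ‖hankelRes ω κ a‖ + κ⁻¹ * ‖N‖ :=
    (norm_sub_le _ _).trans (add_le_add le_rfl (norm_mulRes_le hκ0 N))
  have hnormG₂ : ‖mulRes ω κ G₂‖ ≤ κ⁻¹ * ‖G₂‖ := norm_mulRes_le hκ0 G₂
  have u1 : IsUnit (1 + ofMat ω K₁) :=
    isUnit_one_add (lt_of_le_of_lt (norm_ofMat_le K₁) (by linarith))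
  have u2 : IsUnit (1 + ofMat ω K₂) := isUnit_one_add (lt_of_le_of_lt (norm_ofMat_le K₂) hX)
  have u3 : IsUnit (1 + (ofMat ω K₁ + ofMat ω G₁)) := by
    refine isUnit_one_add (lt_of_le_of_lt (norm_add_le _ _) ?_)
    have := norm_ofMat_le (ω := ω) K₁
    have := norm_ofMat_le (ω := ω) G₁
    linarith
  have u4 : IsUnit (1 + (ofMat ω K₂ + ofMat ω (mulRes ω κ G₂))) := by
    refine isUnit_one_add (lt_of_le_of_lt (norm_add_le _ _) ?_)
    have := norm_ofMat_le (ω := ω) K₂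
    have := norm_ofMat_le (ω := ω) (mulRes ω κ G₂)
    linarith
  have r1 : ofMat ω K₁ * R = R * (ofMat ω K₁ + ofMat ω G₁) :=
    ofMat_mul_res hκ0 fun j n => hankelRes_sub_apply ha m hκ j n
  have r2 : ofMat ω K₂ * R = R * (ofMat ω K₂ + ofMat ω (mulRes ω κ G₂)) := by
    refine ofMat_mul_res hκ0 fun j n => ?_
    classical
    rw [mulRes_apply hκ0, hG₂, hK₂, lp.coeFn_sub, Pi.sub_apply, scale_apply (norm_ind_le _),
      scale_apply (norm_commSymbol_le k), ind, commSymbol, eig_sub]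
    by_cases h : InBlock k (j, n)
    · simp [h]
    · rw [if_neg h, if_neg h, zero_smul, sub_zero, smul_smul, mul_assoc,
        mul_inv_cancel₀ (eig_ne_zero (sub_ne_zero.2 fun h' => h (Or.inr h'))), mul_one]
  have b1 : ofMat ω (hankelRes ω κ a) * (ofMat ω K₁ + ofMat ω G₁) = ofMat ω (cutCols m E) * R := by
    rw [← ofMat_add, ← ofMat_mul, ← ofMat_mulRes hκ0, ← hankelRes_mul ha hE m hκ]
  have hC' : ofMat ω C + ofMat ω K₁ * ofMat ω C = ofMat ω N + ofMat ω (cutCols m E) := by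
    rw [← ofMat_mul, ← ofMat_add, hC, ofMat_add]
  have hG₁' : ofMat ω G₁ = ofMat ω (hankelRes ω κ a) - ofMat ω N * R := by
    rw [hG₁, ofMat_sub, ofMat_mulRes hκ0]
  have hG₂' : ofMat ω (mulRes ω κ G₂)
      = (ofMat ω C + ofMat ω C * ofMat ω K₂ - ofMat ω Z - ofMat ω K₂ * ofMat ω Z) * R := by
    rw [ofMat_mulRes hκ0, hXZ, ofMat_sub, ofMat_sub, ofMat_add, ofMat_mul, ofMat_mul]
  -- This is `(A - B)(1 + K₁) = (1 + K₁)(A - C)` times `R`; `s2` is the analogue `(A - C)(1 + K₂) =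
  -- (1 + K₂)(A - Z)`.
  have s1 : (1 + (κ : ℂ) • R - ofMat ω (hankelRes ω κ a)) * (1 + (ofMat ω K₁ + ofMat ω G₁))
      = (1 + ofMat ω K₁) * (1 + (κ : ℂ) • R - ofMat ω C * R) := by
    have e1 : (1 + ofMat ω K₁) * (ofMat ω C * R) = (ofMat ω N + ofMat ω (cutCols m E)) * R := by
      rw [← hC']; noncomm_ring
    rw [mul_add, mul_one, sub_mul, b1, add_mul, one_mul, smul_mul_assoc, ← r1, mul_sub, e1, mul_add,
      mul_one, mul_smul_comm, add_mul, add_mul, one_mul, smul_add, hG₁']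
    abel
  have s2 : (1 + (κ : ℂ) • R - ofMat ω C * R) * (1 + (ofMat ω K₂ + ofMat ω (mulRes ω κ G₂)))
      = (1 + ofMat ω K₂) * (1 + (κ : ℂ) • R - ofMat ω Z * R) := by
    have e1 : ofMat ω C * R * (ofMat ω K₂ + ofMat ω (mulRes ω κ G₂))
        = ofMat ω C * ofMat ω K₂ * R := by rw [mul_assoc, ← r2, mul_assoc]
    rw [mul_add, mul_one, sub_mul, e1, add_mul, one_mul, smul_mul_assoc, ← r2, mul_sub, mul_add,
      mul_one, mul_smul_comm, add_mul, add_mul, one_mul, one_mul, smul_add, hG₂', sub_mul, sub_mul,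
      add_mul]
    simp only [mul_assoc]
    abel
  refine ⟨k, Z, κ, u1.unit * u2.unit, u3.unit * u4.unit, hκ, hZ, ?_, ?_, ?_⟩
  · have : (((u1.unit * u2.unit : (L2 ω H →L[ℂ] L2 ω H)ˣ) : L2 ω H →L[ℂ] L2 ω H) - 1)
        = ofMat ω (K₁ + K₂ + K₁.mul K₂) := by
      rw [Units.val_mul, IsUnit.unit_spec, IsUnit.unit_spec, ofMat_add, ofMat_add, ofMat_mul]
      noncomm_ring
    rw [this]
    exact isHilbertSchmidt_ofMat _
  · simp only [Units.val_mul, IsUnit.unit_spec]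
    have e1 : (1 + ofMat ω K₁) * R = R * (1 + (ofMat ω K₁ + ofMat ω G₁)) := by
      rw [add_mul, one_mul, r1, mul_add R 1, mul_one]
    have e2 : (1 + ofMat ω K₂) * R = R * (1 + (ofMat ω K₂ + ofMat ω (mulRes ω κ G₂))) := by
      rw [add_mul, one_mul, r2, mul_add R 1, mul_one]
    rw [mul_assoc, e2, ← mul_assoc, e1, mul_assoc]
  · simp only [Units.val_mul, IsUnit.unit_spec]
    rw [← mul_assoc, s1, mul_assoc, s2, mul_assoc]

/-! ### Block diagonal matrices and the existence of the similar group -/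

section

variable {k : ℕ} {Z : Mat H} (hZ : ∀ j n, ¬ InBlock k (j, n) → Z (j, n) = 0)

include hZ

lemma ofMat_mem_HSubSum {x : L2 ω H} (hx : x ∈ HSubSum ω H k) :
    ofMat ω Z x ∈ HSubSum ω H k := by
  refine mem_HSubSum.2 (ext_coeff fun j => ?_)
  rw [coeff_PSum]
  split_ifs with hj
  · rfl
  · rw [coeff_ofMat, eq_comm]
    refine (tsum_congr fun n => ?_).trans tsum_zero
    by_cases hn : |n| ≤ (k : ℤ)
    · rw [hZ j n]
      · simp
      · rintro (h | h)
        · exact hj h.1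
        · simp only at h; exact hj (h ▸ hn)
    · rw [coeff_of_mem_HSubSum hx (not_le.1 hn), map_zero]

lemma coeff_ofMat_of_mem_HSub {l : ℤ} (hl : (k : ℤ) < |l|) {x : L2 ω H} (hx : x ∈ HSub ω H l)
    (j : ℤ) : coeff ω j (ofMat ω Z x) = if j = l then Z (l, l) (coeff ω l x) else 0 := by
  rw [coeff_ofMat, tsum_eq_single l fun n hn => by rw [coeff_of_mem_HSub hx hn, map_zero]]
  split_ifs with h
  · rw [h]
  · rw [hZ j l]
    · simp
    · rintro (h' | h')
      · exact absurd h'.2 (not_le.2 hl)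
      · exact h h'

/-- On `H_l` with `|l| > k` the operator `low` vanishes and the block is `-Z (l, l)`, so the square
summability of the blocks is that of the diagonal of `Z`. -/
lemma exists_isBlock_low_sub :
    ∃ (B₀ : HSubSum ω H k →L[ℂ] HSubSum ω H k)
      (B : ∀ l : {l : ℤ // (k : ℤ) < |l|}, HSub ω H l →L[ℂ] HSub ω H l),
      IsBlock k (low ω H k - ofMat ω Z) B₀ B ∧ Summable fun l => ‖B l‖ ^ 2 := by
  obtain ⟨A₀, A, hA⟩ := isBlock_low (ω := ω) (H := H) k
  have htail : ∀ l : ℤ, (k : ℤ) < |l| → ∀ x ∈ HSub ω H l, ofMat ω Z x ∈ HSub ω H l := by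
    intro l hl x hx
    refine mem_HSub.2 (ext_coeff fun j => ?_)
    rw [coeff_P, coeff_ofMat_of_mem_HSub hZ hl hx]
    split_ifs <;> rfl
  obtain ⟨B₀, B, hB⟩ := exists_restrict (M := low ω H k - ofMat ω Z) (k := k)
    (fun x hx => Submodule.sub_mem _ (hA.mem_center hx) (ofMat_mem_HSubSum hZ hx))
    (fun l hl x hx => Submodule.sub_mem _ (hA.mem_tail hl hx) (htail l hl x hx))
  refine ⟨B₀, B, hB, ?_⟩
  have hinj : Function.Injective fun l : {l : ℤ // (k : ℤ) < |l|} => ((l : ℤ), (l : ℤ)) :=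
    fun a b h => Subtype.ext (Prod.mk.inj h).1
  refine Summable.of_nonneg_of_le (fun _ => sq_nonneg _) (fun l => ?_)
    (Z.hasSum_norm_sq.summable.comp_injective hinj)
  refine pow_le_pow_left₀ (norm_nonneg (B l)) (?_ : ‖B l‖ ≤ ‖Z (l, l)‖) 2
  refine ContinuousLinearMap.opNorm_le_bound _ (norm_nonneg _) fun x => ?_
  change ‖((B l x : HSub ω H l) : L2 ω H)‖ ≤ _
  have h1 : ((B l x : HSub ω H l) : L2 ω H) = character ω l (-(Z (l, l) (coeff ω l x))) := by
    rw [← hB.tail l x]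
    refine ext_coeff fun j => ?_
    rw [sub_apply, map_sub, coeff_low, coeff_character, coeff_ofMat_of_mem_HSub hZ l.2 x.2]
    by_cases hj : j = l
    · rw [if_pos hj, if_pos hj, hj, lowSymbol, if_neg (not_le.2 l.2)]
      simp
    · rw [if_neg hj, if_neg hj, coeff_of_mem_HSub x.2 hj]
      simp
  rw [h1, norm_character, norm_neg]
  exact ((Z (l, l)).le_opNorm _).trans
    (mul_le_mul_of_nonneg_left (norm_coeff_le _ _) (norm_nonneg _))

end

/-- The group `T` is the block group of `A - Z` conjugated by `U`; what needs proof is that its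
generator has exactly the domain and the values of `L`. -/
theorem exists_isSimilarGroupData (V : ℝ → H →L[ℂ] H)
    (hV : ∀ x : H, MemLp (fun s => V s x) 2 (μ ω))
    (hV2 : Summable fun n : ℤ => ‖potentialCoeff ω V hV n‖ ^ 2)
    (hV3 : Summable fun q : ℤ × ℤ => ‖∑' n : {n : ℤ // n ≠ q.2}, ((q.2 - n : ℤ) : ℂ)⁻¹ •
        (potentialCoeff ω V hV (q.1 + n)).comp (potentialCoeff ω V hV (q.2 + n))‖ ^ 2) :
    ∃ T U k B₀ B, IsSimilarGroupData (ω := ω) V T U k B₀ B := by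
  obtain ⟨E, hE⟩ := exists_hankelCommProduct (ω := ω) hV3
  obtain ⟨k, Z, κ, U, U', hκ, hZ, hU, hUR, hUL⟩ := exists_similarity hV2 hE
  obtain ⟨B₀, B, hB, hBs⟩ := exists_isBlock_low_sub (ω := ω) hZ
  have hκ0 : 0 < κ := by linarith
  set M := low ω H k - ofMat ω Z with hM
  set R := res ω H κ with hR
  set T : ℝ → L2 ω H →L[ℂ] L2 ω H := fun t =>
    (U : L2 ω H →L[ℂ] L2 ω H) * blockGroup k M t * (↑U⁻¹ : L2 ω H →L[ℂ] L2 ω H) with hT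
  have hUU : ∀ x, (U : L2 ω H →L[ℂ] L2 ω H) ((↑U⁻¹ : L2 ω H →L[ℂ] L2 ω H) x) = x := fun x => by
    rw [← mul_apply_eq_comp, Units.mul_inv]; rfl
  have hUU' : ∀ x, (↑U⁻¹ : L2 ω H →L[ℂ] L2 ω H) ((U : L2 ω H →L[ℂ] L2 ω H) x) = x := fun x => by
    rw [← mul_apply_eq_comp, Units.inv_mul]; rfl
  have hU'U' : ∀ x, (U' : L2 ω H →L[ℂ] L2 ω H) ((↑U'⁻¹ : L2 ω H →L[ℂ] L2 ω H) x) = x := fun x => by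
    rw [← mul_apply_eq_comp, Units.mul_inv]; rfl
  have hURx : ∀ x, (U : L2 ω H →L[ℂ] L2 ω H) (R x) = R ((U' : L2 ω H →L[ℂ] L2 ω H) x) := fun x =>
    DFunLike.congr_fun hUR x
  have hULx : ∀ x, (U' : L2 ω H →L[ℂ] L2 ω H) x + (κ : ℂ) • R ((U' : L2 ω H →L[ℂ] L2 ω H) x)
        - ofMat ω (hankelRes ω κ (potentialCoeff ω V hV)) ((U' : L2 ω H →L[ℂ] L2 ω H) x)
      = (U : L2 ω H →L[ℂ] L2 ω H) (x + (κ : ℂ) • R x - ofMat ω Z (R x)) := fun x =>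
    DFunLike.congr_fun hUL x
  have hC0 := hB.isC0Group_blockGroup
  -- Conjugation by `U` carries the graph of `A - Z`, parametrized through `R`, to the graph of `A -
  -- B`, and `U'` is the change of parameter.
  have hderiv : ∀ y f : L2 ω H, HasDerivAt (fun t => T t y) f 0 ↔ ∃ w, y = R w ∧
      f = w + (κ : ℂ) • R w - ofMat ω (hankelRes ω κ (potentialCoeff ω V hV)) w := by
    intro y f
    have h1 : HasDerivAt (fun t => T t y) f 0 ↔
        HasDerivAt (fun t => blockGroup k M t ((↑U⁻¹ : L2 ω H →L[ℂ] L2 ω H) y))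
          ((↑U⁻¹ : L2 ω H →L[ℂ] L2 ω H) f) 0 := by
      constructor
      · intro h
        have := ((↑U⁻¹ : L2 ω H →L[ℂ] L2 ω H).restrictScalars ℝ).hasFDerivAt.comp_hasDerivAt
          (0 : ℝ) h
        refine this.congr_of_eventuallyEq (Eventually.of_forall fun t => ?_)
        exact (hUU' _).symm
      · intro h
        have := ((U : L2 ω H →L[ℂ] L2 ω H).restrictScalars ℝ).hasFDerivAt.comp_hasDerivAt
          (0 : ℝ) h
        have h2 : HasDerivAt (fun t => T t y)
            ((U : L2 ω H →L[ℂ] L2 ω H) ((↑U⁻¹ : L2 ω H →L[ℂ] L2 ω H) f)) 0 := this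
        rwa [hUU] at h2
    rw [h1, hasDerivAt_blockGroup_iff, eq_res_iff hκ0]
    have hMl : M - low ω H k = -ofMat ω Z := by rw [hM]; abel
    rw [hMl]
    constructor
    · rintro ⟨w, hw1, hw2⟩
      refine ⟨(U' : L2 ω H →L[ℂ] L2 ω H) w, ?_, ?_⟩
      · rw [← hURx, ← hw1, hUU]
      · rw [hULx, ← hw2, ← hw1, neg_apply, sub_neg_eq_add, add_sub_cancel_right, hUU]
    · rintro ⟨w, rfl, rfl⟩
      have h2 : R w = (U : L2 ω H →L[ℂ] L2 ω H) (R ((↑U'⁻¹ : L2 ω H →L[ℂ] L2 ω H) w)) := by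
        rw [hURx, hU'U']
      have h3 := hULx ((↑U'⁻¹ : L2 ω H →L[ℂ] L2 ω H) w)
      rw [hU'U'] at h3
      refine ⟨(↑U'⁻¹ : L2 ω H →L[ℂ] L2 ω H) w, ?_, ?_⟩
      · rw [h2, hUU']
      · rw [h3, hUU', h2, hUU', neg_apply]
        abel
  have hsob : ∀ w : L2 ω H, IsPeriodicSobolev (R w) (w + (κ : ℂ) • R w) := fun w =>
    isPeriodicSobolev_iff.2 ((eq_res_iff hκ0).2 ⟨w, rfl, rfl⟩)
  refine ⟨T, U, k, B₀, B, ⟨⟨?_, fun s t => ?_, fun x => ?_⟩, fun y => ?_, fun y f hf => ?_⟩, hU, hBs,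
    fun t => ?_⟩
  · rw [hT]
    simp only [hC0.zero, mul_one, Units.mul_inv]
  · simp only [hT, hC0.add]
    ext1 x
    simp only [mul_apply_eq_comp, hUU']
  · exact (U : L2 ω H →L[ℂ] L2 ω H).continuous.comp (hC0.cont _)
  · simp only [hderiv]
    constructor
    · rintro ⟨g, hg⟩
      obtain ⟨w, hw, -⟩ := (eq_res_iff hκ0).1 (isPeriodicSobolev_iff.1 hg)
      exact ⟨_, w, hw, rfl⟩
    · rintro ⟨f, w, rfl, -⟩
      exact ⟨_, hsob w⟩
  · obtain ⟨w, rfl, rfl⟩ := (hderiv y f).1 hf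
    refine ⟨_, hsob w, ?_⟩
    filter_upwards [potential_reflect_ae_eq hV2 hκ w, Lp.coeFn_sub (w + (κ : ℂ) • R w)
      (ofMat ω (hankelRes ω κ (potentialCoeff ω V hV)) w)] with s h1 h2
    rw [h2, Pi.sub_apply, h1]
  · have : similarGroup T U t = blockGroup k M t := by
      ext1 x
      simp only [similarGroup, hT, mul_apply_eq_comp, hUU']
    rw [this]
    exact hB.isDirectSum_blockGroup t

end

end InvolutionGroup

theorem corollary2p1 {H : Type*} [NormedAddCommGroup H] [InnerProductSpace ℂ H] [CompleteSpace H]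
    (ω : ℝ) [Fact (0 < ω)] (V : ℝ → H →L[ℂ] H)
    (hV : ∀ x : H, MemLp (fun s => V s x) 2 (InvolutionGroup.μ ω))
    (hV2 : Summable fun n : ℤ => ‖InvolutionGroup.potentialCoeff ω V hV n‖ ^ 2)
    (hV3 : Summable fun q : ℤ × ℤ =>
      ‖∑' n : {n : ℤ // n ≠ q.2}, ((q.2 - n : ℤ) : ℂ)⁻¹ •
        (InvolutionGroup.potentialCoeff ω V hV (q.1 + n)).comp
          (InvolutionGroup.potentialCoeff ω V hV (q.2 + n))‖ ^ 2) :
    (∃ T U k B₀ B, InvolutionGroup.IsSimilarGroupData (ω := ω) V T U k B₀ B) ∧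
    ∀ T U k B₀ B, InvolutionGroup.IsSimilarGroupData (ω := ω) V T U k B₀ B →
      ∃ Φl Φr : ℂ → InvolutionGroup.L2 ω H →L[ℂ] InvolutionGroup.L2 ω H,
        InvolutionGroup.IsEntireOfExponentialType Φl ∧
        InvolutionGroup.IsEntireOfExponentialType Φr ∧
        (∀ t : ℝ, InvolutionGroup.similarGroup T U t = InvolutionGroup.S ω t * Φr t ∧
          InvolutionGroup.similarGroup T U t = Φl t * InvolutionGroup.S ω t) ∧
        (∀ j : ℤ, (k : ℤ) < |j| → ∀ x ∈ InvolutionGroup.HSub ω H j, ∀ z : ℂ,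
          Φl z x = Φr z x) ∧
        ∀ z : ℂ, max ‖Φl z‖ ‖Φr z‖ ≤
          Real.exp (InvolutionGroup.growthBound k B₀ B * ‖z‖) :=
  ⟨InvolutionGroup.exists_isSimilarGroupData V hV hV2 hV3,
    fun _ _ _ _ _ h => InvolutionGroup.exists_entire_factors h⟩
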